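/- For a nonzero integer $d$ write $\chi_d=\left(\frac{d}{\cdot}\right)$ for the Kronecker symbol; fundamental discriminants include $1$. **Definitions.** For a fundamental discriminant $D_0>0$ and an integral binary quadratic form $[a,b,c]$ with $a>0$ and discriminant $b^2-4ac=DD_0$, $D$ a positive discriminant, let $\chi_{D_0}[a,b,c]=\left(\frac{D_0}{n}\right)$ if $\gcd(a,b,c,D_0)=1$, where $n$ is any positive integer coprime to $D_0$ represented by $[a,b,c]$, and $\chi_{D_0}[a,b,c]=0$ otherwise. For integers $k>1$, $N\ge 1$ put $$c_\infty(N,DD_0)=\frac{(DD_0)^{k-\frac12}}{2k-1}\,\pi\,2^{2-2k}\sum_{\substack{a\ge1\\ N\mid a}}\frac1{a^k}\sum_{\substack{0\le b<2a\\ b^2\equiv DD_0\ (4a)}}\chi_{D_0}\!\left[a,b,\tfrac{b^2-DD_0}{4a}\right],\qquad \gamma_{k,N,DD_0}=\frac{(-1)^k2^{2k-2}}{\pi\binom{2k-2}{k-1}}\,c_\infty(N,DD_0).$$ For an integer $\kappa<0$, $\ell\ge1$ and $n\in\mathbb Z$, the Pei–Wang generalized Hurwitz class number is $$H(\kappa,1,\ell,\ell;n)=L_\ell(1-\kappa,\chi_t)\sum_{\substack{a\mid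 m\\ \gcd(a,\ell)=1}}\mu(a)\chi_t(a)a^{\kappa-1}\sigma_{\ell,2\kappa-1}\!\left(\tfrac ma\right)\quad\text{if }(-1)^\kappa n=tm^2\ne0,\ t\text{ fundamental},\ m\ge1,$$ $H(\kappa,1,\ell,\ell;0)=L_\ell(1-2\kappa,\mathrm{id})$, and $H(\kappa,1,\ell,\ell;n)=0$ for all other $n$. Here $\mathrm{id}(r)=1$ for all $r$, $L_\ell(s,\chi)=\sum_{r\ge1,\ \gcd(r,\ell)=1}\chi(r)r^{-s}$ and $\sigma_{\ell,s}(n)=\sum_{0<r\mid n,\ \gcd(r,\ell)=1}r^s$. **Theorem.** Let $k>1$ be an integer, $N$ a square-free positive integer, $D_0>0$ a fundamental discriminant, and $D=\widetilde D f_D^2$ with a fundamental discriminant $\widetilde D>0$ and an integer $f_D\ge1$. Then the series over $a$ defining $c_\infty(N,DD_0)$ converges absolutely, and $$\frac{2k-1}{(DD_0)^{k-\frac12}}\,c_\infty(N,DD_0)=\frac{\pi}{2^{2k-2}}\cdot\frac{2k-1}{(DD_0)^{k-\frac12}}\cdot\frac{\binom{2k-2}{k-1}}{(-1)^k}\,\gamma_{k,N,DD_0}$$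 $$=\frac{\pi}{2^{2k-2}\,\zeta(2k)}\sum_{\ell\mid N}\mu(\ell)\Big(\prod_{p\mid\ell}\frac1{1-p^{-2k}}\Big)H\big(1-k,1,\ell,\ell;(-1)^{k-1}D\big)\,H\big(1-k,1,\ell,\ell;(-1)^{k-1}D_0\big).$$ -/

import Mathlib

/-- `d` is a fundamental discriminant: `1` or the discriminant of a quadratic number field. -/
def IsFundamentalDiscriminant (d : ℤ) : Prop :=
  (d % 4 = 1 ∧ Squarefree d) ∨
    ∃ m : ℤ, d = 4 * m ∧ (m % 4 = 2 ∨ m % 4 = 3) ∧ Squarefree m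

/-- The Kronecker symbol `(d / n)` for an integer `d` and a natural number `n`.  At the prime `2` it
is `0` for even `d`, `1` for `d ≡ ±1 (mod 8)` and `-1` for `d ≡ ±3 (mod 8)` (this is `ZMod.χ₈`), and
on the odd part of `n` it is the Jacobi symbol. -/
def kroneckerSymbol (d : ℤ) (n : ℕ) : ℤ :=
  if n = 0 then (if d.natAbs = 1 then 1 else 0)
  else ZMod.χ₈ (d : ZMod 8) ^ n.factorization 2 * jacobiSym d (n / 2 ^ n.factorization 2)

open Classical in
/-- The genus character `χ_{D₀}` at the integral binary quadratic form `[a, b, c]`: it is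
`(D₀ / n)` for any positive integer `n` coprime to `D₀` that is represented by the form when
`gcd (a, b, c, D₀) = 1`, and it is `0` otherwise.  (For a fundamental discriminant `D₀` dividing
`b ^ 2 - 4 * a * c` with quotient a discriminant, the value does not depend on the choice of `n`.
Such an `n` exists when `a > 0` and `gcd (a, b, c, D₀) = 1`.) -/
noncomputable def genusCharacter (D₀ a b c : ℤ) : ℤ :=
  if h : Int.gcd (Int.gcd a b) (Int.gcd c D₀) = 1 ∧
      ∃ n : ℕ, 0 < n ∧ Int.gcd n D₀ = 1 ∧ ∃ x y : ℤ, a * x ^ 2 + b * x * y + c * y ^ 2 = n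
  then kroneckerSymbol D₀ h.2.choose
  else 0

/-- The inner sum over the residues `0 ≤ b < 2 * a` with `b ^ 2 ≡ Δ (mod 4 * a)` of
`χ_{D₀} [a, b, (b ^ 2 - Δ) / (4 * a)]`. -/
noncomputable def genusSum (Δ D₀ : ℤ) (a : ℕ) : ℤ :=
  ∑ b ∈ (Finset.range (2 * a)).filter (fun b : ℕ => (4 * a : ℤ) ∣ (b : ℤ) ^ 2 - Δ),
    genusCharacter D₀ a b (((b : ℤ) ^ 2 - Δ) / (4 * a))

/-- The `a`-th term of the series defining `c_∞ (N, Δ)`; it vanishes unless `a ≥ 1` and `N ∣ a`. -/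
noncomputable def cInftyTerm (k N : ℕ) (Δ D₀ : ℤ) (a : ℕ) : ℝ :=
  if 0 < a ∧ N ∣ a then 1 / (a : ℝ) ^ k * (genusSum Δ D₀ a : ℝ) else 0

/-- The constant `c_∞ (N, Δ)`, for `Δ = D * D₀`; it depends also on `k` and on `D₀`. -/
noncomputable def cInfty (k N : ℕ) (Δ D₀ : ℤ) : ℝ :=
  (Δ : ℝ) ^ ((k : ℝ) - 1 / 2) / (2 * (k : ℝ) - 1) * Real.pi * (2 : ℝ) ^ (2 - 2 * (k : ℤ)) *
    ∑' a : ℕ, cInftyTerm k N Δ D₀ a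

/-- The constant `γ_{k, N, Δ}`, for `Δ = D * D₀`. -/
noncomputable def gammaConst (k N : ℕ) (Δ D₀ : ℤ) : ℝ :=
  (-1 : ℝ) ^ k * (2 : ℝ) ^ (2 * (k : ℤ) - 2) / (Real.pi * ((2 * k - 2).choose (k - 1) : ℝ)) *
    cInfty k N Δ D₀

/-- The incomplete `L`-series `L_N (s, χ) = ∑_{gcd (n, N) = 1} χ(n) n ^ (-s)`, for `Re s > 1`. -/
noncomputable def incompleteL (N : ℕ) (χ : ℕ → ℂ) (s : ℂ) : ℂ :=
  LSeries (fun n => if n.Coprime N then χ n else 0) s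

/-- The divisor sum `σ_{N, s} (n) = ∑ r ^ s` over the divisors `r` of `n` coprime to `N`. -/
noncomputable def coprimeSigma (N : ℕ) (s : ℤ) (n : ℕ) : ℂ :=
  ∑ r ∈ n.divisors.filter (fun r => r.Coprime N), (r : ℂ) ^ s

open Classical in
/-- The generalized Hurwitz class number `H(κ, 1, N, N; n)` of Pei and Wang, at negative integers
`κ`, where both `L`-values in it are values of absolutely convergent series.  The fundamental
discriminant `t` and the integer `m ≥ 1` with `(-1) ^ κ * n = t * m ^ 2` are unique. -/
noncomputable def hurwitzClassNumber (κ : ℤ) (N : ℕ) (n : ℤ) : ℂ :=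
  if n = 0 then incompleteL N (fun _ => 1) (1 - 2 * κ)
  else if h : ∃ q : ℤ × ℕ, IsFundamentalDiscriminant q.1 ∧ 0 < q.2 ∧
      (κ.negOnePow : ℤ) * n = q.1 * (q.2 : ℤ) ^ 2 then
    let t : ℤ := h.choose.1
    let m : ℕ := h.choose.2
    incompleteL N (fun j => (kroneckerSymbol t j : ℂ)) (1 - κ) *
      ∑ a ∈ m.divisors.filter (fun a => a.Coprime N),
        (ArithmeticFunction.moebius a : ℂ) * (kroneckerSymbol t a : ℂ) * (a : ℂ) ^ (κ - 1) *
          coprimeSigma N (2 * κ - 1) (m / a)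
  else 0

/-! Let `E = Dt * f ^ 2` and `S a = genusSum (D₀ * E) D₀ a`. The heart of the matter is that `S` is
multiplicative and has Dirichlet series `L(s, χ_{D₀}) L(s, χ_{Dt}) ζ(2s)⁻¹ ∑_{d ∣ f} μ(d) χ_{Dt}(d)
d⁻ˢ σ_{1-2s}(f/d)`. `genusArith_eq` states this as a convolution identity of integer-valued
arithmetic functions. Multiplication by the principal character modulo `ℓ` distributes over
convolution, so it removes the Euler factors at `p ∣ ℓ`; at `s = k` the right side becomes two
generalized Hurwitz class numbers divided by `ζ(2k) ∏_{p ∣ ℓ} (1 - p⁻²ᵏ)`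
(`lseriesHasSum_genusArith`). For square-free `N`, `∑_{ℓ ∣ N} μ(ℓ) [gcd(a, ℓ) = 1] = [N ∣ a]`, and a
finite combination over `ℓ` gives the series of `c_∞` together with its convergence.

Multiplicativity of `S` combines the Chinese remainder theorem for `b` with composition of forms for
the genus character. The latter is well defined because four times a product of two represented
numbers has the shape `x² - D₀ E y²`, and reciprocity gives `(D₀ / n) = 1` whenever `4n` has that
shape and `n` is prime to `D₀` (`kroneckerSymbol_norm`).

For the Euler factor at `p`: if `p ∤ D₀`, the form `[pᵛ, b, c]` represents `pᵛ`, and `S(pᵛ)` is `(D₀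
/ p)ᵛ` times a count of square roots. If `p ∣ D₀`, write `D₀ = P e` with `P` a prime discriminant at
`p`; for `v ≥ 1` the form contributes `(e / p)ᵛ ψ(c)`, where `ψ` is the character of `P`. These sums
are evaluated when `p ∤ f` (`genusSeries_base`), and replacing `E` by `p² E` gives a recursion
(`genusSeries_sq_mul`) that matches the recursion of the conductor factor. -/

/-! ### The Kronecker symbol and reciprocity. -/

theorem kroneckerSymbol_of_ne_zero (d : ℤ) {n : ℕ} (hn : n ≠ 0) :
    kroneckerSymbol d n = ZMod.χ₈ (d : ZMod 8) ^ n.factorization 2 *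
      jacobiSym d (n / 2 ^ n.factorization 2) := by
  simp [kroneckerSymbol, hn]

theorem kroneckerSymbol_one_right (d : ℤ) : kroneckerSymbol d 1 = 1 := by
  simp [kroneckerSymbol]

theorem kroneckerSymbol_mul_right (d : ℤ) {m n : ℕ} (hm : m ≠ 0) (hn : n ≠ 0) :
    kroneckerSymbol d (m * n) = kroneckerSymbol d m * kroneckerSymbol d n := by
  have h1 : m / 2 ^ m.factorization 2 ≠ 0 := (Nat.ordCompl_pos 2 hm).ne'
  have h2 : n / 2 ^ n.factorization 2 ≠ 0 := (Nat.ordCompl_pos 2 hn).ne'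
  rw [kroneckerSymbol_of_ne_zero d (mul_ne_zero hm hn), kroneckerSymbol_of_ne_zero d hm,
    kroneckerSymbol_of_ne_zero d hn, Nat.ordCompl_mul, Nat.factorization_mul hm hn,
    jacobiSym.mul_right' _ h1 h2, Finsupp.add_apply, pow_add]
  ring

theorem kroneckerSymbol_pow_right (d : ℤ) {m : ℕ} (hm : m ≠ 0) (v : ℕ) :
    kroneckerSymbol d (m ^ v) = kroneckerSymbol d m ^ v := by
  induction v with
  | zero => simp [kroneckerSymbol_one_right]
  | succ v ih => rw [pow_succ, kroneckerSymbol_mul_right d (pow_ne_zero v hm) hm, ih, pow_succ]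

theorem kroneckerSymbol_mul_left (d e : ℤ) {n : ℕ} (hn : n ≠ 0) :
    kroneckerSymbol (d * e) n = kroneckerSymbol d n * kroneckerSymbol e n := by
  rw [kroneckerSymbol_of_ne_zero _ hn, kroneckerSymbol_of_ne_zero _ hn,
    kroneckerSymbol_of_ne_zero _ hn, jacobiSym.mul_left, Int.cast_mul, map_mul, mul_pow]
  ring

theorem kroneckerSymbol_of_odd (d : ℤ) {n : ℕ} (hn : Odd n) :
    kroneckerSymbol d n = jacobiSym d n := by
  have h : n.factorization 2 = 0 :=
    Nat.factorization_eq_zero_of_not_dvd (by rw [← even_iff_two_dvd]; simpa using hn)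
  rw [kroneckerSymbol_of_ne_zero _ hn.pos.ne', h]
  simp

theorem kroneckerSymbol_two (d : ℤ) : kroneckerSymbol d 2 = ZMod.χ₈ (d : ZMod 8) := by
  rw [kroneckerSymbol_of_ne_zero _ two_ne_zero, Nat.Prime.factorization_self Nat.prime_two]
  simp

theorem kroneckerSymbol_one_left (n : ℕ) : kroneckerSymbol 1 n = 1 := by
  by_cases hn : n = 0
  · simp [kroneckerSymbol, hn]
  · simp [kroneckerSymbol_of_ne_zero _ hn]

theorem kroneckerSymbol_two_pow_mul_odd (d : ℤ) (k : ℕ) {m : ℕ} (hm : Odd m) :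
    kroneckerSymbol d (2 ^ k * m) = ZMod.χ₈ (d : ZMod 8) ^ k * jacobiSym d m := by
  rw [kroneckerSymbol_mul_right _ (by positivity) hm.pos.ne', kroneckerSymbol_of_odd _ hm,
    kroneckerSymbol_pow_right _ two_ne_zero, kroneckerSymbol_two]

theorem zmod_eight_sq_of_odd : ∀ d : ZMod 8, ZMod.χ₈ d = 0 ∨ ZMod.χ₈ d ^ 2 = 1 := by decide

theorem χ₈_eq_zero_iff (d : ℤ) : ZMod.χ₈ (d : ZMod 8) = 0 ↔ d % 2 = 0 := by
  rw [ZMod.χ₈_int_eq_if_mod_eight]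
  split_ifs <;> simp_all

theorem kroneckerSymbol_sq_of_coprime {d : ℤ} {n : ℕ} (hn : n ≠ 0) (h : Int.gcd n d = 1) :
    kroneckerSymbol d n ^ 2 = 1 := by
  obtain ⟨k, m, hm, rfl⟩ := Nat.exists_eq_two_pow_mul_odd hn
  rw [kroneckerSymbol_two_pow_mul_odd _ _ hm, mul_pow, ← pow_mul, mul_comm k 2, pow_mul]
  have hc : IsCoprime (((2 ^ k * m : ℕ) : ℤ)) d := Int.isCoprime_iff_gcd_eq_one.mpr h
  push_cast at hc
  have h1 : jacobiSym d m ^ 2 = 1 :=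
    jacobiSym.sq_one (Int.isCoprime_iff_gcd_eq_one.mp hc.of_mul_left_right.symm)
  rw [h1, mul_one]
  rcases Nat.eq_zero_or_pos k with rfl | hk
  · simp
  rcases zmod_eight_sq_of_odd (d : ZMod 8) with h2 | h2
  · rw [χ₈_eq_zero_iff] at h2
    have h3 : IsCoprime (2 : ℤ) d := (IsCoprime.pow_left_iff hk).mp hc.of_mul_left_left
    have := h3.isUnit_of_dvd' (dvd_refl 2) (Int.dvd_of_emod_eq_zero h2)
    exact absurd this (by decide)
  · rw [h2, one_pow]

theorem kroneckerSymbol_eq_zero_of_prime_dvd {d : ℤ} {p : ℕ} (hp : p.Prime) (h : (p : ℤ) ∣ d) :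
    kroneckerSymbol d p = 0 := by
  rcases hp.eq_two_or_odd' with rfl | hodd
  · rw [kroneckerSymbol_two, χ₈_eq_zero_iff]; omega
  · have := Fact.mk hp
    rw [kroneckerSymbol_of_odd _ hodd, ← jacobiSym.legendreSym.to_jacobiSym, legendreSym.eq_zero_iff]
    exact (ZMod.intCast_zmod_eq_zero_iff_dvd _ _).mpr h

theorem abs_kroneckerSymbol_le_one (d : ℤ) (n : ℕ) : |kroneckerSymbol d n| ≤ 1 := by
  by_cases hn : n = 0
  · simp only [kroneckerSymbol, hn, if_true]; split_ifs <;> simp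
  obtain ⟨k, m, hm, rfl⟩ := Nat.exists_eq_two_pow_mul_odd hn
  rw [kroneckerSymbol_two_pow_mul_odd _ _ hm, abs_mul, abs_pow]
  have h1 : |ZMod.χ₈ (d : ZMod 8)| ≤ 1 := by
    generalize (d : ZMod 8) = x; revert x; decide
  have h2 : |jacobiSym d m| ≤ 1 := by
    rcases jacobiSym.trichotomy d m with h | h | h <;> rw [h] <;> simp
  calc _ ≤ 1 * 1 := mul_le_mul (pow_le_one₀ (abs_nonneg _) h1) h2 (abs_nonneg _) zero_le_one
    _ = 1 := one_mul 1

/-- For `d = -e` with `e ≡ 3 (mod 4)`, the sign `(-1 / n)` equals the sign in the reciprocity law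
for `e` and `n`, so the two cancel. -/
theorem jacobiSym_eq_of_mod_four_eq_one {d : ℤ} (hd : d % 4 = 1) {n : ℕ} (hn : Odd n) :
    jacobiSym d n = jacobiSym n d.natAbs := by
  rcases le_total 0 d with h | h
  · lift d to ℕ using h
    rw [Int.natAbs_natCast]
    exact jacobiSym.quadratic_reciprocity_one_mod_four (by omega) hn
  · obtain ⟨e, rfl⟩ : ∃ e : ℕ, d = -(e : ℤ) := ⟨d.natAbs, by omega⟩
    have he : e % 4 = 3 := by omega
    rw [Int.natAbs_neg, Int.natAbs_natCast, jacobiSym.neg _ hn]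
    rcases Nat.odd_mod_four_iff.mp (Nat.odd_iff.mp hn) with h4 | h4
    · rw [ZMod.χ₄_nat_one_mod_four h4, one_mul]
      exact (jacobiSym.quadratic_reciprocity_one_mod_four h4
        (Nat.odd_iff.mpr (by omega))).symm
    · rw [ZMod.χ₄_nat_three_mod_four h4, jacobiSym.quadratic_reciprocity_three_mod_four he h4]
      ring

/-- Quadratic reciprocity for the Kronecker symbol of a discriminant `d ≡ 1 (mod 4)`. -/
theorem kroneckerSymbol_eq_jacobiSym {d : ℤ} (hd : d % 4 = 1) {n : ℕ} (hn : n ≠ 0) :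
    kroneckerSymbol d n = jacobiSym n d.natAbs := by
  obtain ⟨k, m, hm, rfl⟩ := Nat.exists_eq_two_pow_mul_odd hn
  have hodd : Odd d.natAbs := Nat.odd_iff.mpr (by omega)
  rw [kroneckerSymbol_two_pow_mul_odd _ _ hm, jacobiSym_eq_of_mod_four_eq_one hd hm]
  push_cast
  rw [jacobiSym.mul_left, jacobiSym.pow_left, jacobiSym.at_two hodd]
  congr 2
  rw [ZMod.χ₈_int_eq_if_mod_eight, ZMod.χ₈_nat_eq_if_mod_eight]
  split_ifs <;> first | rfl | omega

theorem kroneckerSymbol_neg_four {n : ℕ} (hn : n ≠ 0) : kroneckerSymbol (-4) n = ZMod.χ₄ n := by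
  obtain ⟨k, m, hm, rfl⟩ := Nat.exists_eq_two_pow_mul_odd hn
  rw [kroneckerSymbol_two_pow_mul_odd _ _ hm]
  rcases Nat.eq_zero_or_pos k with rfl | hk
  · have h2 : jacobiSym (2 : ℤ) m * jacobiSym 2 m = 1 := by
      rw [← pow_two]
      exact jacobiSym.sq_one (by simpa [Int.gcd] using (Nat.coprime_two_left.mpr hm))
    rw [show (-4 : ℤ) = -1 * (2 * 2) by norm_num, jacobiSym.mul_left, jacobiSym.mul_left,
      jacobiSym.at_neg_one hm, h2]
    simp
  · obtain ⟨j, rfl⟩ := Nat.exists_eq_succ_of_ne_zero hk.ne'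
    have h0 : ZMod.χ₈ ((-4 : ℤ) : ZMod 8) = 0 := by decide
    rw [h0, zero_pow (by omega), zero_mul, ZMod.χ₄_nat_eq_if_mod_four, if_pos]
    rw [pow_succ, mul_right_comm, Nat.mul_mod_left]

theorem kroneckerSymbol_eight {n : ℕ} (hn : n ≠ 0) : kroneckerSymbol 8 n = ZMod.χ₈ n := by
  obtain ⟨k, m, hm, rfl⟩ := Nat.exists_eq_two_pow_mul_odd hn
  rw [kroneckerSymbol_two_pow_mul_odd _ _ hm]
  rcases Nat.eq_zero_or_pos k with rfl | hk
  · have h2 : jacobiSym (2 : ℤ) m * jacobiSym 2 m = 1 := by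
      rw [← pow_two]
      exact jacobiSym.sq_one (by simpa [Int.gcd] using (Nat.coprime_two_left.mpr hm))
    rw [show (8 : ℤ) = 2 * (2 * 2) by norm_num, jacobiSym.mul_left, jacobiSym.mul_left,
      h2, jacobiSym.at_two hm]
    simp
  · obtain ⟨j, rfl⟩ := Nat.exists_eq_succ_of_ne_zero hk.ne'
    have h0 : ZMod.χ₈ ((8 : ℤ) : ZMod 8) = 0 := by decide
    rw [h0, zero_pow (by omega), zero_mul, ZMod.χ₈_nat_eq_if_mod_eight, if_pos]
    rw [pow_succ, mul_right_comm, Nat.mul_mod_left]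

theorem kroneckerSymbol_neg_eight {n : ℕ} (hn : n ≠ 0) :
    kroneckerSymbol (-8) n = ZMod.χ₈' n := by
  obtain ⟨k, m, hm, rfl⟩ := Nat.exists_eq_two_pow_mul_odd hn
  rw [kroneckerSymbol_two_pow_mul_odd _ _ hm]
  rcases Nat.eq_zero_or_pos k with rfl | hk
  · have h2 : jacobiSym (2 : ℤ) m * jacobiSym 2 m = 1 := by
      rw [← pow_two]
      exact jacobiSym.sq_one (by simpa [Int.gcd] using (Nat.coprime_two_left.mpr hm))
    rw [show (-8 : ℤ) = -2 * (2 * 2) by norm_num, jacobiSym.mul_left, jacobiSym.mul_left,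
      h2, jacobiSym.at_neg_two hm]
    simp
  · obtain ⟨j, rfl⟩ := Nat.exists_eq_succ_of_ne_zero hk.ne'
    have h0 : ZMod.χ₈ ((-8 : ℤ) : ZMod 8) = 0 := by decide
    rw [h0, zero_pow (by omega), zero_mul, ZMod.χ₈'_nat_eq_if_mod_eight, if_pos]
    rw [pow_succ, mul_right_comm, Nat.mul_mod_left]

/-! ### Triviality of the Kronecker symbol on norms. -/

/-- `d` is the product of one of `1, -4, 8, -8` and an integer congruent to `1` modulo `4`. -/
def IsGenusDiscriminant (d : ℤ) : Prop :=
  ∃ P e : ℤ, (P = 1 ∨ P = -4 ∨ P = 8 ∨ P = -8) ∧ e % 4 = 1 ∧ d = P * e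

theorem IsFundamentalDiscriminant.isGenusDiscriminant {d : ℤ} (h : IsFundamentalDiscriminant d) :
    IsGenusDiscriminant d := by
  rcases h with ⟨h, -⟩ | ⟨m, rfl, h | h, -⟩
  · exact ⟨1, d, by simp, h, by ring⟩
  · rcases (by omega : m % 8 = 2 ∨ m % 8 = 6) with h8 | h8
    · exact ⟨8, m / 2, by simp, by omega, by omega⟩
    · exact ⟨-8, -(m / 2), by simp, by omega, by omega⟩
  · exact ⟨-4, -m, by simp, by omega, by ring⟩

/-- Genus theory at `2` as a finite check: the residues allowed for `F` are those of a discriminant,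
and they exclude the value `-1`. -/
theorem zmod_four_chi_norm : ∀ x y F : ZMod 4, (F = 0 ∨ F = 1) →
    ZMod.χ₄ (x ^ 2 + F * y ^ 2) = 0 ∨ ZMod.χ₄ (x ^ 2 + F * y ^ 2) = 1 := by decide

set_option maxRecDepth 20000 in
theorem zmod_eight_chi_norm : ∀ x y F : ZMod 8, (F = 0 ∨ F = 1 ∨ F = 4 ∨ F = 5) →
    (ZMod.χ₈ (x ^ 2 - 2 * (F * y ^ 2)) = 0 ∨ ZMod.χ₈ (x ^ 2 - 2 * (F * y ^ 2)) = 1) ∧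
    (ZMod.χ₈' (x ^ 2 + 2 * (F * y ^ 2)) = 0 ∨ ZMod.χ₈' (x ^ 2 + 2 * (F * y ^ 2)) = 1) := by
  decide

theorem intCast_zmod_four_of_disc {F : ℤ} (hF : F % 4 = 0 ∨ F % 4 = 1) :
    (F : ZMod 4) = 0 ∨ (F : ZMod 4) = 1 := by
  rcases hF with h | h
  · left; exact (ZMod.intCast_eq_intCast_iff' F 0 4).mpr h
  · right; exact_mod_cast (ZMod.intCast_eq_intCast_iff' F 1 4).mpr h

theorem intCast_zmod_eight_of_disc {F : ℤ} (hF : F % 4 = 0 ∨ F % 4 = 1) :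
    (F : ZMod 8) = 0 ∨ (F : ZMod 8) = 1 ∨ (F : ZMod 8) = 4 ∨ (F : ZMod 8) = 5 := by
  rcases (by omega : F % 8 = 0 ∨ F % 8 = 1 ∨ F % 8 = 4 ∨ F % 8 = 5) with h | h | h | h
  · left; exact (ZMod.intCast_eq_intCast_iff' F 0 8).mpr h
  · right; left; exact_mod_cast (ZMod.intCast_eq_intCast_iff' F 1 8).mpr h
  · right; right; left; exact_mod_cast (ZMod.intCast_eq_intCast_iff' F 4 8).mpr h
  · right; right; right; exact_mod_cast (ZMod.intCast_eq_intCast_iff' F 5 8).mpr h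

theorem mul_mod_four_disc {e F : ℤ} (he : e % 4 = 1) (hF : F % 4 = 0 ∨ F % 4 = 1) :
    e * F % 4 = 0 ∨ e * F % 4 = 1 := by
  rw [Int.mul_emod, he]; omega

/-- For `P ≠ 1`, `4 ∣ P` forces `x = 2z`; dividing by `4` leaves `n = z² - (P/4) F y²`, whose
residue modulo `4` or `8` decides the symbol. -/
theorem kroneckerSymbol_norm_of_two_part {P F : ℤ} (hP : P = 1 ∨ P = -4 ∨ P = 8 ∨ P = -8)
    (hF : F % 4 = 0 ∨ F % 4 = 1) {n : ℕ} (hn : n ≠ 0) (hc : Int.gcd n P = 1) {x y : ℤ}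
    (h : 4 * (n : ℤ) = x ^ 2 - P * F * y ^ 2) : kroneckerSymbol P n = 1 := by
  have hsq := kroneckerSymbol_sq_of_coprime hn hc
  have hne : kroneckerSymbol P n ≠ 0 := by intro h0; rw [h0] at hsq; norm_num at hsq
  rcases hP with rfl | hP
  · exact kroneckerSymbol_one_left n
  have hx : Even x := by
    have : Even (x ^ 2) := by
      have h4 : x ^ 2 = 4 * (n : ℤ) + P * F * y ^ 2 := by linarith
      rw [h4]
      rcases hP with rfl | rfl | rfl
      · exact ⟨2 * n - 2 * F * y ^ 2, by ring⟩
      · exact ⟨2 * n + 4 * F * y ^ 2, by ring⟩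
      · exact ⟨2 * n - 4 * F * y ^ 2, by ring⟩
    exact (Int.even_pow.mp this).1
  obtain ⟨z, rfl⟩ := hx
  rcases hP with rfl | rfl | rfl
  · rw [kroneckerSymbol_neg_four hn] at hne ⊢
    have h1 : ((n : ℤ) : ZMod 4) = z ^ 2 + F * y ^ 2 := by
      rw [show (n : ℤ) = z ^ 2 + F * y ^ 2 by linarith]; push_cast; rfl
    rw [Int.cast_natCast] at h1
    rw [h1] at hne ⊢
    exact (zmod_four_chi_norm _ _ _ (intCast_zmod_four_of_disc hF)).resolve_left hne
  · rw [kroneckerSymbol_eight hn] at hne ⊢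
    have h1 : ((n : ℤ) : ZMod 8) = z ^ 2 - 2 * (F * y ^ 2) := by
      rw [show (n : ℤ) = z ^ 2 - 2 * (F * y ^ 2) by linarith]; push_cast; rfl
    rw [Int.cast_natCast] at h1
    rw [h1] at hne ⊢
    exact (zmod_eight_chi_norm _ _ _ (intCast_zmod_eight_of_disc hF)).1.resolve_left hne
  · rw [kroneckerSymbol_neg_eight hn] at hne ⊢
    have h1 : ((n : ℤ) : ZMod 8) = z ^ 2 + 2 * (F * y ^ 2) := by
      rw [show (n : ℤ) = z ^ 2 + 2 * (F * y ^ 2) by linarith]; push_cast; rfl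
    rw [Int.cast_natCast] at h1
    rw [h1] at hne ⊢
    exact (zmod_eight_chi_norm _ _ _ (intCast_zmod_eight_of_disc hF)).2.resolve_left hne

/-- By reciprocity the symbol is `(n / |e|)`, and `4n ≡ x²` modulo `e` with `x` a unit. -/
theorem kroneckerSymbol_norm_of_odd {e F : ℤ} (he : e % 4 = 1) {n : ℕ} (hn : n ≠ 0)
    (hc : Int.gcd n e = 1) {x y : ℤ} (h : 4 * (n : ℤ) = x ^ 2 - e * F * y ^ 2) :
    kroneckerSymbol e n = 1 := by
  have hodd : Odd e.natAbs := Nat.odd_iff.mpr (by omega)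
  have h2e : IsCoprime (2 : ℤ) e := by
    rw [Int.isCoprime_iff_gcd_eq_one]; exact Nat.coprime_two_left.mpr hodd
  have hne : IsCoprime (n : ℤ) e := Int.isCoprime_iff_gcd_eq_one.mpr hc
  have h2 : jacobiSym ((2 : ℤ) ^ 2) e.natAbs = 1 :=
    
    jacobiSym.sq_one' (by
      rw [Int.gcd, Int.natAbs_natCast]; exact Int.isCoprime_iff_gcd_eq_one.mp h2e)
  have hx : IsCoprime x e := by
    have h3 : IsCoprime (x ^ 2) e := by
      have h4 : x ^ 2 = 2 ^ 2 * (n : ℤ) + e * (F * y ^ 2) := by linarith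
      rw [h4]
      exact ((h2e.pow_left (m := 2)).mul_left hne).add_mul_left_left _
    exact (IsCoprime.pow_left_iff two_pos).mp h3
  have h5 : jacobiSym (2 ^ 2 * (n : ℤ)) e.natAbs = jacobiSym (x ^ 2) e.natAbs := by
    apply jacobiSym.mod_left'
    rw [show (2 : ℤ) ^ 2 * n = x ^ 2 - e * (F * y ^ 2) by linarith]
    apply Int.ModEq.symm
    rw [Int.modEq_iff_dvd]
    exact ⟨-(e.sign * (F * y ^ 2)), by
      linear_combination (F * y ^ 2) * Int.sign_mul_natAbs e⟩
  rw [jacobiSym.mul_left, h2, one_mul] at h5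
  rw [kroneckerSymbol_eq_jacobiSym he hn, h5]
  exact jacobiSym.sq_one' (by
    rw [Int.gcd, Int.natAbs_natCast]; exact Int.isCoprime_iff_gcd_eq_one.mp hx)

/-- Each factor of `d = P e` is treated separately, the other being absorbed into the cofactor of
`y²`; `e E` is again `0` or `1` modulo `4`. -/
theorem kroneckerSymbol_norm {d E : ℤ} (hd : IsGenusDiscriminant d) (hE : E % 4 = 0 ∨ E % 4 = 1)
    {n : ℕ} (hn : n ≠ 0) (hc : Int.gcd n d = 1) {x y : ℤ}
    (h : 4 * (n : ℤ) = x ^ 2 - d * E * y ^ 2) : kroneckerSymbol d n = 1 := by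
  obtain ⟨P, e, hP, he, rfl⟩ := hd
  have hc' : IsCoprime (n : ℤ) (P * e) := Int.isCoprime_iff_gcd_eq_one.mpr hc
  rw [kroneckerSymbol_mul_left _ _ hn,
    kroneckerSymbol_norm_of_two_part hP (mul_mod_four_disc he hE) hn
      (Int.isCoprime_iff_gcd_eq_one.mp hc'.of_mul_right_left) (x := x) (y := y)
      (by rw [h]; ring),
    kroneckerSymbol_norm_of_odd he (F := P * E) hn
      (Int.isCoprime_iff_gcd_eq_one.mp hc'.of_mul_right_right) (x := x) (y := y)
      (by rw [h]; ring), one_mul]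

/-- The Kronecker symbol takes the same value at any two represented numbers coprime to `d`. -/
theorem kroneckerSymbol_eq_of_norm {d E : ℤ} (hd : IsGenusDiscriminant d)
    (hE : E % 4 = 0 ∨ E % 4 = 1) {m n : ℕ} (hm : m ≠ 0) (hn : n ≠ 0) (hmc : Int.gcd m d = 1)
    (hnc : Int.gcd n d = 1) {x y : ℤ} (h : 4 * ((m : ℤ) * n) = x ^ 2 - d * E * y ^ 2) :
    kroneckerSymbol d m = kroneckerSymbol d n := by
  have h1 : kroneckerSymbol d (m * n) = 1 := by
    refine kroneckerSymbol_norm hd hE (mul_ne_zero hm hn) ?_ (x := x) (y := y)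
      (by push_cast; exact h)
    push_cast
    rw [← Int.isCoprime_iff_gcd_eq_one] at hmc hnc ⊢
    exact hmc.mul_left hnc
  rw [kroneckerSymbol_mul_right _ hm hn] at h1
  have h2 := kroneckerSymbol_sq_of_coprime hn hnc
  calc kroneckerSymbol d m = kroneckerSymbol d m * kroneckerSymbol d n ^ 2 := by rw [h2, mul_one]
    _ = kroneckerSymbol d m * kroneckerSymbol d n * kroneckerSymbol d n := by ring
    _ = kroneckerSymbol d n := by rw [h1, one_mul]

/-! ### The genus character of a form. -/

/-- Independence of the chosen `n` rests on the identity `4 Q(x,y) Q(u,v) = (2axu + b(xv + yu) +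
2cyv)² - (b² - 4ac)(xv - yu)²`. -/
theorem genusCharacter_eq_kroneckerSymbol {D₀ E a b c : ℤ} (hd : IsGenusDiscriminant D₀)
    (hE : E % 4 = 0 ∨ E % 4 = 1) (hdisc : b ^ 2 - 4 * a * c = D₀ * E) {n : ℕ} (hn : 0 < n)
    (hnc : Int.gcd n D₀ = 1) {x y : ℤ} (hxy : a * x ^ 2 + b * x * y + c * y ^ 2 = n) :
    genusCharacter D₀ a b c = kroneckerSymbol D₀ n := by
  have hg : Int.gcd (Int.gcd a b) (Int.gcd c D₀) = 1 := by
    rw [← Nat.dvd_one, ← hnc]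
    set g := Int.gcd (Int.gcd a b) (Int.gcd c D₀) with hgdef
    have h1 : (g : ℤ) ∣ Int.gcd a b := Int.gcd_dvd_left ..
    have h2 : (g : ℤ) ∣ Int.gcd c D₀ := Int.gcd_dvd_right ..
    have ha : (g : ℤ) ∣ a := h1.trans (Int.gcd_dvd_left ..)
    have hb : (g : ℤ) ∣ b := h1.trans (Int.gcd_dvd_right ..)
    have hc : (g : ℤ) ∣ c := h2.trans (Int.gcd_dvd_left ..)
    have hD : (g : ℤ) ∣ D₀ := h2.trans (Int.gcd_dvd_right ..)
    refine Int.dvd_gcd ?_ hD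
    rw [← hxy, mul_assoc b]
    exact ((ha.mul_right _).add (hb.mul_right _)).add (hc.mul_right _)
  have h : Int.gcd (Int.gcd a b) (Int.gcd c D₀) = 1 ∧
      ∃ n : ℕ, 0 < n ∧ Int.gcd n D₀ = 1 ∧ ∃ x y : ℤ, a * x ^ 2 + b * x * y + c * y ^ 2 = n :=
    ⟨hg, n, hn, hnc, x, y, hxy⟩
  rw [genusCharacter, dif_pos h]
  obtain ⟨hm, hmc, u, v, huv⟩ := h.2.choose_spec
  refine kroneckerSymbol_eq_of_norm hd hE hm.ne' hn.ne' hmc hnc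
    (x := 2 * a * x * u + b * (x * v + y * u) + 2 * c * y * v) (y := x * v - y * u) ?_
  rw [← hdisc, ← huv, ← hxy]
  ring

theorem exists_rep_of_genusCharacter_ne_zero {D₀ a b c : ℤ} (h : genusCharacter D₀ a b c ≠ 0) :
    ∃ n : ℕ, 0 < n ∧ Int.gcd n D₀ = 1 ∧ ∃ x y : ℤ, a * x ^ 2 + b * x * y + c * y ^ 2 = n := by
  rw [genusCharacter] at h
  by_contra h'
  exact h (dif_neg (fun h'' => h' h''.2))

theorem gcd_eq_one_of_genusCharacter_ne_zero {D₀ a b c : ℤ} (h : genusCharacter D₀ a b c ≠ 0) :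
    Int.gcd (Int.gcd a b) (Int.gcd c D₀) = 1 := by
  rw [genusCharacter] at h
  by_contra h'
  exact h (dif_neg (fun h'' => h' h''.1))

/-- No prime divides `a, b, c, D₀` simultaneously. -/
theorem gcd_four_eq_one_iff {a b c D₀ : ℤ} : Int.gcd (Int.gcd a b) (Int.gcd c D₀) = 1 ↔
    ∀ p : ℕ, p.Prime → (p : ℤ) ∣ a → (p : ℤ) ∣ b → (p : ℤ) ∣ c → (p : ℤ) ∣ D₀ → False := by
  constructor
  · intro h p hp ha hb hc hd
    have : p ∣ 1 := by
      rw [← h]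
      exact Int.dvd_gcd (Int.dvd_coe_gcd ha hb) (Int.dvd_coe_gcd hc hd)
    exact hp.one_lt.ne' (Nat.dvd_one.mp this)
  · intro h
    by_contra hne
    obtain ⟨p, hp, hdvd⟩ := Nat.exists_prime_and_dvd hne
    have hdvd' : (p : ℤ) ∣ (Int.gcd (Int.gcd a b) (Int.gcd c D₀) : ℤ) :=
      Int.natCast_dvd_natCast.mpr hdvd
    have h1 : (p : ℤ) ∣ Int.gcd a b := hdvd'.trans (Int.gcd_dvd_left ..)
    have h2 : (p : ℤ) ∣ Int.gcd c D₀ := hdvd'.trans (Int.gcd_dvd_right ..)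
    exact h p hp (h1.trans (Int.gcd_dvd_left ..)) (h1.trans (Int.gcd_dvd_right ..))
      (h2.trans (Int.gcd_dvd_left ..)) (h2.trans (Int.gcd_dvd_right ..))

theorem int_gcd_eq_one_iff_prime {m d : ℤ} :
    Int.gcd m d = 1 ↔ ∀ p : ℕ, p.Prime → (p : ℤ) ∣ m → (p : ℤ) ∣ d → False := by
  constructor
  · intro h p hp hm hd
    have : p ∣ 1 := by rw [← h]; exact Int.dvd_gcd hm hd
    exact hp.one_lt.ne' (Nat.dvd_one.mp this)
  · intro h
    by_contra hne
    obtain ⟨p, hp, hdvd⟩ := Nat.exists_prime_and_dvd hne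
    have hdvd' : (p : ℤ) ∣ (Int.gcd m d : ℤ) := Int.natCast_dvd_natCast.mpr hdvd
    exact h p hp (hdvd'.trans (Int.gcd_dvd_left ..)) (hdvd'.trans (Int.gcd_dvd_right ..))

/-- The forms may be indefinite; this bound allows the first argument to be moved within a residue
class until the value is positive. -/
theorem quadratic_form_pos {a b c X y : ℤ} (ha : 0 < a) (hX : |b * y| + |c| * y ^ 2 + 1 ≤ X) :
    0 < a * X ^ 2 + b * X * y + c * y ^ 2 := by
  have h1 : -|b * y| ≤ b * y := neg_abs_le _
  have h2 : -(|c| * y ^ 2) ≤ c * y ^ 2 := by nlinarith [neg_abs_le c, sq_nonneg y]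
  have h3 : 0 ≤ |c| * y ^ 2 := by positivity
  have h4 := abs_nonneg (b * y)
  have hX0 : 0 < X := by linarith
  have h5 : X ≤ a * X := by nlinarith
  have h6 : 1 ≤ a * X + b * y := by linarith
  have h7 : X ≤ X * (a * X + b * y) := by nlinarith
  nlinarith

/-- A form whose coefficients have no common factor with `D₀`, and whose discriminant is divisible
by `D₀`, represents a positive integer coprime to `D₀`. -/
theorem exists_rep_coprime {D₀ a b c : ℤ} (hD₀ : D₀ ≠ 0) (ha : 0 < a)
    (hdvd : D₀ ∣ b ^ 2 - 4 * a * c) (hg : Int.gcd (Int.gcd a b) (Int.gcd c D₀) = 1) :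
    ∃ n : ℕ, 0 < n ∧ Int.gcd n D₀ = 1 ∧ ∃ x y : ℤ, a * x ^ 2 + b * x * y + c * y ^ 2 = n := by
  classical
  rw [gcd_four_eq_one_iff] at hg
  set S := D₀.natAbs.primeFactors
  -- Among the primes `p ∣ D₀`, `x` collects those dividing `a` and `y` the others. If `p ∤ a`, the
  -- value is `≡ a x²` modulo `p`. If `p ∣ a`, then `p ∣ b` because `p` divides the discriminant, so
  -- `p ∤ c` and the value is `≡ c y²`. Both are units. `X` is `x` shifted by a multiple of `D₀`
  -- that secures positivity.
  set x : ℕ := ∏ p ∈ S.filter (fun p : ℕ => (p : ℤ) ∣ a), p with hx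
  set y : ℕ := ∏ p ∈ S.filter (fun p : ℕ => ¬ (p : ℤ) ∣ a), p with hy
  set X : ℤ := x + (|b * y| + |c| * y ^ 2 + 1) * |D₀| with hX
  have hXge : |b * y| + |c| * (y : ℤ) ^ 2 + 1 ≤ X := by
    have h1 : 1 ≤ |D₀| := Int.one_le_abs hD₀
    have h2 : 0 ≤ |b * y| + |c| * (y : ℤ) ^ 2 + 1 := by positivity
    have h3 : (0 : ℤ) ≤ x := by positivity
    rw [hX]; nlinarith
  have hpos := quadratic_form_pos ha hXge
  refine ⟨(a * X ^ 2 + b * X * y + c * y ^ 2).toNat, by omega, ?_, X, y,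
    (Int.toNat_of_nonneg hpos.le).symm⟩
  rw [Int.toNat_of_nonneg hpos.le, int_gcd_eq_one_iff_prime]
  intro p hp hpn hpd
  have hpS : p ∈ S :=
    Nat.mem_primeFactors.mpr ⟨hp, Int.natCast_dvd.mp hpd, Int.natAbs_ne_zero.mpr hD₀⟩
  have hpZ : Prime (p : ℤ) := Nat.prime_iff_prime_int.mp hp
  have hprod : ∀ T : Finset ℕ, T ⊆ S → (p : ℤ) ∣ ((∏ q ∈ T, q : ℕ) : ℤ) → p ∈ T := by
    intro T hT h
    obtain ⟨q, hq, hpq⟩ := (Prime.dvd_finsetProd_iff hp.prime _).mp (Int.natCast_dvd_natCast.mp h)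
    rwa [(Nat.prime_dvd_prime_iff_eq hp (Nat.prime_of_mem_primeFactors (hT hq))).mp hpq]
  have hXx : (p : ℤ) ∣ X - x := by
    rw [hX, add_sub_cancel_left]
    exact ((dvd_abs _ _).mpr hpd).mul_left _
  by_cases hpa : (p : ℤ) ∣ a
  · have hxp : (p : ℤ) ∣ x := Int.natCast_dvd_natCast.mpr
      (Finset.dvd_prod_of_mem _ (Finset.mem_filter.mpr ⟨hpS, hpa⟩))
    have hyp : ¬ (p : ℤ) ∣ y := fun h =>
      (Finset.mem_filter.mp (hprod _ (Finset.filter_subset _ _) h)).2 hpa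
    have hpb : (p : ℤ) ∣ b := by
      have : (p : ℤ) ∣ b ^ 2 := by
        have := (hpd.trans hdvd).add (hpa.mul_left (4 * c))
        rwa [show b ^ 2 - 4 * a * c + 4 * c * a = b ^ 2 by ring] at this
      exact hpZ.dvd_of_dvd_pow this
    have hpc : ¬ (p : ℤ) ∣ c := fun h => hg p hp hpa hpb h hpd
    have h1 : (p : ℤ) ∣ c * y ^ 2 := by
      have h2 : (p : ℤ) ∣ a * X ^ 2 + b * X * y := by
        rw [mul_assoc b]
        exact (hpa.mul_right _).add (hpb.mul_right _)
      exact (dvd_add_right h2).mp hpn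
    rcases hpZ.dvd_or_dvd h1 with h | h
    · exact hpc h
    · exact hyp (hpZ.dvd_of_dvd_pow h)
  · have hyp : (p : ℤ) ∣ y := Int.natCast_dvd_natCast.mpr
      (Finset.dvd_prod_of_mem _ (Finset.mem_filter.mpr ⟨hpS, hpa⟩))
    have hxp : ¬ (p : ℤ) ∣ x := fun h =>
      hpa (Finset.mem_filter.mp (hprod _ (Finset.filter_subset _ _) h)).2
    have h1 : (p : ℤ) ∣ a * X ^ 2 := by
      rw [add_assoc, pow_two (y : ℤ), ← mul_assoc, ← add_mul] at hpn
      exact (dvd_add_left (hyp.mul_left _)).mp hpn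
    rcases hpZ.dvd_or_dvd h1 with h | h
    · exact hpa h
    · have h2 := hpZ.dvd_of_dvd_pow h
      exact hxp (by simpa using h2.sub hXx)

theorem genusCharacter_ne_zero {D₀ E a b c : ℤ} (hd : IsGenusDiscriminant D₀)
    (hE : E % 4 = 0 ∨ E % 4 = 1) (hdisc : b ^ 2 - 4 * a * c = D₀ * E) {n : ℕ} (hn : 0 < n)
    (hnc : Int.gcd n D₀ = 1) {x y : ℤ} (hxy : a * x ^ 2 + b * x * y + c * y ^ 2 = n) :
    genusCharacter D₀ a b c ≠ 0 := by
  rw [genusCharacter_eq_kroneckerSymbol hd hE hdisc hn hnc hxy]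
  intro h0
  have := kroneckerSymbol_sq_of_coprime hn.ne' hnc
  rw [h0] at this
  norm_num at this

/-- Two forms of discriminant `D₀ E` representing the same integers have the same genus
character. -/
theorem genusCharacter_congr {D₀ E a b c a' b' c' : ℤ} (hd : IsGenusDiscriminant D₀)
    (hE : E % 4 = 0 ∨ E % 4 = 1) (hdisc : b ^ 2 - 4 * a * c = D₀ * E)
    (hdisc' : b' ^ 2 - 4 * a' * c' = D₀ * E)
    (h : ∀ n : ℤ, (∃ x y : ℤ, a * x ^ 2 + b * x * y + c * y ^ 2 = n) ↔
      ∃ x y : ℤ, a' * x ^ 2 + b' * x * y + c' * y ^ 2 = n) :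
    genusCharacter D₀ a b c = genusCharacter D₀ a' b' c' := by
  by_cases h0 : genusCharacter D₀ a b c = 0
  · by_cases h0' : genusCharacter D₀ a' b' c' = 0
    · rw [h0, h0']
    · obtain ⟨n, hn, hnc, hr⟩ := exists_rep_of_genusCharacter_ne_zero h0'
      obtain ⟨x, y, hxy⟩ := (h n).mpr hr
      exact absurd h0 (genusCharacter_ne_zero hd hE hdisc hn hnc hxy)
  · obtain ⟨n, hn, hnc, hr⟩ := exists_rep_of_genusCharacter_ne_zero h0
    obtain ⟨x', y', hxy'⟩ := (h n).mp hr
    obtain ⟨x, y, hxy⟩ := hr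
    rw [genusCharacter_eq_kroneckerSymbol hd hE hdisc hn hnc hxy,
      genusCharacter_eq_kroneckerSymbol hd hE hdisc' hn hnc hxy']

/-! ### Multiplicativity of the genus sums. -/

/-- The summand of `genusSum`, extended to all integers `b`. -/
noncomputable def genusTerm (Δ D₀ : ℤ) (a : ℕ) (b : ℤ) : ℤ :=
  if (4 * a : ℤ) ∣ b ^ 2 - Δ then genusCharacter D₀ a b ((b ^ 2 - Δ) / (4 * a)) else 0

theorem genusSum_eq_sum_genusTerm (Δ D₀ : ℤ) (a : ℕ) :
    genusSum Δ D₀ a = ∑ b ∈ Finset.range (2 * a), genusTerm Δ D₀ a b := by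
  rw [genusSum, Finset.sum_filter]
  rfl

theorem genusTerm_of_eq {Δ D₀ : ℤ} {a : ℕ} (ha : a ≠ 0) {b c : ℤ} (h : b ^ 2 - Δ = 4 * a * c) :
    genusTerm Δ D₀ a b = genusCharacter D₀ a b c := by
  have h4 : (4 * a : ℤ) ≠ 0 := by positivity
  rw [genusTerm, if_pos ⟨c, h⟩, h, Int.mul_ediv_cancel_left _ h4]

theorem genusTerm_of_not_dvd {Δ D₀ : ℤ} {a : ℕ} {b : ℤ} (h : ¬ (4 * a : ℤ) ∣ b ^ 2 - Δ) :
    genusTerm Δ D₀ a b = 0 := if_neg h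

theorem genusTerm_eq_zero_of_parity {Δ D₀ : ℤ} {a : ℕ} {b : ℤ} (h : b % 2 ≠ Δ % 2) :
    genusTerm Δ D₀ a b = 0 := by
  refine genusTerm_of_not_dvd fun h' => h ?_
  have h2 : (2 : ℤ) ∣ b ^ 2 - Δ := (Dvd.intro (2 * a : ℤ) (by ring)).trans h'
  have h3 : b ^ 2 % 2 = b % 2 := by
    rcases Int.emod_two_eq_zero_or_one b with h | h <;> simp [pow_two, Int.mul_emod, h]
  omega

/-- The shift of `b` by `2a` is the substitution `x ↦ x + y`, which preserves the set of represented
integers. -/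
theorem genusTerm_add_two_mul {D₀ E : ℤ} (hd : IsGenusDiscriminant D₀)
    (hE : E % 4 = 0 ∨ E % 4 = 1) {a : ℕ} (ha : a ≠ 0) (b : ℤ) :
    genusTerm (D₀ * E) D₀ a (b + 2 * a) = genusTerm (D₀ * E) D₀ a b := by
  by_cases h : (4 * a : ℤ) ∣ b ^ 2 - D₀ * E
  · obtain ⟨c, hc⟩ := h
    have hc' : (b + 2 * a) ^ 2 - D₀ * E = 4 * a * (c + b + a) := by linear_combination hc
    rw [genusTerm_of_eq ha hc, genusTerm_of_eq ha hc']
    refine genusCharacter_congr hd hE (by linear_combination hc') (by linear_combination hc) ?_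
    intro n
    constructor
    · rintro ⟨x, y, rfl⟩; exact ⟨x + y, y, by ring⟩
    · rintro ⟨x, y, rfl⟩; exact ⟨x - y, y, by ring⟩
  · rw [genusTerm_of_not_dvd h, genusTerm_of_not_dvd]
    intro h'
    apply h
    have := h'.sub (Dvd.intro (b + a) (rfl : (4 * a : ℤ) * (b + a) = _))
    rwa [show (b + 2 * a) ^ 2 - D₀ * E - 4 * a * (b + a) = b ^ 2 - D₀ * E by ring] at this

/-- Dirichlet composition: a bilinear substitution makes `[a₁a₂, b, c]` represent the product of
values of `[a₁, b, a₂c]` and `[a₂, b, a₁c]`. Coprimality of `a₁, a₂` enters only in showing that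
both factors are nonzero when the left side is. -/
theorem genusCharacter_mul_of_coprime {D₀ E : ℤ} (hd : IsGenusDiscriminant D₀) (hD₀ : D₀ ≠ 0)
    (hE : E % 4 = 0 ∨ E % 4 = 1) {a₁ a₂ b c : ℤ} (h₁ : 0 < a₁) (h₂ : 0 < a₂)
    (hc : IsCoprime a₁ a₂) (hdisc : b ^ 2 - 4 * (a₁ * a₂) * c = D₀ * E) :
    genusCharacter D₀ (a₁ * a₂) b c =
      genusCharacter D₀ a₁ b (a₂ * c) * genusCharacter D₀ a₂ b (a₁ * c) := by
  have hdisc₁ : b ^ 2 - 4 * a₁ * (a₂ * c) = D₀ * E := by linear_combination hdisc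
  have hdisc₂ : b ^ 2 - 4 * a₂ * (a₁ * c) = D₀ * E := by linear_combination hdisc
  by_cases h0 : genusCharacter D₀ a₁ b (a₂ * c) ≠ 0 ∧ genusCharacter D₀ a₂ b (a₁ * c) ≠ 0
  · obtain ⟨n₁, hn₁, hc₁, x, y, hxy⟩ := exists_rep_of_genusCharacter_ne_zero h0.1
    obtain ⟨n₂, hn₂, hc₂, u, v, huv⟩ := exists_rep_of_genusCharacter_ne_zero h0.2
    rw [genusCharacter_eq_kroneckerSymbol hd hE hdisc₁ hn₁ hc₁ hxy,
      genusCharacter_eq_kroneckerSymbol hd hE hdisc₂ hn₂ hc₂ huv,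
      ← kroneckerSymbol_mul_right _ hn₁.ne' hn₂.ne']
    refine genusCharacter_eq_kroneckerSymbol hd hE hdisc (Nat.mul_pos hn₁ hn₂) ?_
      (x := x * u - c * y * v) (y := a₁ * x * v + a₂ * y * u + b * y * v) ?_
    · rw [← Int.isCoprime_iff_gcd_eq_one] at hc₁ hc₂ ⊢
      push_cast
      exact hc₁.mul_left hc₂
    · push_cast
      rw [← hxy, ← huv]
      ring
  · by_cases h : genusCharacter D₀ (a₁ * a₂) b c = 0
    · rw [h, eq_comm, mul_eq_zero]
      tauto
    · exfalso
      apply h0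
      have hg := gcd_eq_one_of_genusCharacter_ne_zero h
      rw [gcd_four_eq_one_iff] at hg
      have hcp : ∀ p : ℕ, p.Prime → (p : ℤ) ∣ a₁ → (p : ℤ) ∣ a₂ → False := fun p hp h1 h2 =>
        int_gcd_eq_one_iff_prime.mp (Int.isCoprime_iff_gcd_eq_one.mp hc) p hp h1 h2
      constructor
      · obtain ⟨n, hn, hnc, x, y, hxy⟩ := exists_rep_coprime (b := b) (c := a₂ * c) hD₀ h₁
          (hdisc₁ ▸ Dvd.intro _ rfl) (by
            rw [gcd_four_eq_one_iff]
            intro p hp ha hb hc hd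
            rcases (Nat.prime_iff_prime_int.mp hp).dvd_or_dvd hc with h | h
            · exact hcp p hp ha h
            · exact hg p hp (ha.mul_right _) hb h hd)
        exact genusCharacter_ne_zero hd hE hdisc₁ hn hnc hxy
      · obtain ⟨n, hn, hnc, x, y, hxy⟩ := exists_rep_coprime (b := b) (c := a₁ * c) hD₀ h₂
          (hdisc₂ ▸ Dvd.intro _ rfl) (by
            rw [gcd_four_eq_one_iff]
            intro p hp ha hb hc hd
            rcases (Nat.prime_iff_prime_int.mp hp).dvd_or_dvd hc with h | h
            · exact hcp p hp h ha
            · exact hg p hp (ha.mul_left _) hb h hd)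
        exact genusCharacter_ne_zero hd hE hdisc₂ hn hnc hxy

theorem genusTerm_mul_of_coprime {D₀ E : ℤ} (hd : IsGenusDiscriminant D₀) (hD₀ : D₀ ≠ 0)
    (hE : E % 4 = 0 ∨ E % 4 = 1) {a₁ a₂ : ℕ} (h₁ : a₁ ≠ 0) (h₂ : a₂ ≠ 0)
    (hc : a₁.Coprime a₂) (b : ℤ) :
    genusTerm (D₀ * E) D₀ (a₁ * a₂) b =
      genusTerm (D₀ * E) D₀ a₁ b * genusTerm (D₀ * E) D₀ a₂ b := by
  have hcZ : IsCoprime (a₁ : ℤ) a₂ := Nat.isCoprime_iff_coprime.mpr hc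
  by_cases h : (4 * (a₁ * a₂ : ℕ) : ℤ) ∣ b ^ 2 - D₀ * E
  · obtain ⟨c, hc⟩ := h
    rw [genusTerm_of_eq (mul_ne_zero h₁ h₂) hc,
      genusTerm_of_eq h₁ (c := a₂ * c) (by rw [hc]; push_cast; ring),
      genusTerm_of_eq h₂ (c := a₁ * c) (by rw [hc]; push_cast; ring)]
    push_cast
    refine genusCharacter_mul_of_coprime hd hD₀ hE (by positivity) (by positivity) hcZ ?_
    push_cast at hc
    linear_combination hc
  · rw [genusTerm_of_not_dvd h, eq_comm, mul_eq_zero]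
    by_contra h0
    push Not at h0
    have hd₁ : (4 * a₁ : ℤ) ∣ b ^ 2 - D₀ * E := by
      by_contra h'; exact h0.1 (genusTerm_of_not_dvd h')
    have hd₂ : (4 * a₂ : ℤ) ∣ b ^ 2 - D₀ * E := by
      by_contra h'; exact h0.2 (genusTerm_of_not_dvd h')
    obtain ⟨M, hM⟩ := (Dvd.intro _ rfl : (4 : ℤ) ∣ 4 * a₁).trans hd₁
    rw [hM] at h hd₁ hd₂
    push_cast at h
    rw [mul_dvd_mul_iff_left (by norm_num)] at h hd₁ hd₂
    exact h (hcZ.mul_dvd hd₁ hd₂)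

theorem sum_range_two_mul {M : Type*} [AddCommMonoid M] (f : ℕ → M) (n : ℕ) :
    ∑ b ∈ Finset.range (2 * n), f b = ∑ x ∈ Finset.range n, (f (2 * x) + f (2 * x + 1)) := by
  induction n with
  | zero => simp
  | succ n ih => rw [Finset.sum_range_succ, ← ih, mul_add, Finset.sum_range_succ,
      Finset.sum_range_succ, add_assoc]

/-- A sum over `b < 2 n` supported on one parity class. -/
theorem sum_range_two_mul_of_parity {M : Type*} [AddCommMonoid M] (f : ℤ → M) {Δ : ℤ}
    (hf : ∀ b : ℤ, b % 2 ≠ Δ % 2 → f b = 0) (n : ℕ) :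
    ∑ b ∈ Finset.range (2 * n), f b = ∑ x ∈ Finset.range n, f (2 * x + Δ % 2) := by
  rw [sum_range_two_mul (fun b => f b)]
  refine Finset.sum_congr rfl fun x _ => ?_
  push_cast
  rcases Int.emod_two_eq_zero_or_one Δ with h | h
  · rw [hf (2 * x + 1) (by omega), h, add_zero, add_zero]
  · rw [hf (2 * x) (by omega), h, zero_add]

theorem sum_range_mul_of_periodic {R : Type*} [CommSemiring R] {f g : ℕ → R} {m n : ℕ}
    (hm : m ≠ 0) (hn : n ≠ 0) (hmn : m.Coprime n) (hf : Function.Periodic f m)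
    (hg : Function.Periodic g n) :
    ∑ x ∈ Finset.range (m * n), f x * g x =
      (∑ x ∈ Finset.range m, f x) * ∑ x ∈ Finset.range n, g x := by
  rw [Finset.sum_mul_sum, ← Finset.sum_product']
  refine Finset.sum_nbij (fun x => (x % m, x % n)) ?_ ?_ ?_ ?_
  · intro x _
    simp [Nat.mod_lt _ (Nat.pos_of_ne_zero hm), Nat.mod_lt _ (Nat.pos_of_ne_zero hn)]
  · intro x hx y hy hxy
    simp only [Prod.mk.injEq] at hxy
    have h := (Nat.modEq_and_modEq_iff_modEq_mul hmn).mp hxy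
    simp only [Finset.coe_range, Set.mem_Iio] at hx hy
    exact Nat.ModEq.eq_of_lt_of_lt h hx hy
  · rintro ⟨u, v⟩ huv
    simp only [Finset.coe_product, Finset.coe_range, Set.mem_prod, Set.mem_Iio] at huv
    refine ⟨Nat.chineseRemainder hmn u v, ?_, ?_⟩
    · simpa using Nat.chineseRemainder_lt_mul hmn u v hm hn
    · have h := (Nat.chineseRemainder hmn u v).2
      simp only [Prod.mk.injEq]
      exact ⟨Eq.trans h.1 (Nat.mod_eq_of_lt huv.1), Eq.trans h.2 (Nat.mod_eq_of_lt huv.2)⟩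
  · intro x _
    simp only [hf.map_mod_nat, hg.map_mod_nat]

/-- The moduli `2a₁, 2a₂` are not coprime. Since `b` has the parity of the discriminant, `b = 2x +
(D₀ E mod 2)` replaces them by `a₁, a₂`, and the Chinese remainder theorem applies to `x`. -/
theorem genusSum_mul_of_coprime {D₀ E : ℤ} (hd : IsGenusDiscriminant D₀) (hD₀ : D₀ ≠ 0)
    (hE : E % 4 = 0 ∨ E % 4 = 1) {a₁ a₂ : ℕ} (h₁ : a₁ ≠ 0) (h₂ : a₂ ≠ 0)
    (hc : a₁.Coprime a₂) :
    genusSum (D₀ * E) D₀ (a₁ * a₂) = genusSum (D₀ * E) D₀ a₁ * genusSum (D₀ * E) D₀ a₂ := by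
  have key : ∀ a : ℕ, genusSum (D₀ * E) D₀ a =
      ∑ x ∈ Finset.range a, genusTerm (D₀ * E) D₀ a (2 * x + D₀ * E % 2) := fun a => by
    rw [genusSum_eq_sum_genusTerm]
    exact sum_range_two_mul_of_parity _ (fun b hb => genusTerm_eq_zero_of_parity hb) a
  have hper : ∀ a : ℕ, a ≠ 0 → Function.Periodic
      (fun x : ℕ => genusTerm (D₀ * E) D₀ a (2 * x + D₀ * E % 2)) a := by
    intro a ha x
    simp only
    rw [← genusTerm_add_two_mul hd hE ha (2 * x + D₀ * E % 2)]
    push_cast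
    congr 1
    ring
  rw [key, key, key, ← sum_range_mul_of_periodic h₁ h₂ hc (hper a₁ h₁) (hper a₂ h₂)]
  exact Finset.sum_congr rfl fun x _ => genusTerm_mul_of_coprime hd hD₀ hE h₁ h₂ hc _

theorem disc_mod_four {D₀ E : ℤ} (hd : IsGenusDiscriminant D₀) (hE : E % 4 = 0 ∨ E % 4 = 1) :
    D₀ * E % 4 = 0 ∨ D₀ * E % 4 = 1 := by
  obtain ⟨P, e, hP, he, rfl⟩ := hd
  have := mul_mod_four_disc he hE
  rcases hP with rfl | rfl | rfl | rfl
  · simpa using this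
  all_goals left; rw [mul_assoc]; omega

theorem genusSum_one {D₀ E : ℤ} (hd : IsGenusDiscriminant D₀) (hE : E % 4 = 0 ∨ E % 4 = 1) :
    genusSum (D₀ * E) D₀ 1 = 1 := by
  rw [genusSum_eq_sum_genusTerm,
    sum_range_two_mul_of_parity _ (fun b hb => genusTerm_eq_zero_of_parity hb) 1]
  simp only [Finset.range_one, Finset.sum_singleton, Nat.cast_zero, mul_zero, zero_add]
  obtain ⟨c, hc⟩ : (4 : ℤ) ∣ (D₀ * E % 2) ^ 2 - D₀ * E := by
    rcases disc_mod_four hd hE with h | h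
    · rw [show D₀ * E % 2 = 0 by omega]; omega
    · rw [show D₀ * E % 2 = 1 by omega]; omega
  rw [genusTerm_of_eq one_ne_zero (c := c) (by rw [hc]; push_cast; ring),
    genusCharacter_eq_kroneckerSymbol hd hE (n := 1) (x := 1) (y := 0) _ one_pos (by simp)
      (by simp), kroneckerSymbol_one_right]
  push_cast
  linear_combination hc

/-! ### Genus sums at prime powers as local character sums. -/

/-- `P` is the prime discriminant `(-1) ^ ((p - 1) / 2) * p` at an odd prime `p`, or one of
`-4, 8, -8` at `p = 2`, and `ψ` is the quadratic character of conductor `|P|`. -/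
def IsLocalCharacter (p : ℕ) (P : ℤ) (ψ : ℤ → ℤ) : Prop :=
  (p ≠ 2 ∧ P = ZMod.χ₄ p * p ∧ ψ = fun c => jacobiSym c p) ∨
  (p = 2 ∧ ((P = -4 ∧ ψ = fun c : ℤ => ZMod.χ₄ (c : ZMod 4)) ∨
    (P = 8 ∧ ψ = fun c : ℤ => ZMod.χ₈ (c : ZMod 8)) ∨
    (P = -8 ∧ ψ = fun c : ℤ => ZMod.χ₈' (c : ZMod 8))))

theorem prime_discriminant_mod_four {p : ℕ} (hp : p.Prime) (h2 : p ≠ 2) :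
    (ZMod.χ₄ p * p : ℤ) % 4 = 1 := by
  have := hp.eq_two_or_odd.resolve_left h2
  rcases Nat.odd_mod_four_iff.mp this with h | h
  · rw [ZMod.χ₄_nat_one_mod_four h]; omega
  · rw [ZMod.χ₄_nat_three_mod_four h]; omega

theorem chi_four_prime_eq {p : ℕ} (hp : p.Prime) (h2 : p ≠ 2) :
    ZMod.χ₄ p = 1 ∨ ZMod.χ₄ p = -1 := by
  have := hp.eq_two_or_odd.resolve_left h2
  rcases Nat.odd_mod_four_iff.mp this with h | h
  · left; exact ZMod.χ₄_nat_one_mod_four h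
  · right; exact ZMod.χ₄_nat_three_mod_four h

namespace IsLocalCharacter

variable {p : ℕ} {P : ℤ} {ψ : ℤ → ℤ}

theorem isGenusDiscriminant (h : IsLocalCharacter p P ψ) (hp : p.Prime) :
    IsGenusDiscriminant P := by
  rcases h with ⟨h2, rfl, -⟩ | ⟨-, h⟩
  · exact ⟨1, _, by simp, prime_discriminant_mod_four hp h2, by ring⟩
  · exact ⟨P, 1, by tauto, by norm_num, by ring⟩

theorem dvd (h : IsLocalCharacter p P ψ) : (p : ℤ) ∣ P := by
  rcases h with ⟨-, rfl, -⟩ | ⟨rfl, ⟨rfl, -⟩ | ⟨rfl, -⟩ | ⟨rfl, -⟩⟩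
  · exact Dvd.intro_left _ rfl
  all_goals norm_num

theorem ne_zero (h : IsLocalCharacter p P ψ) (hp : p.Prime) : P ≠ 0 := by
  rcases h with ⟨h2, rfl, -⟩ | ⟨rfl, ⟨rfl, -⟩ | ⟨rfl, -⟩ | ⟨rfl, -⟩⟩
  · have := prime_discriminant_mod_four hp h2
    intro h0; rw [h0] at this; norm_num at this
  all_goals norm_num

theorem prime_eq_of_dvd (h : IsLocalCharacter p P ψ) (hp : p.Prime) {q : ℕ} (hq : q.Prime)
    (hqP : (q : ℤ) ∣ P) : q = p := by
  rcases h with ⟨h2, rfl, -⟩ | ⟨rfl, h⟩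
  · rw [← Nat.prime_dvd_prime_iff_eq hq hp, ← Int.natCast_dvd_natCast]
    rcases chi_four_prime_eq hp h2 with h | h <;> rw [h] at hqP <;> simpa using hqP
  · rw [← Nat.prime_dvd_prime_iff_eq hq Nat.prime_two, ← Int.natCast_dvd_natCast]
    have hq' := Nat.prime_iff_prime_int.mp hq
    refine hq'.dvd_of_dvd_pow (n := 3) ?_
    rcases h with ⟨rfl, -⟩ | ⟨rfl, -⟩ | ⟨rfl, -⟩
    · exact hqP.trans ⟨-2, by norm_num⟩
    · exact hqP.trans ⟨1, by norm_num⟩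
    · exact hqP.trans ⟨-1, by norm_num⟩

theorem kroneckerSymbol_eq (h : IsLocalCharacter p P ψ) (hp : p.Prime) {n : ℕ} (hn : n ≠ 0) :
    kroneckerSymbol P n = ψ n := by
  rcases h with ⟨h2, rfl, rfl⟩ | ⟨-, ⟨rfl, rfl⟩ | ⟨rfl, rfl⟩ | ⟨rfl, rfl⟩⟩
  · rw [kroneckerSymbol_eq_jacobiSym (prime_discriminant_mod_four hp h2) hn]
    congr 1
    rcases chi_four_prime_eq hp h2 with h | h <;> simp [h]
  · simpa using kroneckerSymbol_neg_four hn
  · simpa using kroneckerSymbol_eight hn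
  · simpa using kroneckerSymbol_neg_eight hn

theorem congr_mod (h : IsLocalCharacter p P ψ) {x y : ℤ} (hxy : (8 * p : ℤ) ∣ x - y) :
    ψ x = ψ y := by
  rcases h with ⟨-, rfl, rfl⟩ | ⟨rfl, ⟨rfl, rfl⟩ | ⟨rfl, rfl⟩ | ⟨rfl, rfl⟩⟩
  · refine jacobiSym.mod_left' ?_
    exact Int.ModEq.symm (Int.modEq_iff_dvd.mpr ((Dvd.intro_left (8 : ℤ) rfl).trans hxy))
  all_goals
    simp only
    congr 1
  · rw [ZMod.intCast_eq_intCast_iff_dvd_sub]; push_cast at hxy ⊢; omega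
  · rw [ZMod.intCast_eq_intCast_iff_dvd_sub]; push_cast at hxy ⊢; omega
  · rw [ZMod.intCast_eq_intCast_iff_dvd_sub]; push_cast at hxy ⊢; omega

theorem eq_zero_of_dvd (h : IsLocalCharacter p P ψ) (hp : p.Prime) {c : ℤ} (hc : (p : ℤ) ∣ c) :
    ψ c = 0 := by
  rcases h with ⟨h2, rfl, rfl⟩ | ⟨rfl, ⟨rfl, rfl⟩ | ⟨rfl, rfl⟩ | ⟨rfl, rfl⟩⟩
  · have : NeZero p := ⟨hp.ne_zero⟩
    rw [jacobiSym.eq_zero_iff_not_coprime]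
    intro h1
    exact int_gcd_eq_one_iff_prime.mp h1 p hp hc (dvd_refl _)
  · simp only
    rw [ZMod.χ₄_int_eq_if_mod_four, if_pos (by omega)]
  · simp only
    rw [ZMod.χ₈_int_eq_if_mod_eight, if_pos (by omega)]
  · simp only
    rw [ZMod.χ₈'_int_eq_if_mod_eight, if_pos (by omega)]

end IsLocalCharacter

/-- The sum over square roots `b` of `Δ` modulo `4 * a` of `ψ ((b ^ 2 - Δ) / (4 * a))`. -/
def localTerm (ψ : ℤ → ℤ) (Δ : ℤ) (a : ℕ) (b : ℤ) : ℤ :=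
  if (4 * a : ℤ) ∣ b ^ 2 - Δ then ψ ((b ^ 2 - Δ) / (4 * a)) else 0

/-- The sum of `localTerm` over `0 ≤ b < 2 * a`. -/
def localSum (ψ : ℤ → ℤ) (Δ : ℤ) (a : ℕ) : ℤ := ∑ b ∈ Finset.range (2 * a), localTerm ψ Δ a b

theorem localTerm_of_eq (ψ : ℤ → ℤ) {Δ : ℤ} {a : ℕ} (ha : a ≠ 0) {b c : ℤ}
    (h : b ^ 2 - Δ = 4 * a * c) : localTerm ψ Δ a b = ψ c := by
  have h4 : (4 * a : ℤ) ≠ 0 := by positivity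
  rw [localTerm, if_pos ⟨c, h⟩, h, Int.mul_ediv_cancel_left _ h4]

theorem localTerm_of_not_dvd (ψ : ℤ → ℤ) {Δ : ℤ} {a : ℕ} {b : ℤ}
    (h : ¬ (4 * a : ℤ) ∣ b ^ 2 - Δ) : localTerm ψ Δ a b = 0 := if_neg h

/-- The leading coefficient `pᵛ` is itself a represented number prime to `D₀`. -/
theorem genusTerm_prime_pow_of_not_dvd {D₀ E : ℤ} (hd : IsGenusDiscriminant D₀)
    (hE : E % 4 = 0 ∨ E % 4 = 1) {p : ℕ} (hp : p.Prime) (hpD : ¬ (p : ℤ) ∣ D₀) (v : ℕ) (b : ℤ) :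
    genusTerm (D₀ * E) D₀ (p ^ v) b =
      kroneckerSymbol D₀ p ^ v * localTerm (fun _ => 1) (D₀ * E) (p ^ v) b := by
  have hv : p ^ v ≠ 0 := pow_ne_zero _ hp.ne_zero
  by_cases h : (4 * (p ^ v : ℕ) : ℤ) ∣ b ^ 2 - D₀ * E
  · obtain ⟨c, hc⟩ := h
    rw [genusTerm_of_eq hv hc, localTerm_of_eq _ hv hc, mul_one,
      ← kroneckerSymbol_pow_right _ hp.ne_zero]
    refine genusCharacter_eq_kroneckerSymbol hd hE (by linear_combination hc)
      (Nat.pos_of_ne_zero hv) ?_ (x := 1) (y := 0) (by ring)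
    rw [← Int.isCoprime_iff_gcd_eq_one]
    push_cast
    exact ((Prime.coprime_iff_not_dvd (Nat.prime_iff_prime_int.mp hp)).mpr hpD).pow_left
  · rw [genusTerm_of_not_dvd h, localTerm_of_not_dvd _ h, mul_zero]

/-- Here `p ∣ b`, so both sides vanish when `p ∣ c`. Otherwise the character of `P e` is the product
of those of `P` and `e`, and each may be evaluated at its own represented number: `pᵛ` for `e`, and
a number `≡ c (mod 8p)` for `P`. -/
theorem genusTerm_prime_pow_of_dvd {p : ℕ} {P : ℤ} {ψ : ℤ → ℤ} (hψ : IsLocalCharacter p P ψ)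
    (hp : p.Prime) {e E : ℤ} (he : IsGenusDiscriminant e) (he0 : e ≠ 0)
    (hd : IsGenusDiscriminant (P * e)) (hE : E % 4 = 0 ∨ E % 4 = 1)
    (hpe : ¬ (p : ℤ) ∣ e) {v : ℕ} (hv : v ≠ 0) (b : ℤ) :
    genusTerm (P * e * E) (P * e) (p ^ v) b =
      kroneckerSymbol e p ^ v * localTerm ψ (P * e * E) (p ^ v) b := by
  have hpv : p ^ v ≠ 0 := pow_ne_zero _ hp.ne_zero
  have hpZ := Nat.prime_iff_prime_int.mp hp
  by_cases h : (4 * (p ^ v : ℕ) : ℤ) ∣ b ^ 2 - P * e * E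
  swap
  · rw [genusTerm_of_not_dvd h, localTerm_of_not_dvd _ h, mul_zero]
  obtain ⟨c, hc⟩ := h
  rw [genusTerm_of_eq hpv hc, localTerm_of_eq _ hpv hc]
  have hdisc : b ^ 2 - 4 * (p ^ v : ℕ) * c = P * e * E := by linear_combination hc
  have hpP := hψ.dvd
  have hpa : (p : ℤ) ∣ (p ^ v : ℕ) := by push_cast; exact dvd_pow_self _ hv
  have hpb : (p : ℤ) ∣ b := by
    refine hpZ.dvd_of_dvd_pow (n := 2) ?_
    rw [show b ^ 2 = P * (e * E) + (p ^ v : ℕ) * (4 * c) by linear_combination hdisc]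
    exact (hpP.mul_right _).add (hpa.mul_right _)
  by_cases hpc : (p : ℤ) ∣ c
  · rw [hψ.eq_zero_of_dvd hp hpc, mul_zero]
    by_contra h0
    exact gcd_four_eq_one_iff.mp (gcd_eq_one_of_genusCharacter_ne_zero h0) p hp hpa hpb hpc
      (hpP.mul_right _)
  obtain ⟨n, hn, hnc, x, y, hxy⟩ := exists_rep_coprime (a := (p ^ v : ℕ)) (b := b) (c := c)
    (mul_ne_zero (hψ.ne_zero hp) he0) (by positivity) (hdisc ▸ Dvd.intro _ rfl) (by
      rw [gcd_four_eq_one_iff]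
      intro q hq hqa _ hqc _
      push_cast at hqa
      have := (Nat.prime_dvd_prime_iff_eq hq hp).mp (Int.natCast_dvd_natCast.mp
        ((Nat.prime_iff_prime_int.mp hq).dvd_of_dvd_pow hqa))
      exact hpc (this ▸ hqc))
  have hnc' : IsCoprime (n : ℤ) (P * e) := Int.isCoprime_iff_gcd_eq_one.mpr hnc
  rw [genusCharacter_eq_kroneckerSymbol hd hE hdisc hn hnc hxy,
    kroneckerSymbol_mul_left _ _ hn.ne', mul_comm]
  congr 1
  · rw [← kroneckerSymbol_pow_right _ hp.ne_zero]
    have hE' := disc_mod_four (hψ.isGenusDiscriminant hp) hE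
    have hdisc' : b ^ 2 - 4 * (p ^ v : ℕ) * c = e * (P * E) := by rw [hdisc]; ring
    rw [← genusCharacter_eq_kroneckerSymbol he hE' hdisc' hn
        (Int.isCoprime_iff_gcd_eq_one.mp hnc'.of_mul_right_right) hxy,
      ← genusCharacter_eq_kroneckerSymbol he hE' hdisc' (Nat.pos_of_ne_zero hpv) _
        (x := 1) (y := 0) (by ring)]
    rw [← Int.isCoprime_iff_gcd_eq_one]
    push_cast
    exact ((Prime.coprime_iff_not_dvd hpZ).mpr hpe).pow_left
  · have hE' := disc_mod_four he hE
    have hdisc' : b ^ 2 - 4 * (p ^ v : ℕ) * c = P * (e * E) := by rw [hdisc]; ring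
    -- The factor `8p` makes the value at `(X, 1)` congruent to `c` modulo a period of `ψ`; the
    -- other factor makes that value positive.
    set X : ℤ := 8 * p * (|b * 1| + |c| * 1 ^ 2 + 1) with hX
    have hXge : |b * 1| + |c| * 1 ^ 2 + 1 ≤ X := by
      have h1 : (1 : ℤ) ≤ p := by exact_mod_cast hp.one_lt.le
      have h2 : 0 ≤ |b * 1| + |c| * 1 ^ 2 + 1 := by positivity
      rw [hX]; nlinarith
    have hpos := quadratic_form_pos (a := (p ^ v : ℕ)) (by positivity) hXge
    obtain ⟨m, hm⟩ := Int.eq_ofNat_of_zero_le hpos.le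
    have hm0 : 0 < m := by omega
    have hmc : (8 * p : ℤ) ∣ m - c := by
      refine ⟨(|b * 1| + |c| * 1 ^ 2 + 1) * ((p ^ v : ℕ) * X + b), ?_⟩
      rw [← hm, hX]
      ring
    have hψm := hψ.congr_mod hmc
    rw [← hψm, ← hψ.kroneckerSymbol_eq hp hm0.ne',
      ← genusCharacter_eq_kroneckerSymbol (hψ.isGenusDiscriminant hp) hE' hdisc' hn
        (Int.isCoprime_iff_gcd_eq_one.mp hnc'.of_mul_right_left) hxy,
      ← genusCharacter_eq_kroneckerSymbol (hψ.isGenusDiscriminant hp) hE' hdisc' hm0 _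
        (x := X) (y := 1) hm]
    rw [int_gcd_eq_one_iff_prime]
    intro q hq hqm hqP
    obtain rfl := hψ.prime_eq_of_dvd hp hq hqP
    exact hpc (by simpa using hqm.sub ((Dvd.intro_left (8 : ℤ) rfl).trans hmc))

theorem genusSum_prime_pow_of_not_dvd {D₀ E : ℤ} (hd : IsGenusDiscriminant D₀)
    (hE : E % 4 = 0 ∨ E % 4 = 1) {p : ℕ} (hp : p.Prime) (hpD : ¬ (p : ℤ) ∣ D₀) (v : ℕ) :
    genusSum (D₀ * E) D₀ (p ^ v) =
      kroneckerSymbol D₀ p ^ v * localSum (fun _ => 1) (D₀ * E) (p ^ v) := by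
  rw [genusSum_eq_sum_genusTerm, localSum, Finset.mul_sum]
  exact Finset.sum_congr rfl fun b _ => genusTerm_prime_pow_of_not_dvd hd hE hp hpD v b

theorem genusSum_prime_pow_of_dvd {p : ℕ} {P : ℤ} {ψ : ℤ → ℤ} (hψ : IsLocalCharacter p P ψ)
    (hp : p.Prime) {e E : ℤ} (he : IsGenusDiscriminant e) (he0 : e ≠ 0)
    (hd : IsGenusDiscriminant (P * e)) (hE : E % 4 = 0 ∨ E % 4 = 1)
    (hpe : ¬ (p : ℤ) ∣ e) {v : ℕ} (hv : v ≠ 0) :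
    genusSum (P * e * E) (P * e) (p ^ v) =
      kroneckerSymbol e p ^ v * localSum ψ (P * e * E) (p ^ v) := by
  rw [genusSum_eq_sum_genusTerm, localSum, Finset.mul_sum]
  exact Finset.sum_congr rfl fun b _ => genusTerm_prime_pow_of_dvd hψ hp he he0 hd hE hpe hv b

/-! ### Periodicity of local terms and scaling of the discriminant by `p²`. -/

theorem isGenusDiscriminant_one : IsGenusDiscriminant 1 := ⟨1, 1, by simp, by norm_num, by simp⟩

/-- With `e = 1` the local term is the genus term of `P` itself, whose periodicity is known. -/
theorem localTerm_add_two_mul {p : ℕ} {P : ℤ} {ψ : ℤ → ℤ} (hψ : IsLocalCharacter p P ψ)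
    (hp : p.Prime) {E : ℤ} (hE : E % 4 = 0 ∨ E % 4 = 1) {v : ℕ} (hv : v ≠ 0) (b : ℤ) :
    localTerm ψ (P * E) (p ^ v) (b + 2 * (p ^ v : ℕ)) = localTerm ψ (P * E) (p ^ v) b := by
  have key := genusTerm_prime_pow_of_dvd hψ hp isGenusDiscriminant_one one_ne_zero
    (by simpa using hψ.isGenusDiscriminant hp) hE
    (fun h => hp.one_lt.ne' (by simpa using Int.eq_one_of_dvd_one (by positivity) h)) hv
  simp only [mul_one, kroneckerSymbol_one_left, one_pow, one_mul] at key
  rw [← key, ← key]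
  exact genusTerm_add_two_mul (hψ.isGenusDiscriminant hp) hE (pow_ne_zero _ hp.ne_zero) b

theorem localTerm_one_add_two_mul (Δ : ℤ) (a : ℕ) (b : ℤ) :
    localTerm (fun _ => 1) Δ a (b + 2 * a) = localTerm (fun _ => 1) Δ a b := by
  have : (b + 2 * a) ^ 2 - Δ = b ^ 2 - Δ + 4 * a * (b + a) := by ring
  rw [localTerm, localTerm, this]
  simp only [dvd_add_left (Dvd.intro (b + a) (rfl : (4 * a : ℤ) * (b + a) = _))]

theorem sum_range_mul_eq {M : Type*} [AddCommMonoid M] (f : ℕ → M) (p m : ℕ) :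
    ∑ b ∈ Finset.range (p * m), f b =
      ∑ b ∈ Finset.range m, ∑ t ∈ Finset.range p, f (b + m * t) := by
  rw [Finset.sum_comm]
  induction p with
  | zero => simp
  | succ p ih =>
    rw [Finset.sum_range_succ, ← ih, add_mul, one_mul, Finset.sum_range_add]
    congr 1
    exact Finset.sum_congr rfl fun x _ => by rw [add_comm x, mul_comm p]

theorem sum_range_mul_of_periodic_int (f : ℤ → ℤ) (p m : ℕ) (hf : Function.Periodic f m) :
    ∑ b ∈ Finset.range (p * m), f b = p * ∑ b ∈ Finset.range m, f b := by
  rw [sum_range_mul_eq (fun b => f b), Finset.mul_sum]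
  refine Finset.sum_congr rfl fun b _ => ?_
  have h : ∀ t ∈ Finset.range p, f ((b + m * t : ℕ) : ℤ) = f b := fun t _ => by
    have := hf.nat_mul t b
    push_cast
    rwa [mul_comm (m : ℤ)]
  rw [Finset.sum_congr rfl h]
  simp

theorem sum_range_mul_of_support (f : ℤ → ℤ) {p : ℕ} (hp : p ≠ 0) (m : ℕ)
    (hf : ∀ b : ℤ, ¬ (p : ℤ) ∣ b → f b = 0) :
    ∑ b ∈ Finset.range (p * m), f b = ∑ b ∈ Finset.range m, f (p * b) := by
  rw [mul_comm p, sum_range_mul_eq (fun b => f b), Finset.sum_eq_single_of_mem 0]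
  · simp
  · exact Finset.mem_range.mpr (Nat.pos_of_ne_zero hp)
  · intro b hb hb0
    refine Finset.sum_eq_zero fun t _ => hf _ fun h => ?_
    have h' : p ∣ b := by
      rw [Int.natCast_dvd_natCast] at h
      exact (Nat.dvd_add_left (Dvd.intro _ rfl)).mp h
    exact hb0 (Nat.eq_zero_of_dvd_of_lt h' (Finset.mem_range.mp hb))

/-- Only multiples `b = p b'` contribute, and `p²` cancels from the quotient; `b'` then runs over an
interval `p` times as long as in the sum for `Δ` and `pᵛ`. -/
theorem localSum_sq_mul (ψ : ℤ → ℤ) (Δ : ℤ) {p : ℕ} (hp : p.Prime) (v : ℕ) :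
    localSum ψ (p ^ 2 * Δ) (p ^ (v + 2)) =
      ∑ b ∈ Finset.range (p * (2 * p ^ v)), localTerm ψ Δ (p ^ v) b := by
  have hp0 : (p : ℤ) ^ 2 ≠ 0 := pow_ne_zero _ (by exact_mod_cast hp.ne_zero)
  rw [localSum, show 2 * p ^ (v + 2) = p * (p * (2 * p ^ v)) by ring,
    sum_range_mul_of_support _ hp.ne_zero]
  · refine Finset.sum_congr rfl fun b _ => ?_
    have h1 : (4 * ((p ^ (v + 2) : ℕ) : ℤ)) = p ^ 2 * (4 * (p ^ v : ℕ)) := by push_cast; ring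
    have h2 : ((p : ℤ) * b) ^ 2 - p ^ 2 * Δ = p ^ 2 * (b ^ 2 - Δ) := by ring
    rw [localTerm, localTerm, h1, h2]
    simp only [mul_dvd_mul_iff_left hp0, Int.mul_ediv_mul_of_pos _ _
      (lt_of_le_of_ne (sq_nonneg _) hp0.symm)]
  · intro b hb
    refine localTerm_of_not_dvd _ fun h => hb ?_
    have h3 : (p : ℤ) ∣ 4 * (p ^ (v + 2) : ℕ) := by
      push_cast; exact (dvd_pow_self _ (by omega)).mul_left _
    have h4 := (h3.trans h).add (Dvd.intro (p * Δ) (by ring : (p : ℤ) * (p * Δ) = p ^ 2 * Δ))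
    rw [sub_add_cancel] at h4
    exact (Nat.prime_iff_prime_int.mp hp).dvd_of_dvd_pow h4

theorem localSum_one_sq_mul (Δ : ℤ) {p : ℕ} (hp : p.Prime) (v : ℕ) :
    localSum (fun _ => 1) (p ^ 2 * Δ) (p ^ (v + 2)) = p * localSum (fun _ => 1) Δ (p ^ v) := by
  rw [localSum_sq_mul _ _ hp, sum_range_mul_of_periodic_int (localTerm _ Δ _), localSum]
  intro b
  push_cast
  simpa using localTerm_one_add_two_mul Δ (p ^ v) b

/-- The case `v = 0` is different, since `ψ((b² - Δ)/4)` need not have period `2` in `b`;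
`localSum_sq_mul_sq` deals with it. -/
theorem localSum_sq_mul_of_pos {p : ℕ} {P : ℤ} {ψ : ℤ → ℤ} (hψ : IsLocalCharacter p P ψ)
    (hp : p.Prime) {E : ℤ} (hE : E % 4 = 0 ∨ E % 4 = 1) {v : ℕ} (hv : v ≠ 0) :
    localSum ψ (P * (p ^ 2 * E)) (p ^ (v + 2)) = p * localSum ψ (P * E) (p ^ v) := by
  rw [show P * (p ^ 2 * E) = p ^ 2 * (P * E) by ring, localSum_sq_mul _ _ hp,
    sum_range_mul_of_periodic_int (localTerm _ _ _), localSum]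
  intro b
  have := localTerm_add_two_mul hψ hp hE hv b
  push_cast at this ⊢
  exact this

/-! ### Complete residue systems and the count of square roots. -/

theorem sum_range_intCast_zmod {p : ℕ} [NeZero p] {M : Type*} [AddCommMonoid M] (h : ZMod p → M) :
    ∑ x ∈ Finset.range p, h x = ∑ z : ZMod p, h z := by
  refine Finset.sum_nbij' (fun x => (x : ZMod p)) ZMod.val ?_ ?_ ?_ ?_ ?_
  · simp
  · intro z _; simpa using ZMod.val_lt z
  · intro x hx; exact ZMod.val_cast_of_lt (Finset.mem_range.mp hx)
  · intro z _; exact ZMod.natCast_zmod_val z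
  · simp

theorem sum_range_affine {p : ℕ} [Fact p.Prime] {M : Type*} [AddCommMonoid M] (h : ZMod p → M)
    {m c : ZMod p} (hm : m ≠ 0) :
    ∑ x ∈ Finset.range p, h (m * x + c) = ∑ z : ZMod p, h z := by
  rw [sum_range_intCast_zmod (fun z => h (m * z + c))]
  exact Fintype.sum_bijective (fun z => m * z + c)
    ((Finite.injective_iff_bijective).mp fun x y hxy => by
      simpa [hm] using hxy) _ _ fun _ => rfl

theorem sq_emod_four_of_parity {b u : ℤ} (hu : u % 4 = 0 ∨ u % 4 = 1) (h : b % 2 = u % 2) :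
    (4 : ℤ) ∣ b ^ 2 - u := by
  have h1 : b ^ 2 % 4 = b % 2 := by
    rcases (by omega : b % 4 = 0 ∨ b % 4 = 1 ∨ b % 4 = 2 ∨ b % 4 = 3) with h | h | h | h
    all_goals rw [pow_two, Int.mul_emod, h]; omega
  omega

theorem parity_of_four_dvd {b u : ℤ} (h : (4 : ℤ) ∣ b ^ 2 - u) : b % 2 = u % 2 := by
  have h3 : b ^ 2 % 2 = b % 2 := by
    rcases Int.emod_two_eq_zero_or_one b with h | h <;> simp [pow_two, Int.mul_emod, h]
  omega

/-- Residues modulo `2 p` of fixed parity form a complete residue system modulo an odd prime. -/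
theorem sum_range_two_mul_prime {p : ℕ} [Fact p.Prime] (h2 : p ≠ 2) {u : ℤ}
    (hu : u % 4 = 0 ∨ u % 4 = 1) (h : ZMod p → ℤ) :
    ∑ b ∈ Finset.range (2 * p), (if (4 : ℤ) ∣ (b : ℤ) ^ 2 - u then h (b : ℤ) else 0) =
      ∑ z : ZMod p, h z := by
  have h2' : (2 : ZMod p) ≠ 0 := by
    intro h0
    have : (p : ℕ) ∣ 2 := (ZMod.natCast_eq_zero_iff 2 p).mp (by exact_mod_cast h0)
    exact h2 ((Nat.prime_dvd_prime_iff_eq Fact.out Nat.prime_two).mp this)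
  rw [sum_range_two_mul_of_parity (fun b : ℤ => if (4 : ℤ) ∣ b ^ 2 - u then h b else 0) (Δ := u)
    (fun b hb => if_neg fun h' => hb (parity_of_four_dvd h')),
    ← sum_range_affine h (m := 2) (c := ((u % 2 : ℤ) : ZMod p)) h2']
  refine Finset.sum_congr rfl fun x _ => ?_
  rw [if_pos (sq_emod_four_of_parity hu (by omega))]
  push_cast
  rfl

/-- This counts the points of the conic `y² = z² - u`. With `s = z - y` it reads `2sz = s² + u`: one
`z` for each `s ≠ 0`, while `s = 0` contributes `p` points if `u = 0` and none otherwise. -/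
theorem sum_quadraticChar_sq_sub {p : ℕ} [Fact p.Prime] (h2 : p ≠ 2) (u : ZMod p) :
    ∑ z : ZMod p, quadraticChar (ZMod p) (z ^ 2 - u) = if u = 0 then (p : ℤ) - 1 else -1 := by
  have hchar : ringChar (ZMod p) ≠ 2 := by rwa [ZMod.ringChar_zmod_n]
  have h2' : (2 : ZMod p) ≠ 0 := Ring.two_ne_zero hchar
  have h1 : ∀ a : ZMod p, quadraticChar (ZMod p) a =
      (∑ y : ZMod p, if y ^ 2 = a then (1 : ℤ) else 0) - 1 := fun a => by
    rw [eq_sub_iff_add_eq, ← quadraticChar_card_sqrts hchar a, Finset.sum_boole]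
    congr 2
    ext; simp
  have h3 : ∀ z : ZMod p, (∑ y : ZMod p, if y ^ 2 = z ^ 2 - u then (1 : ℤ) else 0) =
      ∑ s : ZMod p, if 2 * s * z = s ^ 2 + u then (1 : ℤ) else 0 := fun z => by
    refine Fintype.sum_bijective (fun y => z - y) (sub_right_injective.bijective_of_finite) _ _
      fun y => ?_
    congr 1
    rw [eq_iff_iff]
    constructor <;> intro h <;> linear_combination -h
  have h4 : ∀ s : ZMod p, s ≠ 0 →
      (∑ z : ZMod p, if 2 * s * z = s ^ 2 + u then (1 : ℤ) else 0) = 1 := fun s hs => by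
    rw [Finset.sum_eq_single ((2 * s)⁻¹ * (s ^ 2 + u))]
    · rw [if_pos]; field_simp
    · intro z _ hz
      rw [if_neg]
      intro h
      apply hz
      rw [← h]; field_simp
    · simp
  simp only [h1, h3]
  rw [Finset.sum_sub_distrib, Finset.sum_comm, ← Finset.add_sum_erase _ _ (Finset.mem_univ 0),
    Finset.sum_congr rfl (fun s hs => h4 s (Finset.ne_of_mem_erase hs))]
  have hp1 : 1 ≤ p := (Fact.out : p.Prime).one_lt.le
  by_cases hu : u = 0
  · simp [hu, Finset.card_erase_of_mem, ZMod.card, Nat.cast_sub hp1]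
  · simp [hu, Finset.card_erase_of_mem, ZMod.card, Nat.cast_sub hp1, Ne.symm hu]

theorem quadraticChar_intCast {p : ℕ} [Fact p.Prime] (c : ℤ) :
    quadraticChar (ZMod p) (c : ZMod p) = jacobiSym c p := by
  rw [← jacobiSym.legendreSym.to_jacobiSym, legendreSym]

theorem jacobiSym_four_mul {p : ℕ} (hp : p.Prime) (h2 : p ≠ 2) (c : ℤ) :
    jacobiSym (4 * c) p = jacobiSym c p := by
  have h : jacobiSym ((2 : ℤ) ^ 2) p = 1 := jacobiSym.sq_one' (by
    simpa [Int.gcd] using Nat.coprime_two_left.mpr (hp.odd_of_ne_two h2))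
  rw [show (4 : ℤ) = 2 ^ 2 by norm_num, jacobiSym.mul_left, h, one_mul]

theorem jacobiSym_eq_of_dvd_sub {p : ℕ} {x y : ℤ} (h : (p : ℤ) ∣ x - y) :
    jacobiSym x p = jacobiSym y p :=
  jacobiSym.mod_left' (Int.ModEq.symm (Int.modEq_iff_dvd.mpr h))

theorem localSum_one_two {Δ : ℤ} (hΔ : Δ % 4 = 0 ∨ Δ % 4 = 1) :
    localSum (fun _ => 1) Δ 2 = 1 + kroneckerSymbol Δ 2 := by
  rw [kroneckerSymbol_two, ZMod.χ₈_int_eq_if_mod_eight, localSum]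
  simp only [show 2 * 2 = 4 from rfl, Finset.sum_range_succ, Finset.sum_range_zero, localTerm]
  push_cast
  split_ifs <;> omega

theorem dvd_four_mul_iff {p : ℕ} (hp : p.Prime) (h2 : p ≠ 2) (x : ℤ) :
    (4 * p : ℤ) ∣ x ↔ (4 : ℤ) ∣ x ∧ (p : ℤ) ∣ x := by
  have hc : IsCoprime (4 : ℤ) p := by
    have : Nat.Coprime (2 ^ 2) p :=
      ((Nat.coprime_primes Nat.prime_two hp).mpr (Ne.symm h2)).pow_left 2
    exact_mod_cast Nat.isCoprime_iff_coprime.mpr this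
  exact ⟨fun h => ⟨(Dvd.intro _ rfl).trans h, (Dvd.intro_left _ rfl).trans h⟩,
    fun h => hc.mul_dvd h.1 h.2⟩

theorem localSum_one_prime {Δ : ℤ} (hΔ : Δ % 4 = 0 ∨ Δ % 4 = 1) {p : ℕ} (hp : p.Prime) :
    localSum (fun _ => 1) Δ p = 1 + kroneckerSymbol Δ p := by
  by_cases h2 : p = 2
  · subst h2; exact localSum_one_two hΔ
  have := Fact.mk hp
  have hchar : ringChar (ZMod p) ≠ 2 := by rwa [ZMod.ringChar_zmod_n]
  rw [kroneckerSymbol_of_odd _ (hp.odd_of_ne_two h2), ← quadraticChar_intCast, add_comm,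
    ← quadraticChar_card_sqrts hchar,
    show ((Set.toFinset {x : ZMod p | x ^ 2 = Δ}).card : ℤ) =
      ∑ z : ZMod p, if z ^ 2 = Δ then (1 : ℤ) else 0 by
        rw [Finset.sum_boole]; congr 2; ext; simp,
    ← sum_range_two_mul_prime h2 hΔ, localSum]
  refine Finset.sum_congr rfl fun b _ => ?_
  have hiff : ((b : ℤ) : ZMod p) ^ 2 = Δ ↔ (p : ℤ) ∣ (b : ℤ) ^ 2 - Δ := by
    rw [← ZMod.intCast_zmod_eq_zero_iff_dvd, Int.cast_sub, sub_eq_zero, Int.cast_pow]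
  simp only [localTerm, dvd_four_mul_iff hp h2, hiff, ite_and]

theorem sum_range_linear {p : ℕ} [Fact p.Prime] (h : ZMod p → ℤ) {b c : ℤ} (hb : ¬ (p : ℤ) ∣ b) :
    ∑ t ∈ Finset.range p, h ((c + b * t : ℤ) : ZMod p) = ∑ z : ZMod p, h z := by
  rw [← sum_range_affine h (m := (b : ZMod p)) (c := (c : ZMod p))
    (by rwa [Ne, ZMod.intCast_zmod_eq_zero_iff_dvd])]
  refine Finset.sum_congr rfl fun t _ => ?_
  congr 1
  push_cast
  ring

theorem not_dvd_of_sq_sub {p : ℕ} {Δ b m : ℤ} (hΔ : ¬ (p : ℤ) ∣ Δ)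
    (h : b ^ 2 - Δ = p * m) : ¬ (p : ℤ) ∣ b := fun hb => hΔ (by
  rw [show Δ = b * b - p * m by linear_combination -h]
  exact (hb.mul_right _).sub (Dvd.intro _ rfl))

/-- Hensel lifting: replacing `b` by `b + 2pᵛ⁺¹t` changes `c` into `c + bt` modulo `p`, and since `p
∤ b` exactly one `t` survives. The factor `4` in the modulus makes this valid at `p = 2` too. -/
theorem localSum_one_prime_pow_succ {Δ : ℤ} {p : ℕ} (hp : p.Prime) (hΔ : ¬ (p : ℤ) ∣ Δ) (v : ℕ) :
    localSum (fun _ => 1) Δ (p ^ (v + 2)) = localSum (fun _ => 1) Δ (p ^ (v + 1)) := by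
  have := Fact.mk hp
  have hv : p ^ (v + 1) ≠ 0 := pow_ne_zero _ hp.ne_zero
  have h4 : (4 * (p ^ (v + 1) : ℕ) : ℤ) ≠ 0 := by positivity
  rw [localSum, show 2 * p ^ (v + 2) = p * (2 * p ^ (v + 1)) by ring,
    sum_range_mul_eq (fun b => localTerm _ Δ _ b), localSum]
  refine Finset.sum_congr rfl fun b _ => ?_
  by_cases h : (4 * (p ^ (v + 1) : ℕ) : ℤ) ∣ (b : ℤ) ^ 2 - Δ
  · obtain ⟨c, hc⟩ := h
    have hb : ¬ (p : ℤ) ∣ b := not_dvd_of_sq_sub hΔ (m := 4 * p ^ v * c) (by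
      rw [hc]; push_cast; ring)
    rw [localTerm_of_eq _ hv hc]
    have hsum := sum_range_linear (fun z : ZMod p => if z = 0 then (1 : ℤ) else 0) (c := c) hb
    rw [Finset.sum_ite_eq' Finset.univ (0 : ZMod p) (fun _ => (1 : ℤ)),
      if_pos (Finset.mem_univ _)] at hsum
    refine (Finset.sum_congr rfl fun t _ => ?_).trans hsum
    have h1 : ((b + 2 * p ^ (v + 1) * t : ℕ) : ℤ) ^ 2 - Δ =
        4 * (p ^ (v + 1) : ℕ) * (c + b * t + p * (p ^ v * t ^ 2)) := by
      push_cast at hc ⊢; linear_combination hc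
    have h2 : (4 * (p ^ (v + 2) : ℕ) : ℤ) = 4 * (p ^ (v + 1) : ℕ) * p := by push_cast; ring
    simp only [localTerm]
    rw [h1, h2]
    simp only [mul_dvd_mul_iff_left h4, ZMod.intCast_zmod_eq_zero_iff_dvd,
      dvd_add_left (Dvd.intro (p ^ v * t ^ 2 : ℤ) (rfl : (p : ℤ) * (p ^ v * t ^ 2) = _))]
  · rw [localTerm_of_not_dvd _ h]
    refine Finset.sum_eq_zero fun t _ => localTerm_of_not_dvd _ fun h' => h ?_
    have h1 : ((b + 2 * p ^ (v + 1) * t : ℕ) : ℤ) ^ 2 - Δ =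
        (b : ℤ) ^ 2 - Δ + 4 * (p ^ (v + 1) : ℕ) * (b * t + p ^ (v + 1) * t ^ 2) := by
      push_cast; ring
    have h2 : (4 * (p ^ (v + 2) : ℕ) : ℤ) = 4 * (p ^ (v + 1) : ℕ) * p := by push_cast; ring
    have h3 := (Dvd.intro _ h2.symm).trans h'
    rwa [h1, dvd_add_left (Dvd.intro _ rfl)] at h3

theorem localSum_one_prime_pow {Δ : ℤ} (hΔ : Δ % 4 = 0 ∨ Δ % 4 = 1) {p : ℕ} (hp : p.Prime)
    (hpΔ : ¬ (p : ℤ) ∣ Δ) (v : ℕ) :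
    localSum (fun _ => 1) Δ (p ^ (v + 1)) = 1 + kroneckerSymbol Δ p := by
  induction v with
  | zero => simpa using localSum_one_prime hΔ hp
  | succ v ih => rw [localSum_one_prime_pow_succ hp hpΔ, ih]

theorem localSum_eq_zero_of_forall_not_dvd (ψ : ℤ → ℤ) {Δ : ℤ} {p : ℕ}
    (h : ∀ b : ℤ, ¬ (4 * p ^ 2 : ℤ) ∣ b ^ 2 - Δ) (v : ℕ) : localSum ψ Δ (p ^ (v + 2)) = 0 :=
  Finset.sum_eq_zero fun b _ => localTerm_of_not_dvd _ fun h' =>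
    h b ((Dvd.intro ((p : ℤ) ^ v) (by push_cast; ring)).trans h')

/-! ### Local sums at ramified primes. -/

/-- `E` is a discriminant that is ramified at `p` and has conductor prime to `p`. -/
def IsRamifiedAt (p : ℕ) (E : ℤ) : Prop :=
  (p ≠ 2 ∧ (p : ℤ) ∣ E ∧ ¬ (p : ℤ) ^ 2 ∣ E) ∨
  (p = 2 ∧ ∃ Q w : ℤ, (Q = -4 ∨ Q = 8 ∨ Q = -8) ∧ w % 4 = 1 ∧ E = Q * w)

theorem sq_mod_four (b : ℤ) : b ^ 2 % 4 = 0 ∨ b ^ 2 % 4 = 1 := by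
  rcases Int.even_or_odd b with ⟨k, rfl⟩ | ⟨k, rfl⟩
  · left; ring_nf; omega
  · right; ring_nf; omega

/-- For odd `p`, divisibility would give `p ∣ b` and then `p² ∣ E`. For `p = 2`, it would give `b =
2z` with `z² ≡ 2` or `3` modulo `4`. -/
theorem IsRamifiedAt.not_dvd {p : ℕ} {E : ℤ} (h : IsRamifiedAt p E) (hp : p.Prime) (b : ℤ) :
    ¬ (4 * p ^ 2 : ℤ) ∣ b ^ 2 - E := by
  intro hd
  rcases h with ⟨-, h1, h2⟩ | ⟨rfl, Q, w, hQ, hw, rfl⟩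
  · have h3 : (p : ℤ) ^ 2 ∣ b ^ 2 - E := (Dvd.intro_left _ rfl).trans hd
    have h4 : (p : ℤ) ∣ b := by
      refine (Nat.prime_iff_prime_int.mp hp).dvd_of_dvd_pow (n := 2) ?_
      have := ((dvd_pow_self (p : ℤ) two_ne_zero).trans h3).add h1
      rwa [sub_add_cancel] at this
    apply h2
    have := (pow_dvd_pow_of_dvd h4 2).sub h3
    rwa [sub_sub_cancel] at this
  · obtain ⟨m, hm⟩ := hd
    push_cast at hm
    have hb : Even b := by
      have : Even (b ^ 2) := by
        rw [show b ^ 2 = 16 * m + Q * w by linarith]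
        rcases hQ with rfl | rfl | rfl
        · exact ⟨8 * m - 2 * w, by ring⟩
        · exact ⟨8 * m + 4 * w, by ring⟩
        · exact ⟨8 * m - 4 * w, by ring⟩
      exact (Int.even_pow.mp this).1
    obtain ⟨z, rfl⟩ := hb
    have hz := sq_mod_four z
    ring_nf at hm
    rcases hQ with rfl | rfl | rfl <;> omega

theorem IsLocalCharacter.isRamifiedAt_mul {p : ℕ} {P : ℤ} {ψ : ℤ → ℤ}
    (hψ : IsLocalCharacter p P ψ) (hp : p.Prime) {E : ℤ} (hE : E % 4 = 0 ∨ E % 4 = 1)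
    (hpE : ¬ (p : ℤ) ∣ E) : IsRamifiedAt p (P * E) := by
  have hp0 : (p : ℤ) ≠ 0 := by exact_mod_cast hp.ne_zero
  rcases hψ with ⟨h2, rfl, -⟩ | ⟨rfl, h⟩
  · refine Or.inl ⟨h2, (Dvd.intro_left _ rfl).mul_right _, fun h => hpE ?_⟩
    rw [mul_comm (ZMod.χ₄ p) _, mul_assoc, pow_two, mul_dvd_mul_iff_left hp0] at h
    rcases chi_four_prime_eq hp h2 with h' | h' <;> rw [h'] at h <;> simpa using h
  · refine Or.inr ⟨rfl, P, E, by tauto, ?_, rfl⟩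
    push_cast at hpE
    omega

theorem localSum_prime_pow_eq_zero {p : ℕ} {P : ℤ} {ψ : ℤ → ℤ}
    (hψ : IsLocalCharacter p P ψ) (hp : p.Prime) {E : ℤ} (hE : E % 4 = 0 ∨ E % 4 = 1)
    (hpE : ¬ (p : ℤ) ∣ E) (v : ℕ) : localSum ψ (P * E) (p ^ (v + 2)) = 0 :=
  localSum_eq_zero_of_forall_not_dvd ψ ((hψ.isRamifiedAt_mul hp hE hpE).not_dvd hp) v

theorem jacobiSym_neg_chi_four {p : ℕ} (hp : p.Prime) (h2 : p ≠ 2) :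
    jacobiSym (-ZMod.χ₄ p) p = 1 := by
  have hodd := hp.odd_of_ne_two h2
  rcases Nat.odd_mod_four_iff.mp (Nat.odd_iff.mp hodd) with h | h
  · rw [ZMod.χ₄_nat_one_mod_four h, jacobiSym.at_neg_one hodd, ZMod.χ₄_nat_one_mod_four h]
  · rw [ZMod.χ₄_nat_three_mod_four h, neg_neg, jacobiSym.one_left]

/-- A root `b = pz` gives `4c = pz² - χ₄(p) E`, so `(c / p) = (-χ₄(p) / p)(E / p) = (E / p)`; the
number of roots is `1` by `localSum_one_prime`. -/
theorem localSum_prime_of_odd {p : ℕ} (hp : p.Prime) (h2 : p ≠ 2) {E : ℤ}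
    (hE : E % 4 = 0 ∨ E % 4 = 1) :
    localSum (fun c => jacobiSym c p) (ZMod.χ₄ p * p * E) p = kroneckerSymbol E p := by
  have hp0 : (p : ℤ) ≠ 0 := by exact_mod_cast hp.ne_zero
  have hΔ := mul_mod_four_disc (prime_discriminant_mod_four hp h2) hE
  have h1 := localSum_one_prime hΔ hp
  rw [kroneckerSymbol_eq_zero_of_prime_dvd hp ((Dvd.intro_left _ rfl).mul_right _), add_zero] at h1
  rw [kroneckerSymbol_of_odd _ (hp.odd_of_ne_two h2), ← mul_one (jacobiSym E p), ← h1, localSum,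
    localSum, Finset.mul_sum]
  refine Finset.sum_congr rfl fun b _ => ?_
  by_cases h : (4 * p : ℤ) ∣ (b : ℤ) ^ 2 - ZMod.χ₄ p * p * E
  · obtain ⟨c, hc⟩ := h
    rw [localTerm_of_eq _ hp.ne_zero hc, localTerm_of_eq _ hp.ne_zero hc, mul_one]
    obtain ⟨z, hz⟩ : (p : ℤ) ∣ b := by
      refine (Nat.prime_iff_prime_int.mp hp).dvd_of_dvd_pow (n := 2) ?_
      exact ⟨4 * c + ZMod.χ₄ p * E, by linear_combination hc⟩
    have h3 : 4 * c = p * z ^ 2 + -ZMod.χ₄ p * E := by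
      apply mul_left_cancel₀ hp0
      rw [hz] at hc
      linear_combination -hc
    rw [← jacobiSym_four_mul hp h2, h3, jacobiSym_eq_of_dvd_sub (y := -ZMod.χ₄ p * E)
      ⟨z ^ 2, by ring⟩, jacobiSym.mul_left, jacobiSym_neg_chi_four hp h2, one_mul]
  · rw [localTerm_of_not_dvd _ h, localTerm_of_not_dvd _ h, mul_zero]

theorem localSum_two_of_mod_eight_eq_zero (ψ : ℤ → ℤ) {Δ c : ℤ} (h : Δ = 8 * c) :
    localSum ψ Δ 2 = ψ (-c) := by
  rw [localSum]
  simp only [show 2 * 2 = 4 from rfl, Finset.sum_range_succ, Finset.sum_range_zero]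
  rw [localTerm_of_eq ψ two_ne_zero (c := -c) (by push_cast; linarith),
    localTerm_of_not_dvd _ (by push_cast; omega), localTerm_of_not_dvd _ (by push_cast; omega),
    localTerm_of_not_dvd _ (by push_cast; omega)]
  ring

theorem localSum_two_of_mod_eight_eq_four (ψ : ℤ → ℤ) {Δ c : ℤ} (h : Δ = 8 * c + 4) :
    localSum ψ Δ 2 = ψ (-c) := by
  rw [localSum]
  simp only [show 2 * 2 = 4 from rfl, Finset.sum_range_succ, Finset.sum_range_zero]
  rw [localTerm_of_not_dvd _ (by push_cast; omega), localTerm_of_not_dvd _ (by push_cast; omega),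
    localTerm_of_eq ψ two_ne_zero (c := -c) (by push_cast; linarith),
    localTerm_of_not_dvd _ (by push_cast; omega)]
  ring

theorem localSum_two {P : ℤ} {ψ : ℤ → ℤ} (hψ : IsLocalCharacter 2 P ψ) {E : ℤ}
    (hE : E % 4 = 0 ∨ E % 4 = 1) : localSum ψ (P * E) 2 = kroneckerSymbol E 2 := by
  rw [kroneckerSymbol_two, ZMod.χ₈_int_eq_if_mod_eight]
  rcases hψ with ⟨h2, -⟩ | ⟨-, ⟨rfl, rfl⟩ | ⟨rfl, rfl⟩ | ⟨rfl, rfl⟩⟩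
  · exact absurd rfl h2
  · rcases hE with h | h
    · rw [localSum_two_of_mod_eight_eq_zero _ (c := -(E / 2)) (by omega),
        ZMod.χ₄_int_eq_if_mod_four]
      split_ifs <;> omega
    · rw [localSum_two_of_mod_eight_eq_four _ (c := -((E + 1) / 2)) (by omega),
        ZMod.χ₄_int_eq_if_mod_four]
      split_ifs <;> omega
  · rw [localSum_two_of_mod_eight_eq_zero _ (c := E) (by omega), ZMod.χ₈_int_eq_if_mod_eight]
    split_ifs <;> omega
  · rw [localSum_two_of_mod_eight_eq_zero _ (c := -E) (by omega), ZMod.χ₈'_int_eq_if_mod_eight]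
    split_ifs <;> omega

theorem localSum_prime {p : ℕ} {P : ℤ} {ψ : ℤ → ℤ} (hψ : IsLocalCharacter p P ψ) (hp : p.Prime)
    {E : ℤ} (hE : E % 4 = 0 ∨ E % 4 = 1) : localSum ψ (P * E) p = kroneckerSymbol E p := by
  by_cases h2 : p = 2
  · subst h2; exact localSum_two hψ hE
  · rcases hψ with ⟨-, rfl, rfl⟩ | ⟨h, -⟩
    · exact localSum_prime_of_odd hp h2 hE
    · exact absurd h h2

theorem isUnit_sq_mod_four {p : ℕ} (hp : p.Prime) (h2 : p ≠ 2) : (p : ℤ) ^ 2 % 4 = 1 := by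
  obtain ⟨k, hk⟩ := hp.odd_of_ne_two h2
  rw [hk]; push_cast
  rw [show ((2 : ℤ) * k + 1) ^ 2 = 4 * (k ^ 2 + k) + 1 by ring]
  omega

theorem disc_of_sq_mul {p : ℕ} (hp : p.Prime) (h2 : p ≠ 2) {u : ℤ}
    (h : (p ^ 2 * u) % 4 = 0 ∨ (p ^ 2 * u) % 4 = 1) : u % 4 = 0 ∨ u % 4 = 1 := by
  rw [Int.mul_emod, isUnit_sq_mod_four hp h2] at h
  omega

theorem localSum_sq_of_odd {p : ℕ} (hp : p.Prime) (h2 : p ≠ 2) {u : ℤ}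
    (hu : u % 4 = 0 ∨ u % 4 = 1) :
    localSum (fun c => jacobiSym c p) (p ^ 2 * u) (p ^ 2) =
      if (p : ℤ) ∣ u then (p : ℤ) - 1 else -1 := by
  have := Fact.mk hp
  have h := localSum_sq_mul (fun c => jacobiSym c p) u hp 0
  rw [zero_add] at h
  rw [h, pow_zero, mul_one, mul_comm p 2]
  have h3 := sum_quadraticChar_sq_sub h2 (u : ZMod p)
  simp only [ZMod.intCast_zmod_eq_zero_iff_dvd] at h3
  rw [← h3, ← sum_range_two_mul_prime h2 hu]
  refine Finset.sum_congr rfl fun b _ => ?_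
  by_cases hb : (4 : ℤ) ∣ (b : ℤ) ^ 2 - u
  · obtain ⟨c, hc⟩ := hb
    rw [if_pos ⟨c, hc⟩, localTerm_of_eq _ one_ne_zero (c := c) (by rw [hc]; push_cast; ring),
      ← jacobiSym_four_mul hp h2, ← hc, ← quadraticChar_intCast]
    push_cast
    rfl
  · rw [if_neg hb, localTerm_of_not_dvd _ (by push_cast; exact hb)]

/-- Along the lifts `b + 2pᵛ⁺¹t` of one root, `c + bt` runs through all residues modulo `p`, and the
quadratic character sums to zero. -/
theorem localSum_pow_of_odd {p : ℕ} (hp : p.Prime) (h2 : p ≠ 2) {u : ℤ} (hpu : ¬ (p : ℤ) ∣ u)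
    (v : ℕ) : localSum (fun c => jacobiSym c p) (p ^ 2 * u) (p ^ (v + 3)) = 0 := by
  have := Fact.mk hp
  have hv : p ^ (v + 1) ≠ 0 := pow_ne_zero _ hp.ne_zero
  have hchar : ringChar (ZMod p) ≠ 2 := by rwa [ZMod.ringChar_zmod_n]
  rw [localSum_sq_mul _ _ hp (v + 1), sum_range_mul_eq (fun b => localTerm _ u _ b)]
  refine Finset.sum_eq_zero fun b _ => ?_
  by_cases h : (4 * (p ^ (v + 1) : ℕ) : ℤ) ∣ (b : ℤ) ^ 2 - u
  · obtain ⟨c, hc⟩ := h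
    have hb : ¬ (p : ℤ) ∣ b := not_dvd_of_sq_sub hpu (m := 4 * p ^ v * c) (by
      rw [hc]; push_cast; ring)
    refine (Finset.sum_congr rfl fun t _ => ?_).trans
      ((sum_range_linear (fun z : ZMod p => quadraticChar (ZMod p) z) (c := c) hb).trans
        (quadraticChar_sum_zero hchar))
    have h1 : ((b + 2 * p ^ (v + 1) * t : ℕ) : ℤ) ^ 2 - u =
        4 * (p ^ (v + 1) : ℕ) * (c + b * t + p * (p ^ v * t ^ 2)) := by
      push_cast at hc ⊢; linear_combination hc
    rw [localTerm_of_eq _ hv h1, quadraticChar_intCast]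
    exact jacobiSym_eq_of_dvd_sub ⟨p ^ v * t ^ 2, by ring⟩
  · refine Finset.sum_eq_zero fun t _ => localTerm_of_not_dvd _ fun h' => h ?_
    have h1 : ((b + 2 * p ^ (v + 1) * t : ℕ) : ℤ) ^ 2 - u =
        (b : ℤ) ^ 2 - u + 4 * (p ^ (v + 1) : ℕ) * (b * t + p ^ (v + 1) * t ^ 2) := by
      push_cast; ring
    rwa [h1, dvd_add_left (Dvd.intro _ rfl)] at h'

/-- The case `p = 2` of `localSum ψ (4 Δ) 4`. -/
theorem localSum_four (ψ : ℤ → ℤ) {v : ℤ} :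
    localSum ψ (4 * (4 * v)) 4 = ψ (-v) + ψ (1 - v) := by
  have h := localSum_sq_mul ψ (4 * v) Nat.prime_two 0
  norm_num only [zero_add, pow_zero, mul_one, Nat.cast_ofNat] at h
  rw [h]
  simp only [Finset.sum_range_succ, Finset.sum_range_zero]
  rw [localTerm_of_eq ψ one_ne_zero (c := -v) (by push_cast; ring),
    localTerm_of_not_dvd _ (by push_cast; omega),
    localTerm_of_eq ψ one_ne_zero (c := 1 - v) (by push_cast; ring),
    localTerm_of_not_dvd _ (by push_cast; omega)]
  ring

/-- Only `b = 2β` contributes, and the terms for `β` and `β + 2ʲ` cancel: the shift changes `c` into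
`c + 2β + 2ʲ`, where `ψ` changes sign by hypothesis. -/
theorem localSum_two_pow_eq_zero (ψ : ℤ → ℤ) {u : ℤ} (j : ℕ)
    (h : ∀ β c : ℤ, β ^ 2 - u = 2 ^ j * c → ψ (c + 2 * β + 2 ^ j) = -ψ c) :
    localSum ψ (4 * (4 * u)) (2 ^ (j + 2)) = 0 := by
  have h0 := localSum_sq_mul ψ (4 * u) Nat.prime_two j
  have hj : (2 : ℕ) ^ j ≠ 0 := by positivity
  norm_num only [Nat.cast_ofNat] at h0
  rw [← mul_assoc] at h0 ⊢
  norm_num only at h0 ⊢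
  rw [h0, sum_range_mul_of_support (localTerm ψ (4 * u) (2 ^ j)) two_ne_zero]
  · rw [sum_range_mul_eq (fun b : ℕ => localTerm ψ (4 * u) (2 ^ j) ((2 : ℕ) * b)) 2]
    refine Finset.sum_eq_zero fun b _ => ?_
    simp only [Finset.sum_range_succ, Finset.sum_range_zero]
    push_cast
    by_cases hb : (4 * (2 ^ j : ℕ) : ℤ) ∣ (2 * (b : ℤ)) ^ 2 - 4 * u
    · obtain ⟨c, hc⟩ := hb
      have hc' : (b : ℤ) ^ 2 - u = 2 ^ j * c := by push_cast at hc; linarith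
      rw [localTerm_of_eq ψ hj (c := c) (by rw [← hc]; ring),
        localTerm_of_eq ψ hj (c := c + 2 * b + 2 ^ j) (by push_cast; linear_combination 4 * hc'),
        h b c hc']
      ring
    · rw [localTerm_of_not_dvd _ (by simpa using hb), localTerm_of_not_dvd]
      · simp
      · intro h'
        apply hb
        have h1 : (2 * ((b : ℤ) + 2 ^ j * 1)) ^ 2 - 4 * u =
            (2 * (b : ℤ)) ^ 2 - 4 * u + 4 * (2 ^ j : ℕ) * (2 * b + 2 ^ j) := by push_cast; ring
        rwa [h1, dvd_add_left (Dvd.intro _ rfl)] at h'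
  · intro b hb
    refine localTerm_of_not_dvd _ fun h' => hb ?_
    have h2 : (2 : ℤ) ∣ b ^ 2 := by
      have h3 : (2 : ℤ) ∣ b ^ 2 - 4 * u := (Dvd.intro (2 * (2 ^ j : ℕ) : ℤ) (by ring)).trans h'
      omega
    exact Int.prime_two.dvd_of_dvd_pow h2

theorem zmod_four_shift : ∀ x : ZMod 4, ZMod.χ₄ (x + 2) = -ZMod.χ₄ x := by decide

theorem zmod_eight_shift : ∀ x : ZMod 8, ZMod.χ₈ (x + 4) = -ZMod.χ₈ x ∧
    ZMod.χ₈' (x + 4) = -ZMod.χ₈' x := by decide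

theorem chi_four_shift {c d : ℤ} (h : (d - c) % 4 = 2) :
    ZMod.χ₄ (d : ZMod 4) = -ZMod.χ₄ (c : ZMod 4) := by
  rw [← zmod_four_shift]
  congr 1
  have : ((d : ℤ) : ZMod 4) = ((c + 2 : ℤ) : ZMod 4) := by
    rw [ZMod.intCast_eq_intCast_iff_dvd_sub]; push_cast; omega
  rw [this]; push_cast; rfl

theorem chi_eight_shift {c d : ℤ} (h : (d - c) % 8 = 4) :
    ZMod.χ₈ (d : ZMod 8) = -ZMod.χ₈ (c : ZMod 8) ∧
      ZMod.χ₈' (d : ZMod 8) = -ZMod.χ₈' (c : ZMod 8) := by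
  have : ((d : ℤ) : ZMod 8) = (c : ZMod 8) + 4 := by
    have : ((d : ℤ) : ZMod 8) = ((c + 4 : ℤ) : ZMod 8) := by
      rw [ZMod.intCast_eq_intCast_iff_dvd_sub]; push_cast; omega
    rw [this]; push_cast; rfl
  rw [this]
  exact zmod_eight_shift _

theorem four_dvd_two_pow (i : ℕ) : ∃ k : ℤ, (2 : ℤ) ^ (i + 2) = 4 * k :=
  ⟨2 ^ i, by ring⟩

theorem sq_mod_eight (b : ℤ) : (b % 2 = 0 ∧ (b ^ 2 % 8 = 0 ∨ b ^ 2 % 8 = 4)) ∨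
    (b % 2 = 1 ∧ b ^ 2 % 8 = 1) := by
  rcases (by omega : b % 8 = 0 ∨ b % 8 = 1 ∨ b % 8 = 2 ∨ b % 8 = 3 ∨ b % 8 = 4 ∨ b % 8 = 5 ∨
    b % 8 = 6 ∨ b % 8 = 7) with h | h | h | h | h | h | h | h
  all_goals
    have h1 : b ^ 2 % 8 = (b % 8) * (b % 8) % 8 := by rw [pow_two, Int.mul_emod]
    rw [h] at h1
    omega

/-- Either both arguments are even and both values vanish, or the shift is `2` modulo `4`, half the
conductor of `χ₄`. The mod `8` analogue, with shift `4`, is `chi_eight_shift_of_norm_four`. -/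
theorem chi_four_shift_of_norm {u β c : ℤ} (hu : u % 4 = 1 ∨ u % 4 = 2) {j : ℕ}
    (h : β ^ 2 - u = 2 ^ (j + 1) * c) :
    ZMod.χ₄ ((c + 2 * β + 2 ^ (j + 1) : ℤ) : ZMod 4) = -ZMod.χ₄ (c : ZMod 4) := by
  have hβ := sq_mod_eight β
  rcases j with _ | i
  · simp only [zero_add, pow_one] at h ⊢
    rcases hu with hu | hu
    · have h0 : (c % 2 = 0) ∧ ((c + 2 * β + 2) % 2 = 0) := by omega
      have h1 := ZMod.χ₄_int_eq_if_mod_four c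
      have h2 := ZMod.χ₄_int_eq_if_mod_four (c + 2 * β + 2)
      rw [if_pos h0.1] at h1
      rw [if_pos h0.2] at h2
      rw [h1, h2, neg_zero]
    · exact chi_four_shift (by omega)
  · apply chi_four_shift
    obtain ⟨k, hk⟩ := four_dvd_two_pow i
    rw [show i + 1 + 1 = i + 2 by ring, hk] at h ⊢
    rw [mul_assoc] at h
    generalize k * c = m at h
    omega

set_option maxRecDepth 20000 in
theorem zmod_eight_shift_two : ∀ x w : ZMod 8, (w = 1 ∨ w = 5) →
    ZMod.χ₈ (2 * x ^ 2 + w + 2 * (2 * x) + 2) = -ZMod.χ₈ (2 * x ^ 2 + w) ∧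
    ZMod.χ₈' (2 * x ^ 2 - w + 2 * (2 * x) + 2) = -ZMod.χ₈' (2 * x ^ 2 - w) := by decide

theorem intCast_zmod_eight_of_one_mod_four {w : ℤ} (hw : w % 4 = 1) :
    (w : ZMod 8) = 1 ∨ (w : ZMod 8) = 5 := by
  rcases (by omega : w % 8 = 1 ∨ w % 8 = 5) with h | h
  · left; exact_mod_cast (ZMod.intCast_eq_intCast_iff' w 1 8).mpr h
  · right; exact_mod_cast (ZMod.intCast_eq_intCast_iff' w 5 8).mpr h

/-- Only `j = 0` occurs, because `4` cannot divide `β² + 2w`; then `β = 2x`, `c = 2x² + w`, and a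
finite check remains. -/
theorem chi_eight_shift_of_norm_neg_two {w β c : ℤ} (hw : w % 4 = 1) {j : ℕ}
    (h : β ^ 2 - (-2 * w) = 2 ^ (j + 1) * c) :
    ZMod.χ₈ ((c + 2 * β + 2 ^ (j + 1) : ℤ) : ZMod 8) = -ZMod.χ₈ (c : ZMod 8) := by
  have hβ := sq_mod_eight β
  rcases j with _ | i
  · norm_num at h ⊢
    obtain ⟨x, rfl⟩ : ∃ x, β = 2 * x := ⟨β / 2, by omega⟩
    obtain rfl : c = 2 * x ^ 2 + w := by linarith
    push_cast
    exact (zmod_eight_shift_two x w (intCast_zmod_eight_of_one_mod_four hw)).1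
  · obtain ⟨k, hk⟩ := four_dvd_two_pow i
    rw [show i + 1 + 1 = i + 2 by ring, hk] at h
    rw [mul_assoc] at h
    generalize k * c = m at h
    omega

theorem chi_eight_shift_of_norm_two {w β c : ℤ} (hw : w % 4 = 1) {j : ℕ}
    (h : β ^ 2 - 2 * w = 2 ^ (j + 1) * c) :
    ZMod.χ₈' ((c + 2 * β + 2 ^ (j + 1) : ℤ) : ZMod 8) = -ZMod.χ₈' (c : ZMod 8) := by
  have hβ := sq_mod_eight β
  rcases j with _ | i
  · norm_num at h ⊢
    obtain ⟨x, rfl⟩ : ∃ x, β = 2 * x := ⟨β / 2, by omega⟩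
    obtain rfl : c = 2 * x ^ 2 - w := by linarith
    push_cast
    exact (zmod_eight_shift_two x w (intCast_zmod_eight_of_one_mod_four hw)).2
  · obtain ⟨k, hk⟩ := four_dvd_two_pow i
    rw [show i + 1 + 1 = i + 2 by ring, hk] at h
    rw [mul_assoc] at h
    generalize k * c = m at h
    omega

theorem chi_eight_of_even {c : ℤ} (h : c % 2 = 0) :
    ZMod.χ₈ (c : ZMod 8) = 0 ∧ ZMod.χ₈' (c : ZMod 8) = 0 := by
  rw [ZMod.χ₈_int_eq_if_mod_eight, ZMod.χ₈'_int_eq_if_mod_eight, if_pos h, if_pos h]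
  exact ⟨rfl, rfl⟩

theorem chi_eight_shift_of_norm_four {w β c : ℤ} (hw : w % 2 = 1) {j : ℕ}
    (h : β ^ 2 - 4 * w = 2 ^ (j + 1) * c) :
    ZMod.χ₈ ((c + 2 * β + 2 ^ (j + 1) : ℤ) : ZMod 8) = -ZMod.χ₈ (c : ZMod 8) ∧
      ZMod.χ₈' ((c + 2 * β + 2 ^ (j + 1) : ℤ) : ZMod 8) = -ZMod.χ₈' (c : ZMod 8) := by
  have hβ := sq_mod_eight β
  obtain ⟨x, rfl⟩ : ∃ x, β = 2 * x := by
    refine ⟨β / 2, ?_⟩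
    rw [pow_succ' (2 : ℤ), mul_assoc] at h
    generalize 2 ^ j * c = m at h
    omega
  have hx := sq_mod_eight x
  rcases j with _ | _ | i
  · have h1 : c = 2 * (x ^ 2 - w) := by norm_num at h; linarith
    have h2 := chi_eight_of_even (c := c) (by omega)
    have h3 := chi_eight_of_even (c := c + 2 * (2 * x) + 2 ^ (0 + 1)) (by norm_num; omega)
    rw [h2.1, h2.2, h3.1, h3.2, neg_zero]
    exact ⟨rfl, rfl⟩
  · have h1 : c = x ^ 2 - w := by norm_num at h; linarith
    norm_num only
    rcases Int.emod_two_eq_zero_or_one x with hx2 | hx2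
    · exact chi_eight_shift (by omega)
    · have h2 := chi_eight_of_even (c := c) (by omega)
      have h3 := chi_eight_of_even (c := c + 2 * (2 * x) + 4) (by omega)
      rw [h2.1, h2.2, h3.1, h3.2, neg_zero]
      exact ⟨rfl, rfl⟩
  · have hk : (2 : ℤ) ^ (i + 1 + 1 + 1) = 8 * 2 ^ i := by ring
    rw [hk] at h ⊢
    have h1 : x ^ 2 - w = 2 * (2 ^ i * c) := by linarith
    apply chi_eight_shift
    generalize (2 : ℤ) ^ i * c = m at h1
    generalize (2 : ℤ) ^ i = k at *
    omega

/-- The local sums at `2` for `P E = 16 u`. -/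
theorem localSum_ramified_two {P : ℤ} {ψ : ℤ → ℤ} (hψ : IsLocalCharacter 2 P ψ) {E : ℤ}
    (hE : IsRamifiedAt 2 E) :
    localSum ψ (P * E) (2 ^ 2) = -1 ∧ ∀ v : ℕ, localSum ψ (P * E) (2 ^ (v + 3)) = 0 := by
  obtain ⟨h, -⟩ | ⟨-, Q, w, hQ, hw, rfl⟩ := hE
  · exact absurd rfl h
  have key : ∀ u : ℤ, P * (Q * w) = 4 * (4 * u) → ψ (-u) + ψ (1 - u) = -1 →
      (∀ (j : ℕ) (β c : ℤ), β ^ 2 - u = 2 ^ (j + 1) * c →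
        ψ (c + 2 * β + 2 ^ (j + 1)) = -ψ c) →
      localSum ψ (P * (Q * w)) (2 ^ 2) = -1 ∧
        ∀ v : ℕ, localSum ψ (P * (Q * w)) (2 ^ (v + 3)) = 0 := by
    intro u hu h1 h2
    rw [hu]
    exact ⟨(localSum_four ψ).trans h1, fun v => localSum_two_pow_eq_zero ψ (v + 1) (h2 v)⟩
  rcases hψ with ⟨h, -⟩ | ⟨-, ⟨rfl, rfl⟩ | ⟨rfl, rfl⟩ | ⟨rfl, rfl⟩⟩
  · exact absurd rfl h
  · rcases hQ with rfl | rfl | rfl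
    · refine key w (by ring) ?_ fun j β c h => chi_four_shift_of_norm (by omega) h
      simp only [ZMod.χ₄_int_eq_if_mod_four]
      split_ifs <;> omega
    · refine key (-2 * w) (by ring) ?_ fun j β c h => chi_four_shift_of_norm (by omega) h
      simp only [ZMod.χ₄_int_eq_if_mod_four]
      split_ifs <;> omega
    · refine key (2 * w) (by ring) ?_ fun j β c h => chi_four_shift_of_norm (by omega) h
      simp only [ZMod.χ₄_int_eq_if_mod_four]
      split_ifs <;> omega
  · rcases hQ with rfl | rfl | rfl
    · refine key (-2 * w) (by ring) ?_ fun j β c h => chi_eight_shift_of_norm_neg_two hw h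
      simp only [ZMod.χ₈_int_eq_if_mod_eight]
      split_ifs <;> omega
    · refine key (4 * w) (by ring) ?_ fun j β c h =>
        (chi_eight_shift_of_norm_four (by omega) h).1
      simp only [ZMod.χ₈_int_eq_if_mod_eight]
      split_ifs <;> omega
    · refine key (4 * -w) (by ring) ?_ fun j β c h =>
        (chi_eight_shift_of_norm_four (by omega) h).1
      simp only [ZMod.χ₈_int_eq_if_mod_eight]
      split_ifs <;> omega
  · rcases hQ with rfl | rfl | rfl
    · refine key (2 * w) (by ring) ?_ fun j β c h => chi_eight_shift_of_norm_two hw h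
      simp only [ZMod.χ₈'_int_eq_if_mod_eight]
      split_ifs <;> omega
    · refine key (4 * -w) (by ring) ?_ fun j β c h =>
        (chi_eight_shift_of_norm_four (by omega) h).2
      simp only [ZMod.χ₈'_int_eq_if_mod_eight]
      split_ifs <;> omega
    · refine key (4 * w) (by ring) ?_ fun j β c h =>
        (chi_eight_shift_of_norm_four (by omega) h).2
      simp only [ZMod.χ₈'_int_eq_if_mod_eight]
      split_ifs <;> omega

theorem localSum_ramified {p : ℕ} {P : ℤ} {ψ : ℤ → ℤ} (hψ : IsLocalCharacter p P ψ)
    (hp : p.Prime) {E : ℤ} (hE4 : E % 4 = 0 ∨ E % 4 = 1) (hE : IsRamifiedAt p E) :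
    localSum ψ (P * E) (p ^ 2) = -1 ∧ ∀ v : ℕ, localSum ψ (P * E) (p ^ (v + 3)) = 0 := by
  by_cases h2 : p = 2
  · subst h2; exact localSum_ramified_two hψ hE
  obtain ⟨-, ⟨u, rfl⟩, h4⟩ := hE.resolve_right fun h => h2 h.1
  obtain ⟨-, rfl, rfl⟩ := hψ.resolve_right fun h => h2 h.1
  have hp0 : (p : ℤ) ≠ 0 := by exact_mod_cast hp.ne_zero
  have hu : ¬ (p : ℤ) ∣ ZMod.χ₄ p * u := by
    intro h
    rw [pow_two, mul_dvd_mul_iff_left hp0] at h4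
    rcases chi_four_prime_eq hp h2 with h' | h' <;> rw [h'] at h <;> exact h4 (by simpa using h)
  have h5 : ZMod.χ₄ p * p * (p * u) = p ^ 2 * (ZMod.χ₄ p * u) := by ring
  have hu4 : (ZMod.χ₄ p * u) % 4 = 0 ∨ (ZMod.χ₄ p * u) % 4 = 1 :=
    disc_of_sq_mul hp h2 (h5 ▸ mul_mod_four_disc (prime_discriminant_mod_four hp h2) hE4)
  rw [h5]
  exact ⟨by rw [localSum_sq_of_odd hp h2 hu4, if_neg hu], localSum_pow_of_odd hp h2 hu⟩

theorem localSum_sq_mul_sq {p : ℕ} {P : ℤ} {ψ : ℤ → ℤ} (hψ : IsLocalCharacter p P ψ)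
    (hp : p.Prime) {E : ℤ} (hE : E % 4 = 0 ∨ E % 4 = 1) :
    localSum ψ (P * (p ^ 2 * E)) (p ^ 2) = p - 1 := by
  rcases hψ with ⟨h2, rfl, rfl⟩ | ⟨rfl, h⟩
  · rw [show ZMod.χ₄ p * p * (p ^ 2 * E) = p ^ 2 * (ZMod.χ₄ p * p * E) by ring,
      localSum_sq_of_odd hp h2 (mul_mod_four_disc (prime_discriminant_mod_four hp h2) hE),
      if_pos ((Dvd.intro_left _ rfl).mul_right _)]
  · norm_num only
    have key : ∀ v : ℤ, P * (4 * E) = 4 * (4 * v) → ψ (-v) + ψ (1 - v) = 1 →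
      localSum ψ (P * (4 * E)) 4 = 1 := fun v hv h1 => by rw [hv, localSum_four, h1]
    rcases h with ⟨rfl, rfl⟩ | ⟨rfl, rfl⟩ | ⟨rfl, rfl⟩
    · refine key (-E) (by ring) ?_
      simp only [ZMod.χ₄_int_eq_if_mod_four]
      split_ifs <;> omega
    · refine key (2 * E) (by ring) ?_
      simp only [ZMod.χ₈_int_eq_if_mod_eight]
      split_ifs <;> omega
    · refine key (-2 * E) (by ring) ?_
      simp only [ZMod.χ₈'_int_eq_if_mod_eight]
      split_ifs <;> omega

/-! ### Fundamental discriminants at a prime. -/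

theorem IsGenusDiscriminant.mod_four_of_odd {d : ℤ} (h : IsGenusDiscriminant d)
    (h2 : ¬ (2 : ℤ) ∣ d) : d % 4 = 1 := by
  obtain ⟨P, e, rfl | rfl | rfl | rfl, he, rfl⟩ := h
  · simpa using he
  all_goals exact absurd ((by norm_num : (2 : ℤ) ∣ _).mul_right e) h2

theorem IsGenusDiscriminant.mod_four {d : ℤ} (h : IsGenusDiscriminant d) :
    d % 4 = 0 ∨ d % 4 = 1 := by
  simpa using disc_mod_four h (E := 1) (by norm_num)

theorem IsFundamentalDiscriminant.not_sq_dvd {d : ℤ} (h : IsFundamentalDiscriminant d) {p : ℕ}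
    (hp : p.Prime) (h2 : p ≠ 2) : ¬ (p : ℤ) ^ 2 ∣ d := by
  have hu : ¬ IsUnit (p : ℤ) := (Nat.prime_iff_prime_int.mp hp).not_isUnit
  intro hd
  rw [pow_two] at hd
  rcases h with ⟨-, h⟩ | ⟨m, rfl, -, h⟩
  · exact hu (h _ hd)
  · have hc : IsCoprime ((p : ℤ) * p) 4 := by
      have : IsCoprime (p : ℤ) (2 ^ 2) :=
        (Nat.isCoprime_iff_coprime.mpr ((Nat.coprime_primes hp Nat.prime_two).mpr h2)).pow_right
      exact this.mul_left this
    exact hu (h _ (hc.dvd_of_dvd_mul_left hd))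

theorem IsFundamentalDiscriminant.ne_zero {d : ℤ} (h : IsFundamentalDiscriminant d) : d ≠ 0 := by
  rintro rfl
  exact h.not_sq_dvd Nat.prime_three (by norm_num) (dvd_zero _)

/-- A fundamental discriminant divisible by `p` splits off a prime discriminant at `p`. -/
theorem IsFundamentalDiscriminant.exists_local_factor {d : ℤ} (h : IsFundamentalDiscriminant d)
    {p : ℕ} (hp : p.Prime) (hpd : (p : ℤ) ∣ d) :
    ∃ P ψ e, IsLocalCharacter p P ψ ∧ d = P * e ∧ IsGenusDiscriminant e ∧ e ≠ 0 ∧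
      ¬ (p : ℤ) ∣ e := by
  have hd0 := h.ne_zero
  obtain ⟨Q, w, hQ, hw, hQw⟩ := h.isGenusDiscriminant
  have hpZ := Nat.prime_iff_prime_int.mp hp
  by_cases h2 : p = 2
  · subst h2
    push_cast at hpd
    have hQ1 : Q ≠ 1 := by rintro rfl; omega
    have hwg : IsGenusDiscriminant w := ⟨1, w, by simp, hw, by simp⟩
    have hw0 : w ≠ 0 := by rintro rfl; norm_num at hw
    have hw2 : ¬ ((2 : ℕ) : ℤ) ∣ w := by push_cast; omega
    rcases hQ.resolve_left hQ1 with rfl | rfl | rfl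
    · exact ⟨-4, _, w, Or.inr ⟨rfl, Or.inl ⟨rfl, rfl⟩⟩, hQw, hwg, hw0, hw2⟩
    · exact ⟨8, _, w, Or.inr ⟨rfl, Or.inr (Or.inl ⟨rfl, rfl⟩)⟩, hQw, hwg, hw0, hw2⟩
    · exact ⟨-8, _, w, Or.inr ⟨rfl, Or.inr (Or.inr ⟨rfl, rfl⟩)⟩, hQw, hwg, hw0, hw2⟩
  · have hpw : (p : ℤ) ∣ w := by
      rw [hQw] at hpd
      refine (hpZ.dvd_or_dvd hpd).resolve_left fun hpQ => h2 ?_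
      rw [← Nat.prime_dvd_prime_iff_eq hp Nat.prime_two, ← Int.natCast_dvd_natCast]
      refine hpZ.dvd_of_dvd_pow (n := 3) (hpQ.trans ?_)
      rcases hQ with rfl | rfl | rfl | rfl <;> norm_num
    obtain ⟨w', rfl⟩ := hpw
    have hχ : ZMod.χ₄ p * ZMod.χ₄ p = 1 := by
      rcases chi_four_prime_eq hp h2 with h | h <;> rw [h] <;> norm_num
    have hde : d = ZMod.χ₄ p * p * (Q * (ZMod.χ₄ p * w')) := by
      rw [hQw]; linear_combination (-(Q * p * w')) * hχ
    refine ⟨_, _, Q * (ZMod.χ₄ p * w'), Or.inl ⟨h2, rfl, rfl⟩, hde, ⟨Q, _, hQ, ?_, rfl⟩, ?_, ?_⟩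
    · have h1 : ZMod.χ₄ p * p * (ZMod.χ₄ p * w') % 4 = 1 := by
        rw [show ZMod.χ₄ p * p * (ZMod.χ₄ p * w') = ZMod.χ₄ p * ZMod.χ₄ p * (p * w') by ring, hχ,
          one_mul, hw]
      rw [Int.mul_emod, prime_discriminant_mod_four hp h2] at h1
      omega
    · intro h0
      rw [h0, mul_zero] at hde
      exact hd0 hde
    · rintro ⟨y, hy⟩
      exact h.not_sq_dvd hp h2 ⟨ZMod.χ₄ p * y, by rw [hde, hy]; ring⟩

theorem IsFundamentalDiscriminant.isRamifiedAt {d : ℤ} (h : IsFundamentalDiscriminant d)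
    {p : ℕ} (hp : p.Prime) (hpd : (p : ℤ) ∣ d) : IsRamifiedAt p d := by
  by_cases h2 : p = 2
  · subst h2
    obtain ⟨Q, w, hQ, hw, hQw⟩ := h.isGenusDiscriminant
    refine Or.inr ⟨rfl, Q, w, hQ.resolve_left ?_, hw, hQw⟩
    rintro rfl
    push_cast at hpd
    omega
  · exact Or.inl ⟨h2, hpd, h.not_sq_dvd hp h2⟩

theorem IsRamifiedAt.mul {p : ℕ} (hp : p.Prime) {E x : ℤ} (h : IsRamifiedAt p E)
    (hx : ¬ (p : ℤ) ∣ x) (hx4 : p = 2 → x % 4 = 1) : IsRamifiedAt p (E * x) := by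
  rcases h with ⟨h2, h3, h4⟩ | ⟨h2, Q, w, hQ, hw, rfl⟩
  · refine Or.inl ⟨h2, h3.mul_right _, fun h5 => h4 ?_⟩
    have hc : IsCoprime ((p : ℤ) ^ 2) x :=
      ((Prime.coprime_iff_not_dvd (Nat.prime_iff_prime_int.mp hp)).mpr hx).pow_left
    exact hc.dvd_of_dvd_mul_right h5
  · refine Or.inr ⟨h2, Q, w * x, hQ, ?_, by ring⟩
    rw [Int.mul_emod, hw, hx4 h2]; rfl

theorem mul_sq_mod_four {E : ℤ} (hE : E % 4 = 0 ∨ E % 4 = 1) (f : ℤ) :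
    E * f ^ 2 % 4 = 0 ∨ E * f ^ 2 % 4 = 1 := by
  rcases sq_mod_four f with h | h <;> rw [Int.mul_emod, h] <;> omega

theorem kroneckerSymbol_mul_sq {d f : ℤ} {p : ℕ} (hp : p.Prime) (hf : ¬ (p : ℤ) ∣ f) :
    kroneckerSymbol (d * f ^ 2) p = kroneckerSymbol d p := by
  have hc : Int.gcd p f = 1 := Int.isCoprime_iff_gcd_eq_one.mp
    ((Prime.coprime_iff_not_dvd (Nat.prime_iff_prime_int.mp hp)).mpr hf)
  have h := kroneckerSymbol_sq_of_coprime hp.ne_zero hc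
  rw [kroneckerSymbol_mul_left _ _ hp.ne_zero, pow_two, kroneckerSymbol_mul_left _ _ hp.ne_zero,
    ← pow_two, h, mul_one]

theorem kroneckerSymbol_prime_sq {d : ℤ} {p : ℕ} (hp : p.Prime) (hd : ¬ (p : ℤ) ∣ d) :
    kroneckerSymbol d p ^ 2 = 1 :=
  kroneckerSymbol_sq_of_coprime hp.ne_zero (Int.isCoprime_iff_gcd_eq_one.mp
    ((Prime.coprime_iff_not_dvd (Nat.prime_iff_prime_int.mp hp)).mpr hd))

/-! ### Euler factors of the genus sums. -/

open PowerSeries in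
/-- The generating series of the genus sums at the powers of `p`. -/
noncomputable def genusSeries (D₀ E : ℤ) (p : ℕ) : PowerSeries ℤ :=
  mk fun v => genusSum (D₀ * E) D₀ (p ^ v)

open PowerSeries in
/-- The Euler factor at `p` of the contribution of a conductor with `p`-adic valuation `m`. -/
noncomputable def conductorSeries (p : ℕ) (η : ℤ) (m : ℕ) : PowerSeries ℤ :=
  mk fun v => if v % 2 = 0 then (if v / 2 ≤ m then (p : ℤ) ^ (v / 2) else 0)
    else (if v / 2 < m then -η * (p : ℤ) ^ (v / 2) else 0)

section GeneratingSeries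

open PowerSeries

theorem conductorSeries_zero (p : ℕ) (η : ℤ) : conductorSeries p η 0 = 1 := by
  ext v
  rw [conductorSeries, coeff_mk, coeff_one]
  rcases v with _ | _ | v
  · simp
  · simp
  · rw [if_neg (by omega : ¬ (v + 1 + 1) / 2 ≤ 0), if_neg (by omega : ¬ (v + 1 + 1) / 2 < 0),
      ite_self, if_neg (by omega)]

theorem conductorSeries_succ (p : ℕ) (η : ℤ) (m : ℕ) :
    conductorSeries p η (m + 1) = 1 - C η * X + C (p : ℤ) * X ^ 2 * conductorSeries p η m := by
  ext v
  simp only [map_add, map_sub, mul_assoc, coeff_C_mul, coeff_X_pow_mul', coeff_one, coeff_X]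
  rcases v with _ | _ | v
  · simp [conductorSeries]
  · simp [conductorSeries]
  · simp only [conductorSeries, coeff_mk, Nat.add_sub_cancel, add_assoc, Nat.reduceAdd]
    rw [show (v + 2) % 2 = v % 2 by omega, show (v + 2) / 2 = v / 2 + 1 by omega]
    simp [pow_succ]
    split_ifs <;> ring

/-- The scaling of local sums gives the term `p X²`; `H` corrects the lowest exponents. It is `1 -
X²` if `p ∣ D₀` and `1 + (D₀ / p) X` otherwise. Both are `(1 - X²) / (1 - (D₀ / p) X)`, so
multiplying by the two linear factors yields the recursion `conductorSeries_succ`. -/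
theorem genusSeries_sq_mul {D₀ E : ℤ} (hd : IsFundamentalDiscriminant D₀)
    (hE : E % 4 = 0 ∨ E % 4 = 1) {p : ℕ} (hp : p.Prime) :
    ∃ H : PowerSeries ℤ, (1 - C (kroneckerSymbol D₀ p) * X) * H = 1 - X ^ 2 ∧
      genusSeries D₀ (p ^ 2 * E) p = C (p : ℤ) * X ^ 2 * genusSeries D₀ E p + H := by
  have hg := hd.isGenusDiscriminant
  have hE' : (p ^ 2 * E) % 4 = 0 ∨ (p ^ 2 * E) % 4 = 1 := by
    rw [mul_comm]; exact mul_sq_mod_four hE p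
  have h0 := genusSum_one hg hE
  have h0' := genusSum_one hg hE'
  by_cases hpd : (p : ℤ) ∣ D₀
  · obtain ⟨P, ψ, e, hψ, rfl, he, he0, hpe⟩ := hd.exists_local_factor hp hpd
    have hκ := kroneckerSymbol_prime_sq hp hpe
    have key := fun {v : ℕ} (hv : v ≠ 0) => genusSum_prime_pow_of_dvd hψ hp he he0 hg hE hpe hv
    have key' := fun {v : ℕ} (hv : v ≠ 0) => genusSum_prime_pow_of_dvd hψ hp he he0 hg hE' hpe hv
    have heE := disc_mod_four he hE
    have heE' := disc_mod_four he hE'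
    have hr : P * e * (p ^ 2 * E) = P * (p ^ 2 * (e * E)) := by ring
    refine ⟨1 - X ^ 2, by rw [kroneckerSymbol_eq_zero_of_prime_dvd hp hpd]; simp, ?_⟩
    ext v
    simp only [map_add, map_sub, mul_assoc, coeff_C_mul, coeff_X_pow_mul', coeff_one, coeff_X_pow]
    rcases v with _ | _ | _ | v
    · simpa [genusSeries, mul_assoc] using h0'
    · have h1 := key' one_ne_zero
      have h2 : localSum ψ (P * (e * (p ^ 2 * E))) p = 0 := by
        rw [localSum_prime hψ hp heE']
        exact kroneckerSymbol_eq_zero_of_prime_dvd hp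
          (((dvd_pow_self (p : ℤ) two_ne_zero).mul_right E).mul_left e)
      rw [mul_assoc P e, pow_one, h2, mul_zero] at h1
      simpa [genusSeries, mul_assoc] using h1
    · have h1 := key' two_ne_zero
      rw [hκ, one_mul, hr, localSum_sq_mul_sq hψ hp heE] at h1
      simp only [genusSeries, coeff_mk, zero_add, Nat.reduceAdd]
      rw [hr, h1]
      simp [h0]
      ring
    · have h1 := key' (v := v + 3) (by omega)
      have h2 := key (v := v + 1) (by omega)
      rw [hr, localSum_sq_mul_of_pos hψ hp heE (v := v + 1) (by omega)] at h1
      simp only [genusSeries, coeff_mk]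
      rw [hr, h1, if_pos (by omega),
        show v + 1 + 1 + 1 - 2 = v + 1 by omega, h2, ← mul_assoc P e]
      simp only [Nat.add_eq_zero_iff, Nat.reduceEqDiff]
      simp
      linear_combination (p * kroneckerSymbol e p ^ (v + 1) *
        localSum ψ (P * e * E) (p ^ (v + 1))) * hκ
  · have key := genusSum_prime_pow_of_not_dvd hg hE hp hpd
    have key' := genusSum_prime_pow_of_not_dvd hg hE' hp hpd
    have hε := kroneckerSymbol_prime_sq hp hpd
    have hr : D₀ * (p ^ 2 * E) = p ^ 2 * (D₀ * E) := by ring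
    refine ⟨1 + C (kroneckerSymbol D₀ p) * X, ?_, ?_⟩
    · have h1 : (C (kroneckerSymbol D₀ p) : PowerSeries ℤ) ^ 2 = 1 := by
        rw [← map_pow, hε, map_one]
      linear_combination (-X ^ 2) * h1
    ext v
    simp only [map_add, mul_assoc, coeff_C_mul, coeff_X_pow_mul', coeff_one, coeff_X]
    rcases v with _ | _ | v
    · simpa [genusSeries] using h0'
    · have h1 := key' 1
      rw [pow_one, pow_one, localSum_one_prime (disc_mod_four hg hE') hp,
        kroneckerSymbol_eq_zero_of_prime_dvd hp
          (((dvd_pow_self (p : ℤ) two_ne_zero).mul_right E).mul_left D₀)] at h1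
      simpa [genusSeries] using h1
    · have h1 := key' (v + 2)
      have h2 := key v
      rw [hr, localSum_one_sq_mul _ hp] at h1
      simp only [genusSeries, coeff_mk]
      rw [hr, h1, if_pos (by omega), show v + 1 + 1 - 2 = v by omega, h2]
      simp
      linear_combination (p * kroneckerSymbol D₀ p ^ v *
        localSum (fun _ => 1) (D₀ * E) (p ^ v)) * hε

/-- With `ε = (D₀ / p)` and `η = (Dt / p)`, the series is `1 - X²` if `p` divides both
discriminants, `1 + ηX` if it divides only `D₀`, `1 + εX` if only `Dt`, and `(1 + ηX) / (1 - εX)` if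
neither. The uniform shape follows since `ε²` and `η²` are `1` when nonzero. -/
theorem genusSeries_base {D₀ Dt f : ℤ} (hd : IsFundamentalDiscriminant D₀)
    (ht : IsFundamentalDiscriminant Dt) {p : ℕ} (hp : p.Prime) (hf : ¬ (p : ℤ) ∣ f) :
    (1 - C (kroneckerSymbol D₀ p) * X) * (1 - C (kroneckerSymbol Dt p) * X) *
      genusSeries D₀ (Dt * f ^ 2) p = 1 - X ^ 2 := by
  have hpZ := Nat.prime_iff_prime_int.mp hp
  have hg := hd.isGenusDiscriminant
  have hE := mul_sq_mod_four ht.isGenusDiscriminant.mod_four f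
  have h0 := genusSum_one hg hE
  have hf2 : ¬ (p : ℤ) ∣ f ^ 2 := fun h => hf (hpZ.dvd_of_dvd_pow h)
  have hf4 : p = 2 → f ^ 2 % 4 = 1 := by
    rintro rfl
    have := sq_mod_four f
    push_cast at hf2
    omega
  by_cases hpd : (p : ℤ) ∣ D₀
  · obtain ⟨P, ψ, e, hψ, rfl, he, he0, hpe⟩ := hd.exists_local_factor hp hpd
    have hκ := kroneckerSymbol_prime_sq hp hpe
    have key := fun {v : ℕ} (hv : v ≠ 0) => genusSum_prime_pow_of_dvd hψ hp he he0 hg hE hpe hv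
    have heE := disc_mod_four he hE
    rw [kroneckerSymbol_eq_zero_of_prime_dvd hp hpd]
    have h1 : genusSum (P * e * (Dt * f ^ 2)) (P * e) p = kroneckerSymbol Dt p := by
      have := key one_ne_zero
      rw [pow_one, pow_one, mul_assoc P e, localSum_prime hψ hp heE,
        kroneckerSymbol_mul_left _ _ hp.ne_zero, kroneckerSymbol_mul_sq hp hf] at this
      rw [mul_assoc P e, this]
      linear_combination kroneckerSymbol Dt p * hκ
    by_cases hpt : (p : ℤ) ∣ Dt
    · rw [kroneckerSymbol_eq_zero_of_prime_dvd hp hpt] at h1 ⊢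
      have hram : IsRamifiedAt p (e * (Dt * f ^ 2)) := by
        rw [mul_left_comm]
        refine (ht.isRamifiedAt hp hpt).mul hp (fun h => ?_) fun h => ?_
        · exact (hpZ.dvd_or_dvd h).elim hpe hf2
        · subst h
          rw [Int.mul_emod, hf4 rfl, he.mod_four_of_odd (by exact_mod_cast hpe)]
          rfl
      have h2 := localSum_ramified hψ hp heE hram
      rw [← mul_assoc P e] at h2
      suffices genusSeries (P * e) (Dt * f ^ 2) p = 1 - X ^ 2 by rw [this]; simp
      ext v
      simp only [genusSeries, coeff_mk, map_sub, coeff_one, coeff_X_pow]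
      rcases v with _ | _ | _ | v
      · simpa using h0
      · simpa using h1
      · rw [key (by omega), h2.1]
        simp [hκ]
      · rw [key (by omega), h2.2 v]
        simp
    · have h2 := fun v => localSum_prime_pow_eq_zero hψ hp heE (fun h => by
        rcases hpZ.dvd_or_dvd h with h | h
        · exact hpe h
        · exact (hpZ.dvd_or_dvd h).elim hpt hf2) v
      rw [← mul_assoc P e] at h2
      have hη := kroneckerSymbol_prime_sq hp hpt
      suffices genusSeries (P * e) (Dt * f ^ 2) p = 1 + C (kroneckerSymbol Dt p) * X by
        have h3 : (C (kroneckerSymbol Dt p) : PowerSeries ℤ) ^ 2 = 1 := by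
          rw [← map_pow, hη, map_one]
        rw [this, map_zero]
        linear_combination (-X ^ 2) * h3
      ext v
      simp only [genusSeries, coeff_mk, map_add, coeff_one, coeff_C_mul, coeff_X]
      rcases v with _ | _ | v
      · simpa using h0
      · simpa using h1
      · rw [key (by omega), h2 v]
        simp
  · have key := genusSum_prime_pow_of_not_dvd hg hE hp hpd
    have hε := kroneckerSymbol_prime_sq hp hpd
    have hε' : (C (kroneckerSymbol D₀ p) : PowerSeries ℤ) ^ 2 = 1 := by
      rw [← map_pow, hε, map_one]
    by_cases hpt : (p : ℤ) ∣ Dt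
    · have hram : IsRamifiedAt p (D₀ * (Dt * f ^ 2)) := by
        rw [mul_left_comm]
        refine (ht.isRamifiedAt hp hpt).mul hp (fun h => ?_) fun h => ?_
        · exact (hpZ.dvd_or_dvd h).elim hpd hf2
        · subst h
          rw [Int.mul_emod, hf4 rfl, hg.mod_four_of_odd (by exact_mod_cast hpd)]
          rfl
      have h2 := localSum_eq_zero_of_forall_not_dvd (fun _ => 1) (hram.not_dvd hp)
      have h1 := key 1
      rw [pow_one, pow_one, localSum_one_prime (disc_mod_four hg hE) hp,
        kroneckerSymbol_eq_zero_of_prime_dvd hp ((hpt.mul_right _).mul_left _)] at h1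
      rw [kroneckerSymbol_eq_zero_of_prime_dvd hp hpt]
      suffices genusSeries D₀ (Dt * f ^ 2) p = 1 + C (kroneckerSymbol D₀ p) * X by
        rw [this, map_zero]
        linear_combination (-X ^ 2) * hε'
      ext v
      simp only [genusSeries, coeff_mk, map_add, coeff_one, coeff_C_mul, coeff_X]
      rcases v with _ | _ | v
      · simpa using h0
      · simpa using h1
      · rw [key, h2 v]
        simp
    · have h2 := localSum_one_prime_pow (disc_mod_four hg hE) hp (fun h => by
        rcases hpZ.dvd_or_dvd h with h | h
        · exact hpd h
        · exact (hpZ.dvd_or_dvd h).elim hpt hf2)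
      rw [kroneckerSymbol_mul_left _ _ hp.ne_zero, kroneckerSymbol_mul_sq hp hf] at h2
      have hη := kroneckerSymbol_prime_sq hp hpt
      have hη' : (C (kroneckerSymbol Dt p) : PowerSeries ℤ) ^ 2 = 1 := by
        rw [← map_pow, hη, map_one]
      have h3 : (1 - C (kroneckerSymbol D₀ p) * X) * genusSeries D₀ (Dt * f ^ 2) p =
          1 + C (kroneckerSymbol Dt p) * X := by
        rw [sub_mul, one_mul, mul_assoc]
        ext v
        rw [map_sub, coeff_C_mul, map_add, coeff_C_mul]
        rcases v with _ | _ | v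
        · simpa [genusSeries] using h0
        · rw [zero_add, show (1 : ℕ) = 0 + 1 from rfl, coeff_succ_X_mul]
          simp only [genusSeries, coeff_mk, pow_zero, h0]
          rw [key, h2]
          simp [coeff_one]
          linear_combination (kroneckerSymbol Dt p) * hε
        · rw [coeff_succ_X_mul]
          simp only [genusSeries, coeff_mk]
          rw [key, key, h2, h2]
          simp [coeff_one, coeff_X]
          ring
      rw [mul_right_comm, h3]
      linear_combination (-X ^ 2) * hη'

theorem genusSeries_eq {D₀ Dt f : ℤ} (hd : IsFundamentalDiscriminant D₀)
    (ht : IsFundamentalDiscriminant Dt) {p : ℕ} (hp : p.Prime) (hf : ¬ (p : ℤ) ∣ f) (m : ℕ) :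
    (1 - C (kroneckerSymbol D₀ p) * X) * (1 - C (kroneckerSymbol Dt p) * X) *
      genusSeries D₀ (Dt * (p ^ m * f) ^ 2) p =
        (1 - X ^ 2) * conductorSeries p (kroneckerSymbol Dt p) m := by
  induction m with
  | zero => rw [pow_zero, one_mul, conductorSeries_zero, mul_one, genusSeries_base hd ht hp hf]
  | succ m ih =>
    obtain ⟨H, hH, h⟩ := genusSeries_sq_mul hd
      (mul_sq_mod_four ht.isGenusDiscriminant.mod_four ((p : ℤ) ^ m * f)) hp
    rw [show Dt * ((p : ℤ) ^ (m + 1) * f) ^ 2 = p ^ 2 * (Dt * (p ^ m * f) ^ 2) by ring, h,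
      conductorSeries_succ]
    linear_combination (C (p : ℤ) * X ^ 2) * ih + (1 - C (kroneckerSymbol Dt p) * X) * hH

end GeneratingSeries

/-! ### The convolution identity for the genus sums. -/

section ArithmeticFunctions

open ArithmeticFunction

theorem squarefree_mul_sq_unique {d d' r r' : ℕ} (hd : Squarefree d) (hd' : Squarefree d')
    (hr : r ≠ 0) (h : d * r ^ 2 = d' * r' ^ 2) : d = d' ∧ r = r' := by
  obtain ⟨g, x, y, hg, hxy, hrx, hry⟩ := Nat.exists_coprime' (Nat.gcd_pos_of_pos_left r'
    (Nat.pos_of_ne_zero hr))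
  subst hrx hry
  have h1 : d * x ^ 2 = d' * y ^ 2 := by
    apply Nat.eq_of_mul_eq_mul_right (Nat.pow_pos (n := 2) hg)
    linarith
  have hc : (x ^ 2).Coprime (y ^ 2) := Nat.Coprime.pow 2 2 hxy
  have hx : x = 1 := by
    have : x ^ 2 ∣ d' := hc.dvd_of_dvd_mul_right (h1 ▸ Dvd.intro_left _ rfl)
    exact Nat.isUnit_iff.mp (hd' x (by rwa [← pow_two]))
  have hy : y = 1 := by
    have : y ^ 2 ∣ d := hc.symm.dvd_of_dvd_mul_right (h1 ▸ Dvd.intro_left _ rfl)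
    exact Nat.isUnit_iff.mp (hd y (by rwa [← pow_two]))
  subst hx hy
  exact ⟨by simpa using h1, rfl⟩

/-- Every positive integer is `d r²` with `d` square-free, and coprime products respect this
decomposition. -/
theorem isMultiplicative_of_squarefree_mul_sq {F : ArithmeticFunction ℤ} (φ : ℕ → ℕ → ℤ)
    (hF : ∀ d r, Squarefree d → r ≠ 0 → F (d * r ^ 2) = φ d r) (h1 : φ 1 1 = 1)
    (hφ : ∀ d r d' r', d ≠ 0 → d' ≠ 0 → r ≠ 0 → r' ≠ 0 → (d * r).Coprime (d' * r') →
      φ (d * d') (r * r') = φ d r * φ d' r') : F.IsMultiplicative := by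
  rw [IsMultiplicative.iff_ne_zero]
  constructor
  · have := hF 1 1 squarefree_one one_ne_zero
    rwa [one_pow, mul_one, h1] at this
  · intro m n hm hn hmn
    obtain ⟨d, r, hd0, hr0, rfl, hd⟩ := Nat.sq_mul_squarefree_of_pos (Nat.pos_of_ne_zero hm)
    obtain ⟨d', r', hd0', hr0', rfl, hd'⟩ := Nat.sq_mul_squarefree_of_pos (Nat.pos_of_ne_zero hn)
    have hc1 : (d * r).Coprime (d' * r') := by
      refine Nat.Coprime.of_dvd ?_ ?_ hmn
      · exact ⟨r, by ring⟩
      · exact ⟨r', by ring⟩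
    have hdd : Squarefree (d * d') :=
      (Nat.squarefree_mul (hc1.of_dvd (Dvd.intro _ rfl) (Dvd.intro _ rfl))).mpr ⟨hd, hd'⟩
    rw [show r ^ 2 * d * (r' ^ 2 * d') = d * d' * (r * r') ^ 2 by ring,
      mul_comm (r ^ 2) d, mul_comm (r' ^ 2) d', hF _ _ hdd (mul_ne_zero hr0.ne' hr0'.ne'),
      hF _ _ hd hr0.ne', hF _ _ hd' hr0'.ne']
    exact hφ d r d' r' hd0.ne' hd0'.ne' hr0.ne' hr0'.ne' hc1

/-- The Kronecker symbol of `d` as an arithmetic function. -/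
def kroneckerArith (d : ℤ) : ArithmeticFunction ℤ :=
  ⟨fun n => if n = 0 then 0 else kroneckerSymbol d n, by simp⟩

theorem kroneckerArith_apply (d : ℤ) {n : ℕ} (hn : n ≠ 0) :
    kroneckerArith d n = kroneckerSymbol d n := by
  simp [kroneckerArith, hn]

theorem isMultiplicative_kroneckerArith (d : ℤ) : (kroneckerArith d).IsMultiplicative := by
  rw [IsMultiplicative.iff_ne_zero]
  refine ⟨by rw [kroneckerArith_apply _ one_ne_zero, kroneckerSymbol_one_right], ?_⟩
  intro m n hm hn _
  rw [kroneckerArith_apply _ (mul_ne_zero hm hn), kroneckerArith_apply _ hm,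
    kroneckerArith_apply _ hn, kroneckerSymbol_mul_right _ hm hn]

/-- The genus sums as an arithmetic function. -/
noncomputable def genusArith (D₀ E : ℤ) : ArithmeticFunction ℤ :=
  ⟨genusSum (D₀ * E) D₀, by simp [genusSum]⟩

theorem genusArith_apply (D₀ E : ℤ) (n : ℕ) : genusArith D₀ E n = genusSum (D₀ * E) D₀ n := rfl

theorem isMultiplicative_genusArith {D₀ E : ℤ} (hd : IsFundamentalDiscriminant D₀)
    (hE : E % 4 = 0 ∨ E % 4 = 1) : (genusArith D₀ E).IsMultiplicative := by
  rw [IsMultiplicative.iff_ne_zero]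
  exact ⟨genusSum_one hd.isGenusDiscriminant hE, fun hm hn hmn =>
    genusSum_mul_of_coprime hd.isGenusDiscriminant hd.ne_zero hE hm hn hmn⟩

/-- The function `m ^ 2 ↦ μ m`, zero at nonsquares. -/
def moebiusSq : ArithmeticFunction ℤ :=
  ⟨fun n => if IsSquare n then moebius n.sqrt else 0, by simp⟩

theorem moebiusSq_sq (m : ℕ) : moebiusSq (m ^ 2) = moebius m := by
  change (if IsSquare (m ^ 2) then moebius (m ^ 2).sqrt else 0) = _
  rw [if_pos (IsSquare.sq m), Nat.sqrt_eq']

theorem moebiusSq_squarefree_mul_sq {d r : ℕ} (hd : Squarefree d) (hr : r ≠ 0) :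
    moebiusSq (d * r ^ 2) = if d = 1 then moebius r else 0 := by
  split_ifs with h
  · rw [h, one_mul, moebiusSq_sq]
  · refine if_neg fun ⟨s, hs⟩ => h ?_
    exact (squarefree_mul_sq_unique hd squarefree_one hr (r' := s) (by rw [hs]; ring)).1

theorem isMultiplicative_moebiusSq : moebiusSq.IsMultiplicative := by
  refine isMultiplicative_of_squarefree_mul_sq (fun d r => if d = 1 then moebius r else 0)
    (fun d r hd hr => moebiusSq_squarefree_mul_sq hd hr) (by simp) ?_
  intro d r d' r' _ _ _ _ hc
  simp only [mul_eq_one]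
  rw [isMultiplicative_moebius.map_mul_of_coprime
    (hc.of_dvd (Dvd.intro_left _ rfl) (Dvd.intro_left _ rfl))]
  split_ifs <;> simp_all

/-- The coefficients of the finite Dirichlet series attached to a conductor `f`. -/
def conductorArith (χ : ℕ → ℤ) (f : ℕ) : ArithmeticFunction ℤ :=
  ⟨fun n => ∑ x ∈ f.divisors.sigma fun d => (f / d).divisors,
    if x.1 * x.2 ^ 2 = n then moebius x.1 * χ x.1 * x.2 else 0, by
    refine Finset.sum_eq_zero fun x hx => if_neg ?_
    simp only [Finset.mem_sigma] at hx
    exact mul_ne_zero (Nat.pos_of_mem_divisors hx.1).ne'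
      (pow_ne_zero _ (Nat.pos_of_mem_divisors hx.2).ne')⟩

theorem conductorArith_apply (χ : ℕ → ℤ) (f n : ℕ) :
    conductorArith χ f n = ∑ x ∈ f.divisors.sigma fun d => (f / d).divisors,
      if x.1 * x.2 ^ 2 = n then moebius x.1 * χ x.1 * x.2 else 0 := rfl

/-- Pairs with a non-square-free first entry are killed by `μ`; uniqueness of the decomposition
leaves at most one other pair. -/
theorem conductorArith_squarefree_mul_sq (χ : ℕ → ℤ) {f : ℕ} (hf : f ≠ 0) {d r : ℕ}
    (hd : Squarefree d) (hr : r ≠ 0) :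
    conductorArith χ f (d * r ^ 2) = if d * r ∣ f then moebius d * χ d * r else 0 := by
  have hmem : (⟨d, r⟩ : (_ : ℕ) × ℕ) ∈ (f.divisors.sigma fun d => (f / d).divisors) ↔
      d * r ∣ f := by
    simp only [Finset.mem_sigma, Nat.mem_divisors]
    constructor
    · rintro ⟨⟨⟨e, rfl⟩, -⟩, h, -⟩
      rw [Nat.mul_div_cancel_left _ hd.ne_zero.bot_lt] at h
      exact Nat.mul_dvd_mul_left d h
    · rintro ⟨e, rfl⟩
      rw [mul_assoc, Nat.mul_div_cancel_left _ hd.ne_zero.bot_lt]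
      rw [mul_assoc] at hf
      exact ⟨⟨Dvd.intro _ rfl, hf⟩, Dvd.intro _ rfl, right_ne_zero_of_mul hf⟩
  have hother : ∀ x ∈ (f.divisors.sigma fun d => (f / d).divisors),
      x ≠ (⟨d, r⟩ : (_ : ℕ) × ℕ) →
      (if x.1 * x.2 ^ 2 = d * r ^ 2 then moebius x.1 * χ x.1 * (x.2 : ℤ) else 0) = 0 := by
    rintro ⟨d', r'⟩ _ hne
    refine ite_eq_right_iff.mpr fun h => ?_
    have hd' : ¬ Squarefree d' := fun hd' => hne (by
      obtain ⟨rfl, rfl⟩ := squarefree_mul_sq_unique hd hd' hr h.symm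
      rfl)
    rw [moebius_eq_zero_of_not_squarefree hd', zero_mul, zero_mul]
  rw [conductorArith_apply]
  split_ifs with h
  · rw [Finset.sum_eq_single_of_mem _ (hmem.mpr h) hother, if_pos rfl]
  · exact Finset.sum_eq_zero fun x hx => hother x hx fun hx' => h (hmem.mp (hx' ▸ hx))

theorem isMultiplicative_conductorArith {χ : ℕ → ℤ} (hχ1 : χ 1 = 1)
    (hχ : ∀ m n : ℕ, m ≠ 0 → n ≠ 0 → χ (m * n) = χ m * χ n) {f : ℕ} (hf : f ≠ 0) :
    (conductorArith χ f).IsMultiplicative := by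
  refine isMultiplicative_of_squarefree_mul_sq
    (fun d r => if d * r ∣ f then moebius d * χ d * r else 0)
    (fun d r hd hr => conductorArith_squarefree_mul_sq χ hf hd hr) (by simp [hχ1]) ?_
  intro d r d' r' hd hd' _ _ hc
  have hiff : d * d' * (r * r') ∣ f ↔ d * r ∣ f ∧ d' * r' ∣ f := by
    rw [show d * d' * (r * r') = d * r * (d' * r') by ring]
    exact ⟨fun h => ⟨(Dvd.intro _ rfl).trans h, (Dvd.intro_left _ rfl).trans h⟩,
      fun h => hc.mul_dvd_of_dvd_of_dvd h.1 h.2⟩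
  simp only [hiff]
  rw [isMultiplicative_moebius.map_mul_of_coprime
    (hc.of_dvd (Dvd.intro _ rfl) (Dvd.intro _ rfl)), hχ d d' hd hd']
  split_ifs <;> simp_all
  ring

/-- The generating series of the values of an arithmetic function at the powers of `p`. -/
noncomputable def bellSeries (p : ℕ) (f : ArithmeticFunction ℤ) : PowerSeries ℤ :=
  PowerSeries.mk fun v => f (p ^ v)

theorem bellSeries_mul {p : ℕ} (hp : p.Prime) (f g : ArithmeticFunction ℤ) :
    bellSeries p (f * g) = bellSeries p f * bellSeries p g := by
  ext v
  rw [PowerSeries.coeff_mul, Finset.Nat.sum_antidiagonal_eq_sum_range_succ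
    (fun i j => PowerSeries.coeff i (bellSeries p f) * PowerSeries.coeff j (bellSeries p g))]
  simp only [bellSeries, PowerSeries.coeff_mk]
  rw [mul_apply, Nat.sum_divisorsAntidiagonal (fun i j => f i * g j),
    Nat.sum_divisors_prime_pow hp]
  refine Finset.sum_congr rfl fun i hi => ?_
  rw [Nat.pow_div (Nat.lt_succ_iff.mp (Finset.mem_range.mp hi)) hp.pos]

open PowerSeries in
theorem bellSeries_kroneckerArith {p : ℕ} (hp : p.Prime) (d : ℤ) :
    (1 - C (kroneckerSymbol d p) * X) * bellSeries p (kroneckerArith d) = 1 := by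
  have key : ∀ v : ℕ, kroneckerArith d (p ^ v) = kroneckerSymbol d p ^ v := fun v => by
    rw [kroneckerArith_apply _ (pow_ne_zero _ hp.ne_zero), kroneckerSymbol_pow_right _ hp.ne_zero]
  rw [sub_mul, one_mul, mul_assoc]
  ext v
  rw [map_sub, coeff_C_mul]
  rcases v with _ | v
  · simp [bellSeries, key]
  · rw [coeff_succ_X_mul]
    simp only [bellSeries, coeff_mk, key, coeff_one]
    simp [pow_succ']

open PowerSeries in
theorem bellSeries_moebiusSq {p : ℕ} (hp : p.Prime) : bellSeries p moebiusSq = 1 - X ^ 2 := by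
  ext v
  simp only [bellSeries, coeff_mk, map_sub, coeff_one, coeff_X_pow]
  rcases Nat.even_or_odd' v with ⟨j, rfl | rfl⟩
  · rw [mul_comm 2 j, pow_mul, moebiusSq_sq]
    rcases Nat.eq_zero_or_pos j with rfl | hj
    · simp
    · rw [moebius_apply_prime_pow hp hj.ne', if_neg (by omega : ¬ j * 2 = 0)]
      split_ifs <;> omega
  · have h := moebiusSq_squarefree_mul_sq (r := p ^ j) hp.prime.squarefree
      (pow_ne_zero _ hp.ne_zero)
    rw [if_neg hp.one_lt.ne', show p * (p ^ j) ^ 2 = p ^ (2 * j + 1) by ring] at h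
    rw [h, if_neg (by omega), if_neg (by omega), sub_zero]

theorem bellSeries_conductorArith {p : ℕ} (hp : p.Prime) {χ : ℕ → ℤ} (hχ1 : χ 1 = 1) {f : ℕ}
    (hf : f ≠ 0) :
    bellSeries p (conductorArith χ f) = conductorSeries p (χ p) (f.factorization p) := by
  ext v
  simp only [bellSeries, conductorSeries, PowerSeries.coeff_mk]
  rcases Nat.even_or_odd' v with ⟨j, rfl | rfl⟩
  · have h := conductorArith_squarefree_mul_sq χ hf (r := p ^ j) squarefree_one
      (pow_ne_zero _ hp.ne_zero)
    rw [show 1 * (p ^ j) ^ 2 = p ^ (2 * j) by ring, one_mul] at h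
    simp only [hp.pow_dvd_iff_le_factorization hf] at h
    rw [h, if_pos (by omega : 2 * j % 2 = 0), show 2 * j / 2 = j by omega]
    simp [hχ1]
  · have h := conductorArith_squarefree_mul_sq χ hf (r := p ^ j) hp.prime.squarefree
      (pow_ne_zero _ hp.ne_zero)
    rw [show p * (p ^ j) ^ 2 = p ^ (2 * j + 1) by ring, ← pow_succ',
      moebius_apply_prime hp] at h
    simp only [hp.pow_dvd_iff_le_factorization hf] at h
    rw [h, if_neg (by omega : ¬ (2 * j + 1) % 2 = 0), show (2 * j + 1) / 2 = j by omega]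
    simp

/-- Both sides are multiplicative, so it suffices to compare Bell series; there `genusSeries_eq` is
the claim, the linear factors being inverted by the Bell series of the two Kronecker symbols. -/
theorem genusArith_eq {D₀ Dt : ℤ} (hd : IsFundamentalDiscriminant D₀)
    (ht : IsFundamentalDiscriminant Dt) {f : ℕ} (hf : f ≠ 0) :
    genusArith D₀ (Dt * f ^ 2) = kroneckerArith D₀ * kroneckerArith Dt *
      conductorArith (kroneckerSymbol Dt) f * moebiusSq := by
  have hE := mul_sq_mod_four ht.isGenusDiscriminant.mod_four (f : ℤ)
  have h1 := kroneckerSymbol_one_right Dt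
  refine (IsMultiplicative.eq_iff_eq_on_prime_powers _ (isMultiplicative_genusArith hd hE) _
    ((((isMultiplicative_kroneckerArith D₀).mul (isMultiplicative_kroneckerArith Dt)).mul
      (isMultiplicative_conductorArith h1 (fun m n hm hn => kroneckerSymbol_mul_right Dt hm hn)
        hf)).mul isMultiplicative_moebiusSq)).mpr fun p i hp => ?_
  suffices h : bellSeries p (genusArith D₀ (Dt * f ^ 2)) = bellSeries p (kroneckerArith D₀ *
      kroneckerArith Dt * conductorArith (kroneckerSymbol Dt) f * moebiusSq) by
    simpa [bellSeries] using congrArg (PowerSeries.coeff i) h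
  rw [bellSeries_mul hp, bellSeries_mul hp, bellSeries_mul hp, bellSeries_moebiusSq hp,
    bellSeries_conductorArith hp h1 hf]
  have hA := bellSeries_kroneckerArith hp D₀
  have hB := bellSeries_kroneckerArith hp Dt
  obtain ⟨m, f', hf', rfl⟩ := Nat.exists_eq_pow_mul_and_not_dvd hf p hp.ne_one
  have hf0 : f' ≠ 0 := right_ne_zero_of_mul hf
  have hG := genusSeries_eq hd ht hp (f := (f' : ℤ)) (by exact_mod_cast hf') m
  have hfac : (p ^ m * f').factorization p = m := by
    rw [Nat.factorization_mul (pow_ne_zero _ hp.ne_zero) hf0, Finsupp.add_apply,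
      hp.factorization_pow, Finsupp.single_eq_same, Nat.factorization_eq_zero_of_not_dvd hf',
      add_zero]
  rw [hfac]
  push_cast
  change genusSeries D₀ (Dt * (p ^ m * f') ^ 2) p = _
  set A := bellSeries p (kroneckerArith D₀)
  set B := bellSeries p (kroneckerArith Dt)
  set G := genusSeries D₀ (Dt * (p ^ m * f') ^ 2) p
  set a := 1 - PowerSeries.C (kroneckerSymbol D₀ p) * (PowerSeries.X : PowerSeries ℤ)
  set b := 1 - PowerSeries.C (kroneckerSymbol Dt p) * (PowerSeries.X : PowerSeries ℤ)
  linear_combination (A * B) * hG - (b * B * G) * hA - G * hB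

end ArithmeticFunctions

/-! ### Explicit form of the generalized Hurwitz class numbers. -/

theorem IsFundamentalDiscriminant.exists_squarefree_part {d : ℤ}
    (h : IsFundamentalDiscriminant d) : ∃ (s : ℤ) (c : ℕ), d = s * c ^ 2 ∧ Squarefree s ∧
      ((c = 1 ∧ s % 4 = 1) ∨ (c = 2 ∧ (s % 4 = 2 ∨ s % 4 = 3))) := by
  rcases h with ⟨h1, h2⟩ | ⟨m, rfl, h1, h2⟩
  · exact ⟨d, 1, by simp, h2, Or.inl ⟨rfl, h1⟩⟩
  · exact ⟨m, 2, by push_cast; ring, h2, Or.inr ⟨rfl, h1⟩⟩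

/-- Write `t = s c²` with `s` square-free and `c ∈ {1, 2}`. The common value determines `s` and `c
m`, and `s` modulo `4` determines `c`. -/
theorem IsFundamentalDiscriminant.unique {t t' : ℤ} {m m' : ℕ} (ht : IsFundamentalDiscriminant t)
    (ht' : IsFundamentalDiscriminant t') (hm : m ≠ 0) (h : t * (m : ℤ) ^ 2 = t' * (m' : ℤ) ^ 2) :
    t = t' ∧ m = m' := by
  obtain ⟨s, c, rfl, hs, hc⟩ := ht.exists_squarefree_part
  obtain ⟨s', c', rfl, hs', hc'⟩ := ht'.exists_squarefree_part
  have hc0 : c ≠ 0 := by rintro rfl; simp at hc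
  have h1 : s * ((c * m : ℕ) : ℤ) ^ 2 = s' * ((c' * m' : ℕ) : ℤ) ^ 2 := by
    push_cast; linear_combination h
  have h2 : s.natAbs * (c * m) ^ 2 = s'.natAbs * (c' * m') ^ 2 := by
    have := congrArg Int.natAbs h1
    simpa [Int.natAbs_mul, Int.natAbs_pow] using this
  have h3 := (squarefree_mul_sq_unique (Int.squarefree_natAbs.mpr hs)
    (Int.squarefree_natAbs.mpr hs') (mul_ne_zero hc0 hm) h2).2
  rw [← h3] at h1
  have h4 : s = s' := mul_right_cancel₀
    (pow_ne_zero 2 (by exact_mod_cast mul_ne_zero hc0 hm)) h1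
  subst h4
  obtain rfl : c = c' := by omega
  exact ⟨rfl, Nat.eq_of_mul_eq_mul_left (Nat.pos_of_ne_zero hc0) h3⟩

theorem negOnePow_one_sub {k : ℕ} (hk : 1 ≤ k) :
    (((1 - (k : ℤ)).negOnePow : ℤˣ) : ℤ) * (-1) ^ (k - 1) = 1 := by
  obtain ⟨j, rfl⟩ := Nat.exists_eq_add_of_le hk
  rw [show 1 - ((1 + j : ℕ) : ℤ) = -(j : ℤ) by push_cast; ring, Int.negOnePow_neg,
    Int.negOnePow_def, zpow_natCast, Nat.add_sub_cancel_left]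
  push_cast
  rw [← mul_pow]
  simp

theorem hurwitzClassNumber_eq {k : ℕ} (hk : 1 ≤ k) (ℓ : ℕ) {t : ℤ}
    (ht : IsFundamentalDiscriminant t) {m : ℕ} (hm : m ≠ 0) :
    hurwitzClassNumber (1 - (k : ℤ)) ℓ ((-1) ^ (k - 1) * (t * (m : ℤ) ^ 2)) =
      incompleteL ℓ (fun j => (kroneckerSymbol t j : ℂ)) k *
      ∑ a ∈ m.divisors.filter (fun a => a.Coprime ℓ),
        (ArithmeticFunction.moebius a : ℂ) * (kroneckerSymbol t a : ℂ) *
          (a : ℂ) ^ (-(k : ℤ)) * coprimeSigma ℓ (1 - 2 * (k : ℤ)) (m / a) := by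
  have hn : (-1) ^ (k - 1) * (t * (m : ℤ) ^ 2) ≠ 0 := by
    refine mul_ne_zero (pow_ne_zero _ (by norm_num)) (mul_ne_zero ht.ne_zero ?_)
    exact pow_ne_zero _ (by exact_mod_cast hm)
  have hval : (((1 - (k : ℤ)).negOnePow : ℤˣ) : ℤ) * ((-1) ^ (k - 1) * (t * (m : ℤ) ^ 2)) =
      t * (m : ℤ) ^ 2 := by rw [← mul_assoc, negOnePow_one_sub hk, one_mul]
  have h : ∃ q : ℤ × ℕ, IsFundamentalDiscriminant q.1 ∧ 0 < q.2 ∧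
      (((1 - (k : ℤ)).negOnePow : ℤˣ) : ℤ) * ((-1) ^ (k - 1) * (t * (m : ℤ) ^ 2)) =
        q.1 * (q.2 : ℤ) ^ 2 := ⟨(t, m), ht, Nat.pos_of_ne_zero hm, hval⟩
  have hq : h.choose = (t, m) := by
    obtain ⟨h1, -, h3⟩ := h.choose_spec
    obtain ⟨h4, h5⟩ := ht.unique h1 hm (hval.symm.trans h3)
    exact Prod.ext h4.symm h5.symm
  rw [hurwitzClassNumber, if_neg hn, dif_pos h, hq]
  simp only
  rw [show (1 : ℤ) - (k : ℤ) - 1 = -(k : ℤ) by ring,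
    show 2 * (1 - (k : ℤ)) - 1 = 1 - 2 * (k : ℤ) by ring]
  push_cast
  rw [sub_sub_cancel]

/-- The sum factors as `∏_{p ∣ N} (1 - [p ∤ a])`. -/
theorem sum_moebius_coprime {N : ℕ} (hN : Squarefree N) (a : ℕ) :
    ∑ ℓ ∈ N.divisors, (ArithmeticFunction.moebius ℓ : ℂ) * (if a.Coprime ℓ then 1 else 0) =
      if N ∣ a then 1 else 0 := by
  classical
  let f : ArithmeticFunction ℂ :=
    ⟨fun d => if d = 0 then 0 else if a.Coprime d then 1 else 0, by simp⟩
  have hf : ∀ d, d ≠ 0 → f d = if a.Coprime d then 1 else 0 := fun d hd => if_neg hd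
  have hmult : f.IsMultiplicative := by
    rw [ArithmeticFunction.IsMultiplicative.iff_ne_zero]
    refine ⟨by rw [hf 1 one_ne_zero]; simp, ?_⟩
    intro m n hm hn _
    rw [hf _ (mul_ne_zero hm hn), hf _ hm, hf _ hn]
    simp only [Nat.coprime_mul_iff_right]
    split_ifs <;> simp_all
  have h := hmult.prodPrimeFactors_one_sub_of_squarefree f hN
  have h1 : ∑ ℓ ∈ N.divisors, (ArithmeticFunction.moebius ℓ : ℂ) * (if a.Coprime ℓ then 1 else 0) =
      ∑ ℓ ∈ N.divisors, (ArithmeticFunction.moebius ℓ : ℂ) * f ℓ :=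
    Finset.sum_congr rfl fun ℓ hℓ => by rw [hf ℓ (Nat.pos_of_mem_divisors hℓ).ne']
  rw [h1, ← h]
  have h2 : ∀ p ∈ N.primeFactors, 1 - f p = if p ∣ a then 1 else 0 := fun p hp => by
    have hpp := Nat.prime_of_mem_primeFactors hp
    have hiff : a.Coprime p ↔ ¬ p ∣ a := by rw [Nat.coprime_comm, hpp.coprime_iff_not_dvd]
    rw [hf p hpp.ne_zero]
    simp only [hiff]
    split_ifs <;> simp_all
  rw [Finset.prod_congr rfl h2]
  split_ifs with hNa
  · exact Finset.prod_eq_one fun p hp => if_pos ((Nat.dvd_of_mem_primeFactors hp).trans hNa)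
  · have : ∃ p ∈ N.primeFactors, ¬ p ∣ a := by
      by_contra! hall
      apply hNa
      rw [← Nat.prod_primeFactors_of_squarefree hN]
      exact Finset.prod_primes_dvd a
        (fun p hp => (Nat.prime_of_mem_primeFactors hp).prime) hall
    obtain ⟨p, hp, hpa⟩ := this
    exact Finset.prod_eq_zero hp (if_neg hpa)

/-! ### Passage to Dirichlet series. -/

section LSeriesIdentities

open LSeries

theorem convolution_intCast (f g : ArithmeticFunction ℤ) :
    (fun n => ((f * g) n : ℂ)) = convolution (fun n => (f n : ℂ)) (fun n => (g n : ℂ)) := by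
  rw [convolution_def]
  ext n
  rw [ArithmeticFunction.mul_apply]
  push_cast
  rfl

/-- The principal character modulo `ℓ` as a function on `ℕ`. -/
noncomputable def principalChar (ℓ : ℕ) : ℕ → ℂ := fun n => (1 : DirichletCharacter ℂ ℓ) n

theorem principalChar_apply (ℓ n : ℕ) : principalChar ℓ n = if n.Coprime ℓ then 1 else 0 := by
  rw [principalChar]
  split_ifs with h
  · exact MulChar.one_apply ((ZMod.isUnit_iff_coprime n ℓ).mpr h)
  · exact MulChar.map_nonunit _ fun h' => h ((ZMod.isUnit_iff_coprime n ℓ).mp h')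

theorem principalChar_mul_convolution_intCast (ℓ : ℕ) (f g : ArithmeticFunction ℤ) :
    principalChar ℓ * (fun n => ((f * g) n : ℂ)) =
      convolution (principalChar ℓ * fun n => (f n : ℂ))
        (principalChar ℓ * fun n => (g n : ℂ)) := by
  rw [convolution_intCast]
  exact (DirichletCharacter.mul_convolution_distrib _ _ _).symm

theorem lseriesSummable_kroneckerArith (d : ℤ) (ℓ : ℕ) {s : ℂ} (hs : 1 < s.re) :
    LSeriesSummable (principalChar ℓ * fun n => (kroneckerArith d n : ℂ)) s := by
  refine DirichletCharacter.LSeriesSummable_mul _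
    (LSeriesSummable_of_bounded_of_one_lt_re (m := 1) (fun n hn => ?_) hs)
  rw [kroneckerArith_apply d hn, Complex.norm_intCast]
  exact_mod_cast abs_kroneckerSymbol_le_one d n

theorem lseries_kroneckerArith (d : ℤ) (ℓ : ℕ) (s : ℂ) :
    LSeries (principalChar ℓ * fun n => (kroneckerArith d n : ℂ)) s =
      incompleteL ℓ (fun j => (kroneckerSymbol d j : ℂ)) s := by
  refine LSeries_congr (fun {n} hn => ?_) s
  rw [Pi.mul_apply, principalChar_apply, kroneckerArith_apply d hn]
  split_ifs <;> simp

theorem term_natCast (f : ℕ → ℂ) (k n : ℕ) (hf : f 0 = 0) :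
    LSeries.term f k n = f n / (n : ℂ) ^ k := by
  rcases eq_or_ne n 0 with rfl | hn
  · simp [hf]
  · rw [LSeries.term_of_ne_zero hn, Complex.cpow_natCast]

/-- Reindexing by `m ↦ m²` turns exponent `k` into `2k`, and `m²` is prime to `ℓ` exactly when `m`
is. -/
theorem lseriesHasSum_moebiusSq (ℓ : ℕ) {k : ℕ} (hk : 1 < k) :
    LSeriesHasSum (principalChar ℓ * fun n => (moebiusSq n : ℂ)) k
      (LSeries (principalChar ℓ * fun n => (ArithmeticFunction.moebius n : ℂ)) (2 * k : ℕ)) := by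
  have hs : 1 < ((2 * k : ℕ) : ℂ).re := by
    rw [Complex.natCast_re]; exact_mod_cast (by omega : 1 < 2 * k)
  have hsum : LSeriesSummable (principalChar ℓ * fun n => (ArithmeticFunction.moebius n : ℂ))
      (2 * k : ℕ) :=
    DirichletCharacter.LSeriesSummable_mul _
      (ArithmeticFunction.LSeriesSummable_moebius_iff.mpr hs)
  have h := hsum.LSeriesHasSum
  rw [LSeriesHasSum] at h ⊢
  have hinj : Function.Injective (fun m : ℕ => m ^ 2) := fun a b hab =>
    Nat.pow_left_injective two_ne_zero hab
  rw [← hinj.hasSum_iff]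
  · convert h using 1
    ext m
    simp only [Function.comp]
    rw [term_natCast _ _ _ (by simp), term_natCast _ _ _ (by simp)]
    simp only [Pi.mul_apply, moebiusSq_sq, principalChar_apply, Nat.coprime_pow_left_iff two_pos]
    push_cast
    rw [← pow_mul]
  · intro n hn
    have : moebiusSq n = 0 := if_neg fun ⟨r, hr⟩ => hn ⟨r, by simp only [hr]; ring⟩
    rw [term_natCast _ _ _ (by simp)]
    simp [this]

/-- This is the inverse of the `L`-value of the trivial character modulo `ℓ`, which is `ζ(2k)`
without its Euler factors at `p ∣ ℓ`. -/
theorem lseries_moebius_principalChar {ℓ : ℕ} (hℓ : ℓ ≠ 0) {k : ℕ} (hk : 1 < k) :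
    LSeries (principalChar ℓ * fun n => (ArithmeticFunction.moebius n : ℂ)) (2 * k : ℕ) =
      (riemannZeta (2 * (k : ℂ)))⁻¹ *
        ∏ p ∈ ℓ.primeFactors, 1 / (1 - (p : ℂ) ^ (-(2 * (k : ℤ)))) := by
  have : NeZero ℓ := ⟨hℓ⟩
  have hs : 1 < ((2 * k : ℕ) : ℂ).re := by
    rw [Complex.natCast_re]; exact_mod_cast (by omega : 1 < 2 * k)
  have h1 := DirichletCharacter.LSeries.mul_mu_eq_one (1 : DirichletCharacter ℂ ℓ) hs
  have h2 := DirichletCharacter.LFunctionTrivChar_eq_mul_riemannZeta (N := ℓ)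
    (s := ((2 * k : ℕ) : ℂ)) (by exact_mod_cast (by omega : 2 * k ≠ 1))
  rw [DirichletCharacter.LFunctionTrivChar,
    DirichletCharacter.LFunction_eq_LSeries _ hs] at h2
  rw [h2] at h1
  have h3 := eq_inv_of_mul_eq_one_right h1
  refine h3.trans ?_
  rw [mul_inv, mul_comm, ← Finset.prod_inv_distrib]
  push_cast
  congr 1
  refine Finset.prod_congr rfl fun p _ => ?_
  rw [one_div]
  congr 2
  rw [← Complex.cpow_intCast]
  push_cast
  rfl

/-- The series is finite. A pair `(a, r)` sits at `n = a r²` with weight `r`, so it contributes `a⁻ᵏ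
r¹⁻²ᵏ`, whence the divisor sum of exponent `1 - 2k`. -/
theorem lseriesHasSum_conductorArith (χ : ℕ → ℤ) (f ℓ : ℕ) (k : ℕ) :
    LSeriesHasSum (principalChar ℓ * fun n => (conductorArith χ f n : ℂ)) k
      (∑ a ∈ f.divisors.filter (fun a => a.Coprime ℓ),
        (ArithmeticFunction.moebius a : ℂ) * (χ a : ℂ) *
          (a : ℂ) ^ (-(k : ℤ)) * coprimeSigma ℓ (1 - 2 * (k : ℤ)) (f / a)) := by
  rw [LSeriesHasSum]
  have h1 : LSeries.term (principalChar ℓ * fun n => (conductorArith χ f n : ℂ)) k =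
      fun n => ∑ x ∈ f.divisors.sigma fun d => (f / d).divisors,
        if n = x.1 * x.2 ^ 2 then principalChar ℓ (x.1 * x.2 ^ 2) *
          (ArithmeticFunction.moebius x.1 * χ x.1 * x.2 : ℤ) / ((x.1 * x.2 ^ 2 : ℕ) : ℂ) ^ k
        else 0 := by
    ext n
    rw [term_natCast _ _ _ (by simp), Pi.mul_apply, conductorArith_apply]
    rw [Int.cast_sum, Finset.mul_sum, Finset.sum_div]
    refine Finset.sum_congr rfl fun x _ => ?_
    by_cases hx : n = x.1 * x.2 ^ 2
    · rw [if_pos hx, if_pos hx.symm, hx]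
    · rw [if_neg hx, if_neg (Ne.symm hx)]; simp
  rw [h1]
  convert hasSum_sum (fun (x : (_ : ℕ) × ℕ) _ => hasSum_ite_eq (x.1 * x.2 ^ 2)
    (principalChar ℓ (x.1 * x.2 ^ 2) * (ArithmeticFunction.moebius x.1 * χ x.1 * x.2 : ℤ) /
      ((x.1 * x.2 ^ 2 : ℕ) : ℂ) ^ k)) using 1
  rw [Finset.sum_sigma, Finset.sum_filter]
  refine Finset.sum_congr rfl fun a ha => ?_
  have ha0 : (a : ℂ) ≠ 0 := by exact_mod_cast (Nat.pos_of_mem_divisors ha).ne'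
  rw [coprimeSigma, Finset.sum_filter]
  split_ifs with hc
  · rw [Finset.mul_sum]
    refine Finset.sum_congr rfl fun r hr => ?_
    have hr0 : (r : ℂ) ≠ 0 := by exact_mod_cast (Nat.pos_of_mem_divisors hr).ne'
    have hiff : (a * r ^ 2).Coprime ℓ ↔ r.Coprime ℓ := by
      rw [Nat.coprime_mul_iff_left, Nat.coprime_pow_left_iff two_pos]
      exact and_iff_right hc
    rw [principalChar_apply]
    simp only [hiff]
    split_ifs with hrc
    · push_cast
      rw [zpow_neg, zpow_natCast, zpow_sub₀ hr0, zpow_one, zpow_mul, zpow_natCast, zpow_ofNat]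
      field_simp
      rw [mul_pow]; ring
    · simp
  · refine (Finset.sum_eq_zero fun r _ => ?_).symm
    rw [principalChar_apply, if_neg]
    · simp
    · rw [Nat.coprime_mul_iff_left]; exact fun h => hc h.1

theorem lseriesHasSum_genusArith {D₀ Dt : ℤ} (hd : IsFundamentalDiscriminant D₀)
    (ht : IsFundamentalDiscriminant Dt) {f : ℕ} (hf : f ≠ 0) {ℓ : ℕ} (hℓ : ℓ ≠ 0) {k : ℕ}
    (hk : 1 < k) :
    LSeriesHasSum (principalChar ℓ * fun n => (genusSum (D₀ * (Dt * f ^ 2)) D₀ n : ℂ)) k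
      ((riemannZeta (2 * (k : ℂ)))⁻¹ *
        (∏ p ∈ ℓ.primeFactors, 1 / (1 - (p : ℂ) ^ (-(2 * (k : ℤ))))) *
        hurwitzClassNumber (1 - (k : ℤ)) ℓ ((-1) ^ (k - 1) * (Dt * (f : ℤ) ^ 2)) *
        hurwitzClassNumber (1 - (k : ℤ)) ℓ ((-1) ^ (k - 1) * D₀)) := by
  have hs : 1 < ((k : ℕ) : ℂ).re := by
    rw [Complex.natCast_re]; exact_mod_cast hk
  have hA := lseriesSummable_kroneckerArith D₀ ℓ hs
  have hB := lseriesSummable_kroneckerArith Dt ℓ hs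
  have hF := lseriesHasSum_conductorArith (kroneckerSymbol Dt) f ℓ k
  have hM := lseriesHasSum_moebiusSq ℓ hk
  have hH := ((hA.LSeriesHasSum.convolution hB.LSeriesHasSum).convolution hF).convolution hM
  rw [← principalChar_mul_convolution_intCast, ← principalChar_mul_convolution_intCast,
    ← principalChar_mul_convolution_intCast, ← genusArith_eq hd ht hf] at hH
  simp only [genusArith_apply] at hH
  convert hH using 1
  -- Since `D₀` is fundamental its class number has `m = 1`, so the divisor sum is `1` and only the
  -- `L`-value remains.
  have h0 := hurwitzClassNumber_eq hk.le ℓ hd (m := 1) one_ne_zero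
  rw [Nat.cast_one, one_pow, mul_one] at h0
  rw [hurwitzClassNumber_eq hk.le ℓ ht hf, h0, lseries_kroneckerArith, lseries_kroneckerArith,
    lseries_moebius_principalChar hℓ hk]
  have h1 : ∑ a ∈ (Nat.divisors 1).filter (fun a => a.Coprime ℓ),
        (ArithmeticFunction.moebius a : ℂ) * (kroneckerSymbol D₀ a : ℂ) *
          (a : ℂ) ^ (-(k : ℤ)) * coprimeSigma ℓ (1 - 2 * (k : ℤ)) (1 / a) = 1 := by
    simp [Finset.filter_singleton, coprimeSigma, kroneckerSymbol_one_right]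
  rw [h1]
  ring

theorem hasSum_cInftyTerm {k N : ℕ} (hk : 1 < k) (hN : Squarefree N) {D₀ Dt : ℤ}
    (hd : IsFundamentalDiscriminant D₀) (ht : IsFundamentalDiscriminant Dt) {f : ℕ} (hf : f ≠ 0) :
    HasSum (fun a : ℕ => (cInftyTerm k N (D₀ * (Dt * f ^ 2)) D₀ a : ℂ))
      ((riemannZeta (2 * (k : ℂ)))⁻¹ *
        ∑ ℓ ∈ N.divisors, (ArithmeticFunction.moebius ℓ : ℂ) *
          (∏ p ∈ ℓ.primeFactors, 1 / (1 - (p : ℂ) ^ (-(2 * (k : ℤ))))) *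
          hurwitzClassNumber (1 - (k : ℤ)) ℓ ((-1) ^ (k - 1) * (Dt * (f : ℤ) ^ 2)) *
          hurwitzClassNumber (1 - (k : ℤ)) ℓ ((-1) ^ (k - 1) * D₀)) := by
  have h := hasSum_sum (s := N.divisors) fun ℓ hℓ =>
    (lseriesHasSum_genusArith hd ht hf (Nat.pos_of_mem_divisors hℓ).ne' hk).mul_left
      (ArithmeticFunction.moebius ℓ : ℂ)
  have hfun : (fun a : ℕ => (cInftyTerm k N (D₀ * (Dt * f ^ 2)) D₀ a : ℂ)) =
      fun a => ∑ ℓ ∈ N.divisors, (ArithmeticFunction.moebius ℓ : ℂ) *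
        LSeries.term (principalChar ℓ * fun n => (genusSum (D₀ * (Dt * f ^ 2)) D₀ n : ℂ)) k a := by
    funext a
    have hterm : ∀ ℓ ∈ N.divisors, (ArithmeticFunction.moebius ℓ : ℂ) *
        LSeries.term (principalChar ℓ * fun n => (genusSum (D₀ * (Dt * f ^ 2)) D₀ n : ℂ)) k a =
        (genusSum (D₀ * (Dt * f ^ 2)) D₀ a : ℂ) / (a : ℂ) ^ k *
          ((ArithmeticFunction.moebius ℓ : ℂ) * (if a.Coprime ℓ then 1 else 0)) := fun ℓ _ => by
      rw [term_natCast _ _ _ (by simp [genusSum]), Pi.mul_apply, principalChar_apply]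
      ring
    rw [Finset.sum_congr rfl hterm, ← Finset.mul_sum, sum_moebius_coprime hN, cInftyTerm]
    rcases Nat.eq_zero_or_pos a with rfl | ha
    · simp [genusSum]
    · simp only [ha, true_and]
      split_ifs
      · push_cast; ring
      · simp
  rw [hfun, Finset.mul_sum]
  convert h using 1
  · rfl
  · exact Finset.sum_congr rfl fun ℓ _ => by ring

end LSeriesIdentities

theorem theorem1p5 (k N : ℕ) (hk : 1 < k) (hN : Squarefree N)
    (D₀ : ℤ) (hD₀ : IsFundamentalDiscriminant D₀) (hD₀_pos : 0 < D₀)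
    (Dt : ℤ) (hDt : IsFundamentalDiscriminant Dt) (hDt_pos : 0 < Dt)
    (f : ℕ) (hf : 0 < f) (D : ℤ) (hD : D = Dt * (f : ℤ) ^ 2) :
    Summable (cInftyTerm k N (D * D₀) D₀) ∧
    (2 * (k : ℝ) - 1) / ((D * D₀ : ℤ) : ℝ) ^ ((k : ℝ) - 1 / 2) * cInfty k N (D * D₀) D₀ =
      Real.pi / (2 : ℝ) ^ (2 * (k : ℤ) - 2) *
        ((2 * (k : ℝ) - 1) / ((D * D₀ : ℤ) : ℝ) ^ ((k : ℝ) - 1 / 2) *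
          (((2 * k - 2).choose (k - 1) : ℝ) / (-1 : ℝ) ^ k) * gammaConst k N (D * D₀) D₀) ∧
    (((2 * (k : ℝ) - 1) / ((D * D₀ : ℤ) : ℝ) ^ ((k : ℝ) - 1 / 2) *
        cInfty k N (D * D₀) D₀ : ℝ) : ℂ) =
      (Real.pi : ℂ) / ((2 : ℂ) ^ (2 * (k : ℤ) - 2) * riemannZeta (2 * (k : ℂ))) *
        ∑ ℓ ∈ N.divisors, (ArithmeticFunction.moebius ℓ : ℂ) *
          (∏ p ∈ ℓ.primeFactors, 1 / (1 - (p : ℂ) ^ (-(2 * (k : ℤ))))) *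
          hurwitzClassNumber (1 - (k : ℤ)) ℓ ((-1) ^ (k - 1) * D) *
          hurwitzClassNumber (1 - (k : ℤ)) ℓ ((-1) ^ (k - 1) * D₀) := by
  have hsum := hasSum_cInftyTerm hk hN hD₀ hDt hf.ne'
  rw [← hD, mul_comm D₀ D] at hsum
  have hpos : (0 : ℝ) < ((D * D₀ : ℤ) : ℝ) := by
    rw [hD]; exact_mod_cast (by positivity : 0 < Dt * (f : ℤ) ^ 2 * D₀)
  have hpow : ((D * D₀ : ℤ) : ℝ) ^ ((k : ℝ) - 1 / 2) ≠ 0 := (Real.rpow_pos_of_pos hpos _).ne'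
  have hk' : 2 * (k : ℝ) - 1 ≠ 0 := by
    have : (1 : ℝ) < k := by exact_mod_cast hk
    linarith
  -- For real series, `Summable` is absolute convergence.
  refine ⟨Complex.summable_ofReal.mp hsum.summable, ?_, ?_⟩
  · have h2 : (2 : ℝ) ^ (2 * (k : ℤ) - 2) ≠ 0 := zpow_ne_zero _ two_ne_zero
    have hc : ((2 * k - 2).choose (k - 1) : ℝ) ≠ 0 := by
      exact_mod_cast (Nat.choose_pos (by omega)).ne'
    have hm : (-1 : ℝ) ^ k ≠ 0 := pow_ne_zero _ (by norm_num)
    have hpi := Real.pi_ne_zero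
    rw [gammaConst]
    field_simp
  · have h1 : (2 * (k : ℝ) - 1) / ((D * D₀ : ℤ) : ℝ) ^ ((k : ℝ) - 1 / 2) *
        cInfty k N (D * D₀) D₀ =
        Real.pi / (2 : ℝ) ^ (2 * (k : ℤ) - 2) * ∑' a : ℕ, cInftyTerm k N (D * D₀) D₀ a := by
      rw [cInfty, show (2 : ℤ) - 2 * (k : ℤ) = -(2 * (k : ℤ) - 2) by ring, zpow_neg]
      field_simp
    rw [h1, Complex.ofReal_mul, Complex.ofReal_tsum, hsum.tsum_eq]
    push_cast
    rw [div_mul_eq_div_div, div_mul_eq_mul_div, div_eq_mul_inv (_ / _) (riemannZeta _)]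
    ring
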